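/- Let $A=(a_{ij})_{i,j\in I}$ be a symmetrizable generalized Cartan matrix over a finite index set $I$, with a realization $(\mathfrak h,\{\alpha_i\},\{\alpha_i^\vee\})$ over $\mathbb C$, and let $\mathfrak g=\mathfrak g(A)$ be the Kac--Moody algebra generated by $\mathfrak h$ and $e_i,f_i$ ($i\in I$) subject to the Chevalley--Serre relations. Write $\mathfrak g_\alpha$ for the root spaces, $\Delta^{\pm}$ for the sets of positive and negative roots, $\Delta=\Delta^+\cup\Delta^-$, $\mathfrak n^+=\bigoplus_{\alpha\in\Delta^+}\mathfrak g_\alpha$ and $Q$ for the root lattice. Let $P\subseteq\mathfrak h^*$ be an additive subgroup containing $Q$ (for instance a restricted weight lattice). A \emph{standard graded module} is a $\mathfrak g$-module $V$ (with representation $\rho$) that is the direct sum of its weight spaces $V_\mu$, all finite dimensional, with all weights in $P$, together with an additive map $f:P\to\mathbb Z$ such that for every $m\in\mathbb Z$: the sets $\Delta_m=\{\alpha\in\Delta\cup\{0\}: f(\alpha)=m\}$ and $\{\mu \text{ a weight of } V: f(\mu)=m\}$ are finite; $\Delta_m\subseteq\Delta^+$ if $m>0$, $\Delta_0=\{0\}$,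 and $\Delta_m\subseteq\Delta^-$ if $m<0$; and distinct weights $\mu,\nu$ of $V$ with $f(\mu)=f(\nu)=m$ never satisfy $\nu-\mu\in\sum_i\mathbb Z_{\ge0}\alpha_i$. Put $V_m=\bigoplus_{f(\mu)=m}V_\mu$, $\mathfrak g_m=\bigoplus_{\alpha\in\Delta_m}\mathfrak g_\alpha$ and $\widehat V=\bigoplus_{m<0}V_m\oplus\prod_{m\ge0}V_m$, with the topology induced from the product $\prod_{m\in\mathbb Z}V_m$ of finite-dimensional complex vector spaces; give the group $\mathrm{GL}(\widehat V)$ of all linear automorphisms of $\widehat V$ the topology of pointwise convergence. For $k>0$ and $x\in\mathfrak g_k$ the operator $\exp(\rho(x))\in\mathrm{GL}(\widehat V)$ is given by the exponential series, each component of whose value at a vector is a finite sum. Let $U^+_V\le\mathrm{GL}(\widehat V)$ be the subgroup generated by all $\exp(t\rho(e_i))$ ($i\in I$, $t\in\mathbb C$), and let $$\widehat U^+_{V,1}=\Big\{\prod_{k=1}^{\infty}\exp(\rho(x_k)) : x_k\in\mathfrak g_k\Big\},\qquad \prod_{k=1}^\infty \exp(\rho(x_k)):=\lim_{n\to\infty}\exp(\rho(x_n))\cdots\exp(\rho(x_2))\exp(\rho(x_1)).$$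 Suppose that $V$ is faithful, in the sense that every nonzero element of $\mathfrak n^+$ acts on $V$ as a nonzero operator (this holds whenever $\rho$ is injective, and also for the adjoint module). Then all the above limits exist in $\mathrm{GL}(\widehat V)$, the set $\widehat U^+_{V,1}$ is a subgroup of $\mathrm{GL}(\widehat V)$, and $$\widehat U^+_{V,1}=\widehat U^+_V,\quad\text{the topological closure of } U^+_V \text{ in } \mathrm{GL}(\widehat V).$$ Consequently $\widehat U=\widehat U^+_V$ is independent of the choice of $V$: if $W$ is another faithful standard graded $\mathfrak g$-module (with representation $\rho'$ and its own subgroup $P'\supseteq Q$ and grading function $f'$), then there is exactly one group isomorphism $\Phi:\widehat U^+_V\to\widehat U^+_W$ that is a homeomorphism and satisfies $\Phi(\exp\rho(x))=\exp\rho'(x)$ for every $x\in\mathfrak g$ that is homogeneous of positive degree for both gradings of $\mathfrak g$ (in particular for every root vector $x\in\mathfrak g_\alpha$, $\alpha\in\Delta^+$). -/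

import Mathlib

open Topology Filter

noncomputable section

/-! Kac-Moody algebras -/

namespace KacMoody

/-- Symmetrizable generalized Cartan matrices. -/
structure IsSymmetrizableGCM {ι : Type*} [Fintype ι] [DecidableEq ι] (A : Matrix ι ι ℤ) :
    Prop where
  diag : ∀ i, A i i = 2
  nonpos : ∀ i j, i ≠ j → A i j ≤ 0
  zero : ∀ i j, A i j = 0 → A j i = 0
  symmetrizable : ∃ d : ι → ℚ, (∀ i, 0 < d i) ∧
    (Matrix.diagonal d * A.map (Int.cast : ℤ → ℚ)).IsSymm

/-- A realization of the matrix `A` on the complex vector space `H` (the Cartan subalgebra), with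
simple roots `root i` and simple coroots `coroot i`. -/
structure Realization {ι : Type*} [Fintype ι] (A : Matrix ι ι ℤ)
    (H : Type*) [AddCommGroup H] [Module ℂ H] where
  finiteDimensional : FiniteDimensional ℂ H
  finrank_add_rank : Module.finrank ℂ H + (A.map (Int.cast : ℤ → ℂ)).rank = 2 * Fintype.card ι
  root : ι → Module.Dual ℂ H
  coroot : ι → H
  root_linearIndependent : LinearIndependent ℂ root
  coroot_linearIndependent : LinearIndependent ℂ coroot
  pairing : ∀ i j, root j (coroot i) = A i j

/-- Generators of the Kac-Moody algebra: the elements of `H`, and `e i`, `f i`. -/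
inductive Gen (ι H : Type*) : Type _
  | h : H → Gen ι H
  | e : ι → Gen ι H
  | f : ι → Gen ι H

section Algebra

variable {ι : Type*} [Fintype ι] {A : Matrix ι ι ℤ} {H : Type*} [AddCommGroup H] [Module ℂ H]

/-- The generator of the free Lie algebra given by `x : H`. -/
abbrev genH (ι : Type*) {H : Type*} (x : H) : FreeLieAlgebra ℂ (Gen ι H) :=
  FreeLieAlgebra.of ℂ (Gen.h x)

/-- The generator `e i` of the free Lie algebra. -/
abbrev genE {ι : Type*} (H : Type*) (i : ι) : FreeLieAlgebra ℂ (Gen ι H) :=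
  FreeLieAlgebra.of ℂ (Gen.e i)

/-- The generator `f i` of the free Lie algebra. -/
abbrev genF {ι : Type*} (H : Type*) (i : ι) : FreeLieAlgebra ℂ (Gen ι H) :=
  FreeLieAlgebra.of ℂ (Gen.f i)

/-- The defining relations: `Relator R z` says that `z` is one of the elements of the free Lie
algebra that are set to zero. The first two families make `H` a vector space inside the algebra. -/
inductive Relator (R : Realization A H) : FreeLieAlgebra ℂ (Gen ι H) → Prop
  | h_add (x y : H) : Relator R ((genH ι (x + y)) - ((genH ι x) + (genH ι y)))
  | h_smul (c : ℂ) (x : H) : Relator R ((genH ι (c • x)) - c • (genH ι x))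
  | hh (x y : H) : Relator R ⁅genH ι x, genH ι y⁆
  | he (x : H) (i : ι) : Relator R (⁅genH ι x, genE H i⁆ - R.root i x • (genE H i))
  | hf (x : H) (i : ι) : Relator R (⁅genH ι x, genF H i⁆ + R.root i x • (genF H i))
  | ef_same (i : ι) : Relator R (⁅genE H i, genF H i⁆ - (genH ι (R.coroot i)))
  | ef_ne (i j : ι) : i ≠ j → Relator R ⁅genE H i, genF H j⁆
  | serre_e (i j : ι) : i ≠ j →
      Relator R (((LieAlgebra.ad ℂ (FreeLieAlgebra ℂ (Gen ι H)) (genE H i)) ^ (1 - A i j).toNat) (genE H j))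
  | serre_f (i j : ι) : i ≠ j →
      Relator R (((LieAlgebra.ad ℂ (FreeLieAlgebra ℂ (Gen ι H)) (genF H i)) ^ (1 - A i j).toNat) (genF H j))

/-- The ideal generated by the defining relations. -/
def relIdeal (R : Realization A H) : LieIdeal ℂ (FreeLieAlgebra ℂ (Gen ι H)) :=
  LieSubmodule.lieSpan ℂ _ {z | Relator R z}

/-- The Kac-Moody algebra `𝔤(A)` of a realization of `A`. -/
def KMAlgebra (R : Realization A H) : Type _ := FreeLieAlgebra ℂ (Gen ι H) ⧸ relIdeal R

instance (R : Realization A H) : LieRing (KMAlgebra R) :=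
  inferInstanceAs (LieRing (FreeLieAlgebra ℂ (Gen ι H) ⧸ relIdeal R))

instance (R : Realization A H) : LieAlgebra ℂ (KMAlgebra R) :=
  inferInstanceAs (LieAlgebra ℂ (FreeLieAlgebra ℂ (Gen ι H) ⧸ relIdeal R))

/-- The quotient map from the free Lie algebra. -/
def mk (R : Realization A H) (z : FreeLieAlgebra ℂ (Gen ι H)) : KMAlgebra R :=
  LieSubmodule.Quotient.mk (N := relIdeal R) z

/-- The image of `x : H` in the Kac-Moody algebra. -/
def cartan (R : Realization A H) (x : H) : KMAlgebra R := mk R (genH ι x)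

/-- The simple root vector `e_i`. -/
def eVec (R : Realization A H) (i : ι) : KMAlgebra R := mk R (genE H i)

/-- The negative simple root vector `f_i`. -/
def fVec (R : Realization A H) (i : ι) : KMAlgebra R := mk R (genF H i)

end Algebra

/-! Weight spaces, roots, standard gradings -/

section Weights

variable {ι : Type*} [Fintype ι] {A : Matrix ι ι ℤ} {H : Type*} [AddCommGroup H] [Module ℂ H]
  (R : Realization A H)

/-- The weight space `V_μ` of a `𝔤`-module `V`. -/
def weightSpace (V : Type*) [AddCommGroup V] [Module ℂ V] [LieRingModule (KMAlgebra R) V]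
    [LieModule ℂ (KMAlgebra R) V] (μ : Module.Dual ℂ H) : Submodule ℂ V where
  carrier := {v | ∀ x : H, ⁅cartan R x, v⁆ = μ x • v}
  zero_mem' := by simp
  add_mem' := by
    intro v w hv hw x
    rw [lie_add, hv x, hw x, smul_add]
  smul_mem' := by
    intro c v hv x
    rw [lie_smul, hv x, smul_comm]

/-- The weights of `V`. -/
def wts (V : Type*) [AddCommGroup V] [Module ℂ V] [LieRingModule (KMAlgebra R) V]
    [LieModule ℂ (KMAlgebra R) V] : Set (Module.Dual ℂ H) :=
  {μ | weightSpace R V μ ≠ ⊥}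

/-- The root space `𝔤_α`, that is, a weight space of the adjoint module. -/
abbrev rootSpace (α : Module.Dual ℂ H) : Submodule ℂ (KMAlgebra R) :=
  weightSpace R (KMAlgebra R) α

/-- The set of roots `Δ`. -/
def roots : Set (Module.Dual ℂ H) := {α | α ≠ 0 ∧ rootSpace R α ≠ ⊥}

/-- `Q⁺`, the set of sums of simple roots with coefficients in the natural numbers. -/
def posCone : Set (Module.Dual ℂ H) := {α | ∃ k : ι → ℕ, α = ∑ i, k i • R.root i}

/-- The positive roots `Δ⁺`. -/
def posRoots : Set (Module.Dual ℂ H) := {α | α ∈ roots R ∧ α ∈ posCone R}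

/-- The negative roots `Δ⁻`. -/
def negRoots : Set (Module.Dual ℂ H) := {α | α ∈ roots R ∧ -α ∈ posCone R}

/-- `𝔫⁺`, the sum of the positive root spaces. -/
def nPlus : Submodule ℂ (KMAlgebra R) := ⨆ α ∈ posRoots R, rootSpace R α

variable {P : AddSubgroup (Module.Dual ℂ H)} (f : P →+ ℤ)

/-- The homogeneous component `V_m`, the sum of the weight spaces `V_μ` with `f μ = m`. For the
adjoint module this is `𝔤_m`. -/
def piece (V : Type*) [AddCommGroup V] [Module ℂ V] [LieRingModule (KMAlgebra R) V]
    [LieModule ℂ (KMAlgebra R) V] (m : ℤ) : Submodule ℂ V :=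
  ⨆ (μ : P) (_ : f μ = m), weightSpace R V μ

/-- The homogeneous component `𝔤_m`. -/
abbrev gPiece (m : ℤ) : Submodule ℂ (KMAlgebra R) := piece R f (KMAlgebra R) m

/-- `V` is a weight module with all weights in `P`, and the additive map `f : P → ℤ` makes it a
standard graded module. (Weight spaces for distinct weights are always linearly independent, so
`iSup_weightSpace` says that `V` is the direct sum of its weight spaces.) -/
structure IsStandardGraded (V : Type*) [AddCommGroup V] [Module ℂ V]
    [LieRingModule (KMAlgebra R) V] [LieModule ℂ (KMAlgebra R) V] : Prop where
  iSup_weightSpace : ⨆ μ, weightSpace R V μ = ⊤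
  finiteDimensional : ∀ μ, FiniteDimensional ℂ (weightSpace R V μ)
  wts_subset : wts R V ⊆ P
  finite_roots : ∀ m : ℤ, {α : P | ((α : Module.Dual ℂ H) ∈ roots R ∨ α = 0) ∧ f α = m}.Finite
  finite_wts : ∀ m : ℤ, {μ : P | (μ : Module.Dual ℂ H) ∈ wts R V ∧ f μ = m}.Finite
  pos : ∀ α : P, (α : Module.Dual ℂ H) ∈ roots R → 0 < f α →
    (α : Module.Dual ℂ H) ∈ posRoots R
  neg : ∀ α : P, (α : Module.Dual ℂ H) ∈ roots R → f α < 0 →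
    (α : Module.Dual ℂ H) ∈ negRoots R
  ne_zero : ∀ α : P, (α : Module.Dual ℂ H) ∈ roots R → f α ≠ 0
  incomparable : ∀ μ ν : P, (μ : Module.Dual ℂ H) ∈ wts R V → (ν : Module.Dual ℂ H) ∈ wts R V →
    f μ = f ν → (ν - μ : Module.Dual ℂ H) ∈ posCone R → μ = ν

/-- Nonzero elements of `𝔫⁺` act as nonzero operators on `V`. This holds if `𝔤` acts faithfully on
`V`, and also for the adjoint module when `𝔤` has a nonzero centre. -/
def NPlusFaithful (V : Type*) [AddCommGroup V] [Module ℂ V]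
    [LieRingModule (KMAlgebra R) V] [LieModule ℂ (KMAlgebra R) V] : Prop :=
  ∀ x ∈ nPlus R, (∀ v : V, ⁅x, v⁆ = 0) → x = 0

end Weights

/-! Positive completions of graded vector spaces, and their linear groups -/

section Completion

variable {V : Type*} [AddCommGroup V] [Module ℂ V] (G : ℤ → Submodule ℂ V)

/-- The positive completion `⨁_{m<0} G m ⊕ ∏_{m≥0} G m`: families that vanish in all sufficiently
negative degrees. -/
def completion : Submodule ℂ (∀ m, G m) where
  carrier := {v | ∃ N : ℤ, ∀ m < N, v m = 0}
  zero_mem' := ⟨0, fun _ _ => rfl⟩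
  add_mem' := by
    rintro v w ⟨N, hN⟩ ⟨M, hM⟩
    refine ⟨min N M, fun m hm => ?_⟩
    rw [Pi.add_apply, hN m (lt_of_lt_of_le hm (min_le_left _ _)),
      hM m (lt_of_lt_of_le hm (min_le_right _ _)), add_zero]
  smul_mem' := by
    rintro c v ⟨N, hN⟩
    exact ⟨N, fun m hm => by rw [Pi.smul_apply, hN m hm, smul_zero]⟩

/-- The topology of the completion: the subspace topology from the product `∏ m, G m`, where each
`G m` carries its topology as a (finite-dimensional) complex vector space. -/
instance completionTopology : TopologicalSpace (completion G) :=
  TopologicalSpace.induced (fun v => (v : ∀ m, G m))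
    (@Pi.topologicalSpace ℤ (fun m => G m) (fun m => moduleTopology ℂ (G m)))

/-- `GL(V̂)`, the group of all linear automorphisms of the completion. -/
abbrev GLHat : Type _ := completion G ≃ₗ[ℂ] completion G

/-- The topology of `GL(V̂)` induced by that of `V̂`: pointwise convergence. -/
instance glTopology : TopologicalSpace (GLHat G) :=
  TopologicalSpace.induced (fun g => (g : completion G → completion G)) inferInstance

variable {G}

/-- The operator `D` raises degrees: it maps `∏_{m≥N} G m` into `∏_{m≥N+1} G m` for every `N`. -/
def Raises (D : Module.End ℂ (completion G)) : Prop :=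
  ∀ (N : ℤ) (v : completion G), (∀ m < N, v.1 m = 0) → ∀ m < N + 1, (D v).1 m = 0

theorem Raises.pow {D : Module.End ℂ (completion G)} (hD : Raises D) (n : ℕ) (N : ℤ)
    (v : completion G) (hv : ∀ m < N, v.1 m = 0) : ∀ m < N + n, ((D ^ n) v).1 m = 0 := by
  induction n with
  | zero => simpa using hv
  | succ n ih =>
    intro m hm
    rw [pow_succ', Module.End.mul_apply]
    exact hD (N + n) _ ih m (by push_cast at hm; lia)

theorem Raises.finite_support {D : Module.End ℂ (completion G)} (hD : Raises D) (c : ℕ → ℂ)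
    (v : completion G) (m : ℤ) :
    (Function.support fun n : ℕ => c n • ((D ^ n) v).1 m).Finite := by
  obtain ⟨N, hN⟩ := v.2
  refine (Set.finite_lt_nat (m - N + 1).toNat).subset fun n hn => ?_
  by_contra hlt
  refine hn ?_
  have : m < N + n := by simp only [Set.mem_ofPred_eq] at hlt; lia
  simp only [hD.pow n N v hN m this, smul_zero]

theorem Raises.finsum_eq_zero {D : Module.End ℂ (completion G)} (hD : Raises D) (c : ℕ → ℂ)
    (v : completion G) {N : ℤ} (hv : ∀ m < N, v.1 m = 0) (m : ℤ) (hm : m < N) :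
    ∑ᶠ n : ℕ, c n • ((D ^ n) v).1 m = 0 := by
  refine finsum_eq_zero_of_forall_eq_zero fun n => ?_
  rw [hD.pow n N v hv m (by lia), smul_zero]

/-- The pro-summable series `∑ n, c n • D ^ n` for an operator `D` that raises degrees: each
component of its value at `v` is a finite sum. -/
def proSum (c : ℕ → ℂ) (D : Module.End ℂ (completion G)) (hD : Raises D) :
    Module.End ℂ (completion G) where
  toFun v := ⟨fun m => ∑ᶠ n : ℕ, c n • ((D ^ n) v).1 m, by
    obtain ⟨N, hN⟩ := v.2
    exact ⟨N, hD.finsum_eq_zero c v hN⟩⟩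
  map_add' v w := by
    refine Subtype.ext (funext fun m => ?_)
    change ∑ᶠ n : ℕ, c n • ((D ^ n) (v + w)).1 m =
      ∑ᶠ n : ℕ, c n • ((D ^ n) v).1 m + ∑ᶠ n : ℕ, c n • ((D ^ n) w).1 m
    rw [← finsum_add_distrib (hD.finite_support c v m) (hD.finite_support c w m)]
    refine finsum_congr fun n => ?_
    rw [map_add, ← smul_add]
    rfl
  map_smul' a v := by
    refine Subtype.ext (funext fun m => ?_)
    change ∑ᶠ n : ℕ, c n • ((D ^ n) (a • v)).1 m = a • ∑ᶠ n : ℕ, c n • ((D ^ n) v).1 m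
    rw [smul_finsum' a (hD.finite_support c v m)]
    refine finsum_congr fun n => ?_
    rw [map_smul, smul_comm]
    rfl

theorem Raises.injective {g : Module.End ℂ (completion G)} (hg : Raises (g - 1)) :
    Function.Injective g := by
  refine (injective_iff_map_eq_zero g).2 fun v hv => ?_
  have key : (g - 1) v = -v := by
    rw [LinearMap.sub_apply, hv, zero_sub, Module.End.one_apply]
  obtain ⟨N, hN⟩ := v.2
  have all : ∀ k : ℕ, ∀ m < N + k, v.1 m = 0 := by
    intro k
    induction k with
    | zero => simpa using hN
    | succ k ih =>
      intro m hm
      have h1 := hg (N + k) v ih m (by push_cast at hm; lia)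
      rw [key] at h1
      exact neg_eq_zero.1 h1
  refine Subtype.ext (funext fun m => ?_)
  exact all (m - N + 1).toNat m (by lia)

theorem Raises.neg {D : Module.End ℂ (completion G)} (hD : Raises D) : Raises (-D) := by
  intro N v hv m hm
  change -(D v).1 m = 0
  rw [hD N v hv m hm, neg_zero]

theorem Raises.surjective {g : Module.End ℂ (completion G)} (hg : Raises (g - 1)) :
    Function.Surjective g := by
  intro w
  have hT := hg.neg
  set T : Module.End ℂ (completion G) := -(g - 1) with hTdef
  have hgT : g = 1 - T := by rw [hTdef]; abel
  set v := proSum (fun _ => 1) T hT w with hvdef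
  refine ⟨v, Subtype.ext (funext fun m => ?_)⟩
  obtain ⟨N, hN⟩ := w.2
  -- partial sums agree with `v` in low degrees
  set K : ℕ := (m - N + 1).toNat with hK
  have hmK : m < N + K := by lia
  set p : completion G := (∑ n ∈ Finset.range K, T ^ n) w with hp
  have hlow : ∀ j < N + (K : ℤ), (v - p).1 j = 0 := by
    intro j hj
    have hvj : v.1 j = ∑ᶠ n : ℕ, (1 : ℂ) • ((T ^ n) w).1 j := rfl
    have hpj : p.1 j = ∑ n ∈ Finset.range K, ((T ^ n) w).1 j := by
      rw [hp, LinearMap.sum_apply, Submodule.coe_sum, Finset.sum_apply]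
    have : v.1 j = p.1 j := by
      rw [hvj, hpj, finsum_eq_sum_of_support_subset (s := Finset.range K)]
      · simp
      · intro n hn
        by_contra hlt
        refine hn ?_
        have hle : K ≤ n := by simpa using hlt
        simp only [hT.pow n N w hN j (by lia), smul_zero]
    change v.1 j - p.1 j = 0
    rw [this, sub_self]
  have e1 : (g p).1 m = w.1 m := by
    have hmul : (1 - T) * (∑ n ∈ Finset.range K, T ^ n) = 1 - T ^ K := mul_neg_geom_sum T K
    have : g p = w - (T ^ K) w := by
      rw [hgT, hp, ← Module.End.mul_apply, hmul, LinearMap.sub_apply, Module.End.one_apply]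
    rw [this]
    change w.1 m - ((T ^ K) w).1 m = w.1 m
    rw [hT.pow K N w hN m hmK, sub_zero]
  have e2 : (g (v - p)).1 m = 0 := by
    rw [hgT, LinearMap.sub_apply, Module.End.one_apply]
    change (v - p).1 m - (T (v - p)).1 m = 0
    rw [hlow m hmK, hT _ _ hlow m (by lia), sub_zero]
  have e3 : g v = g (v - p) + g p := by rw [← map_add, sub_add_cancel]
  rw [e3]
  change (g (v - p)).1 m + (g p).1 m = w.1 m
  rw [e1, e2, zero_add]

theorem Raises.proSum_sub_one {D : Module.End ℂ (completion G)} (hD : Raises D) (c : ℕ → ℂ)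
    (hc : c 0 = 1) : Raises (proSum c D hD - 1) := by
  intro N v hv m hm
  change ∑ᶠ n : ℕ, c n • ((D ^ n) v).1 m - v.1 m = 0
  rw [finsum_eq_single _ 0, hc]
  · simp
  · intro n hn
    rw [hD.pow n N v hv m (by lia), smul_zero]

/-- The exponential `∑ n, D ^ n / n!` of an operator `D` that raises degrees, in `GL(V̂)`. -/
def expGL (D : Module.End ℂ (completion G)) (hD : Raises D) : GLHat G :=
  LinearEquiv.ofBijective (proSum (fun n => ((n.factorial : ℂ))⁻¹) D hD)
    ⟨(hD.proSum_sub_one _ (by simp)).injective, (hD.proSum_sub_one _ (by simp)).surjective⟩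

end Completion

/-! The complete unipotent group -/

section Group

variable {ι : Type*} [Fintype ι] {A : Matrix ι ι ℤ} {H : Type*} [AddCommGroup H] [Module ℂ H]
  (R : Realization A H) {P : AddSubgroup (Module.Dual ℂ H)} (f : P →+ ℤ)
  (V : Type*) [AddCommGroup V] [Module ℂ V] [LieRingModule (KMAlgebra R) V]
  [LieModule ℂ (KMAlgebra R) V]

theorem lie_mem_weightSpace {α μ : Module.Dual ℂ H} {x : KMAlgebra R} {v : V}
    (hx : x ∈ rootSpace R α) (hv : v ∈ weightSpace R V μ) : ⁅x, v⁆ ∈ weightSpace R V (α + μ) := by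
  intro y
  rw [leibniz_lie, hx y, hv y, smul_lie, lie_smul, ← add_smul]
  rfl

theorem lie_mem_piece {k j m : ℤ} (hm : k + j = m) {x : KMAlgebra R} {v : V}
    (hx : x ∈ gPiece R f k) (hv : v ∈ piece R f V j) : ⁅x, v⁆ ∈ piece R f V m := by
  have step : ∀ (α : P), f α = k → ∀ y ∈ rootSpace R (α : Module.Dual ℂ H),
      ⁅y, v⁆ ∈ piece R f V m := by
    intro α hα y hy
    have hle : piece R f V j ≤ (piece R f V m).comap (LieModule.toEnd ℂ (KMAlgebra R) V y) := by
      refine iSup₂_le fun μ hμ w hw => ?_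
      have hmem : f (α + μ) = m := by rw [map_add, hα, hμ, hm]
      exact (le_iSup₂_of_le (f := fun (ν : P) (_ : f ν = m) => weightSpace R V ν) (α + μ) hmem
        le_rfl) (lie_mem_weightSpace R V hy hw)
    exact hle hv
  have hle : gPiece R f k ≤ (piece R f V m).comap
      ((LieModule.toEnd ℂ (KMAlgebra R) V : KMAlgebra R →ₗ[ℂ] Module.End ℂ V).flip v) :=
    iSup₂_le fun α hα y hy => step α hα y hy
  exact hle hx

/-- The completion `V̂` of the graded module `V`. -/
abbrev VHat : Submodule ℂ (∀ m, piece R f V m) := completion (piece R f V)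

/-- The group `GL(V̂)`. -/
abbrev GLV : Type _ := GLHat (piece R f V)

/-- The action `ρ(x)` on `V̂` of an element `x` of `𝔤_k`: it sends `(v_m)` to `(x · v_{m-k})`. -/
def rhoHat {k : ℤ} (x : gPiece R f k) : Module.End ℂ (VHat R f V) where
  toFun v := ⟨fun m => ⟨⁅(x : KMAlgebra R), (v.1 (m - k) : V)⁆,
      lie_mem_piece R f V (by ring) x.2 (v.1 (m - k)).2⟩, by
    obtain ⟨N, hN⟩ := v.2
    refine ⟨N + k, fun m hm => Subtype.ext ?_⟩
    simp [hN (m - k) (by lia)]⟩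
  map_add' v w := by
    refine Subtype.ext (funext fun m => Subtype.ext ?_)
    exact lie_add _ _ _
  map_smul' c v := by
    refine Subtype.ext (funext fun m => Subtype.ext ?_)
    exact lie_smul _ _ _

theorem rhoHat_raises {k : ℤ} (hk : 0 < k) (x : gPiece R f k) : Raises (rhoHat R f V x) := by
  intro N v hv m hm
  refine Subtype.ext ?_
  change ⁅(x : KMAlgebra R), (v.1 (m - k) : V)⁆ = 0
  rw [hv (m - k) (by lia)]
  simp

/-- `exp(ρ(x))` in `GL(V̂)`, for `x` homogeneous of positive degree `k`. -/
def expRho {k : ℤ} (hk : 0 < k) (x : gPiece R f k) : GLV R f V :=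
  expGL (rhoHat R f V x) (rhoHat_raises R f V hk x)

/-- The group `U⁺_V` generated by all `χ_i(t) = exp(ρ(t e_i))`. (The degree `k` of `t e_i` is
`f(α_i)`.) -/
def uPlus : Subgroup (GLV R f V) :=
  Subgroup.closure {g | ∃ (i : ι) (t : ℂ) (k : ℤ) (hk : 0 < k) (hx : t • eVec R i ∈ gPiece R f k),
    g = expRho R f V hk ⟨t • eVec R i, hx⟩}

/-- The partial products `exp(ρ(x_n)) ⋯ exp(ρ(x_2)) exp(ρ(x_1))`. -/
def partialProd (x : ∀ k : ℕ, gPiece R f ((k : ℤ) + 1)) : ℕ → GLV R f V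
  | 0 => 1
  | n + 1 => expRho R f V (by lia) (x n) * partialProd x n

/-- `g` is the infinite ordered product `⋯ exp(ρ(x_3)) exp(ρ(x_2)) exp(ρ(x_1))`, where the element
of degree `k + 1` is `x k`. -/
def IsOrderedProd (x : ∀ k : ℕ, gPiece R f ((k : ℤ) + 1)) (g : GLV R f V) : Prop :=
  Tendsto (partialProd R f V x) atTop (𝓝 g)

/-- The set of all infinite ordered products. -/
def uHat : Set (GLV R f V) := {g | ∃ x, IsOrderedProd R f V x g}

end Group

end KacMoody

end

/-!
The infinite products are handled as formal power series. Let `J` be the set of the `i` with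
`e_i ≠ 0`, and for `β : J →₀ ℕ` let `gs R β` be the root space of weight `∑ β_i α_i`. An element
`c = (c_β)` of `∏_{β ≠ 0} 𝔤_β` acts on `V` as the power series `∑ ρ(c_β) X^β` over the (not
necessarily commutative) ring `End V`, and a series of this kind acts on `V̂`, because only
finitely many indices contribute to a given degree (`ev`).

The complete unipotent group is described by a differential equation. Let `D` be the Euler
derivation `X^β ↦ |β| X^β`, for any system of positive integer weights. The series `u` with
constant term `1` whose logarithmic derivative `D(u) u⁻¹` has all its coefficients in the spaces
`ρ(𝔤_β)` form a group (`lieGroup`), because conjugation by `u` preserves the set of the series `Y`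
with coefficients in these spaces: if `D(u) = c u` and `Y` starts in weight `j`, then
`(D - j)(u⁻¹ Y u) = u⁻¹ Z u`, where `Z = D(Y) - j Y - [c, Y]` is again of this kind and starts in
weight `j + 1` (`coeff_conj_mem`). A similar recursion shows that the group does not depend on the
weights (`lieGroup_le`). Sending `c` to the solution of `D(u) = c u` gives coordinates on the
group (`sol`, `solUnit`, `coord`). This replaces the Baker-Campbell-Hausdorff formula: if `u ≡ 1`
modulo weight `k`, then the part of `u` of weight `k` lies in the image of `𝔤` (`exists_step`), so
that every element of the group is an infinite product of exponentials, and every infinite product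
lies in the group (`exists_limit`). Hence the set of ordered products is the range of `toGL`, the
action of the group on `V̂`.

The range is closed. By faithfulness, the components of `c` are continuous functions of the
operators: in weight `k` they are found from the matrix coefficients that raise degrees by `k`,
after the contribution of the lower weights has been subtracted (`exists_continuous_comp`). So the
coordinates are a closed embedding into `GL(V̂)`. The group `U⁺_V` is dense in the range, because
a positive root space is spanned by iterated brackets of the `e_i` (`gs_le_span`, from the
triangular decomposition) and an iterated bracket is the leading term of an iterated group
commutator of exponentials (`exists_mem_simpleGroup_nest`, `exists_approx`).

For two modules, the isomorphism preserves the coordinates `c`. It is multiplicative, and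
compatible with exponentials, because the product of two solutions, or an exponential, can be
computed over the ring `End V × End W`, which gives one logarithmic derivative for both components
(`exists_sol_mul`, `exists_sol_eq_expSer`). It is unique because `U⁺_V` is dense.
-/

noncomputable section

namespace KacMoody

open MvPowerSeries

/-! ### The weight filtration and the Euler derivation on noncommutative power series -/

section Series

variable {σ 𝒜 : Type*} [Ring 𝒜] [Algebra ℂ 𝒜] (n : σ → ℕ)

/-- The series all of whose coefficients of weight less than `k` vanish. The exponent `i` has
weight `n i`. -/
def fil (k : ℕ) : Submodule ℂ (MvPowerSeries σ 𝒜) where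
  carrier := {g | ∀ β, Finsupp.weight n β < k → coeff β g = 0}
  zero_mem' := fun _ _ => map_zero _
  add_mem' := fun hg hh β hβ => by rw [map_add, hg β hβ, hh β hβ, add_zero]
  smul_mem' := fun c g hg β hβ => by
    change c • coeff β g = 0
    rw [hg β hβ, smul_zero]

variable {n}

theorem coeff_smul' (c : ℂ) (g : MvPowerSeries σ 𝒜) (β : σ →₀ ℕ) :
    coeff β (c • g) = c • coeff β g := rfl

theorem mem_fil_zero (g : MvPowerSeries σ 𝒜) : g ∈ fil n 0 :=
  fun _ h => absurd h (Nat.not_lt_zero _)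

theorem fil_anti {j k : ℕ} (h : j ≤ k) : fil (𝒜 := 𝒜) n k ≤ fil n j :=
  fun _ hg β hβ => hg β (hβ.trans_le h)

theorem mul_mem_fil {j k : ℕ} {g h : MvPowerSeries σ 𝒜} (hg : g ∈ fil n j) (hh : h ∈ fil n k) :
    g * h ∈ fil n (j + k) := by
  classical
  intro β hβ
  rw [coeff_mul]
  refine Finset.sum_eq_zero fun p hp => ?_
  rw [← Finset.HasAntidiagonal.mem_antidiagonal.1 hp, map_add] at hβ
  by_cases h1 : Finsupp.weight n p.1 < j
  · rw [hg _ h1, zero_mul]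
  · rw [hh _ (by lia), mul_zero]

theorem mul_mem_fil_left {k : ℕ} (g : MvPowerSeries σ 𝒜) {h : MvPowerSeries σ 𝒜}
    (hh : h ∈ fil n k) : g * h ∈ fil n k := by
  simpa using mul_mem_fil (mem_fil_zero g) hh

theorem mul_mem_fil_right {k : ℕ} {g : MvPowerSeries σ 𝒜} (h : MvPowerSeries σ 𝒜)
    (hg : g ∈ fil n k) : g * h ∈ fil n k := by
  simpa using mul_mem_fil hg (mem_fil_zero h)

theorem pow_mem_fil {k : ℕ} {g : MvPowerSeries σ 𝒜} (hg : g ∈ fil n k) (m : ℕ) :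
    g ^ m ∈ fil n (m * k) := by
  induction m with
  | zero => simpa using mem_fil_zero _
  | succ m ih => rw [pow_succ, add_mul, one_mul]; exact mul_mem_fil ih hg

theorem eq_zero_of_mem_fil {g : MvPowerSeries σ 𝒜} (hg : ∀ k, g ∈ fil n k) : g = 0 := by
  ext β
  exact hg _ β (Nat.lt_succ_self _)

theorem weight_ne_zero (hn : ∀ i, n i ≠ 0) {β : σ →₀ ℕ} (hβ : β ≠ 0) :
    Finsupp.weight n β ≠ 0 := by
  obtain ⟨i, hi⟩ := Finsupp.ne_iff.1 hβ
  have := Finsupp.le_weight n (hn i) β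
  simp at hi
  lia

theorem mem_fil_one (hn : ∀ i, n i ≠ 0) {g : MvPowerSeries σ 𝒜} :
    g ∈ fil n 1 ↔ constantCoeff g = 0 := by
  refine ⟨fun h => by simpa using h 0 (by simp), fun h β hβ => ?_⟩
  have : β = 0 := by
    by_contra hne
    exact weight_ne_zero hn hne (by lia)
  rw [this, coeff_zero_eq_constantCoeff, h]

variable (n) in
/-- The Euler derivation, which multiplies the coefficient of index `β` by the weight of `β`. -/
def euler : MvPowerSeries σ 𝒜 →ₗ[ℂ] MvPowerSeries σ 𝒜 where
  toFun g := fun β => (Finsupp.weight n β : ℂ) • coeff β g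
  map_add' g h := funext fun β => smul_add _ (coeff β g) (coeff β h)
  map_smul' c g := funext fun β => smul_comm _ c (coeff β g)

theorem coeff_euler (g : MvPowerSeries σ 𝒜) (β : σ →₀ ℕ) :
    coeff β (euler n g) = (Finsupp.weight n β : ℂ) • coeff β g := rfl

theorem euler_mul (g h : MvPowerSeries σ 𝒜) :
    euler n (g * h) = euler n g * h + g * euler n h := by
  classical
  ext β
  rw [coeff_euler, map_add, coeff_mul, coeff_mul, coeff_mul, ← Finset.sum_add_distrib,
    Finset.smul_sum]
  refine Finset.sum_congr rfl fun p hp => ?_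
  rw [coeff_euler, coeff_euler, ← Finset.HasAntidiagonal.mem_antidiagonal.1 hp, map_add,
    Nat.cast_add, add_smul, smul_mul_assoc, mul_smul_comm]

theorem euler_one : euler n (1 : MvPowerSeries σ 𝒜) = 0 := by
  have := euler_mul (n := n) (1 : MvPowerSeries σ 𝒜) 1
  simpa using this

theorem euler_comm (n' : σ → ℕ) (g : MvPowerSeries σ 𝒜) :
    euler n (euler n' g) = euler n' (euler n g) := by
  ext β
  simp only [coeff_euler]
  rw [smul_comm]

theorem constantCoeff_euler (g : MvPowerSeries σ 𝒜) : constantCoeff (euler n g) = 0 := by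
  rw [← coeff_zero_eq_constantCoeff_apply, coeff_euler]
  simp

theorem euler_mem_fil {k : ℕ} {g : MvPowerSeries σ 𝒜} (hg : g ∈ fil n k) : euler n g ∈ fil n k :=
  fun β hβ => by rw [coeff_euler, hg β hβ, smul_zero]

/-- The Euler derivation is multiplication by `k` on the quotient of filtration steps `k` and
`k + 1`. -/
theorem euler_sub_smul_mem_fil {k : ℕ} {g : MvPowerSeries σ 𝒜} (hg : g ∈ fil n k) :
    euler n g - (k : ℂ) • g ∈ fil n (k + 1) := by
  intro β hβ
  rw [map_sub, coeff_euler, coeff_smul']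
  rcases Nat.lt_succ_iff_lt_or_eq.1 hβ with h | h
  · rw [hg β h, smul_zero, smul_zero, sub_zero]
  · rw [h, sub_self]

/-- The Sylvester type equation `euler g = c * g - g * c'` has no nonzero solution without constant
term. -/
theorem eq_zero_of_euler_eq (hn : ∀ i, n i ≠ 0) {c c' g : MvPowerSeries σ 𝒜}
    (hc : constantCoeff c = 0) (hc' : constantCoeff c' = 0) (hg : constantCoeff g = 0)
    (h : euler n g = c * g - g * c') : g = 0 := by
  refine eq_zero_of_mem_fil (n := n) fun k => ?_
  induction k with
  | zero => exact mem_fil_zero g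
  | succ k ih =>
    have h1 : euler n g ∈ fil n (k + 1) := by
      rw [h]
      refine sub_mem ?_ (mul_mem_fil ih ((mem_fil_one hn).2 hc'))
      rw [add_comm]
      exact mul_mem_fil ((mem_fil_one hn).2 hc) ih
    intro β hβ
    have h2 := h1 β hβ
    rw [coeff_euler, smul_eq_zero] at h2
    by_cases hβ0 : β = 0
    · rw [hβ0, coeff_zero_eq_constantCoeff, hg]
    · exact h2.resolve_left (Nat.cast_ne_zero.2 (weight_ne_zero hn hβ0))

/-- A series with constant term `1`, as a unit. -/
def oneUnit (g : MvPowerSeries σ 𝒜) (hg : constantCoeff g = 1) : (MvPowerSeries σ 𝒜)ˣ where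
  val := g
  inv := invOfUnit g 1
  val_inv := mul_invOfUnit g 1 hg
  inv_val := invOfUnit_mul g 1 hg

theorem constantCoeff_inv {τ R : Type*} [Ring R] {u : (MvPowerSeries τ R)ˣ}
    (hu : constantCoeff (u : MvPowerSeries τ R) = 1) :
    constantCoeff (↑u⁻¹ : MvPowerSeries τ R) = 1 := by
  have := congrArg constantCoeff u.mul_inv
  rwa [map_mul, hu, one_mul, map_one] at this

theorem sub_one_mem_fil (hn : ∀ i, n i ≠ 0) {u : MvPowerSeries σ 𝒜} (hu : constantCoeff u = 1) :
    u - 1 ∈ fil n 1 :=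
  (mem_fil_one hn).2 (by rw [map_sub, hu, map_one, sub_self])

theorem mul_sub_mem_fil (hn : ∀ i, n i ≠ 0) {k : ℕ} {u g : MvPowerSeries σ 𝒜}
    (hu : constantCoeff u = 1) (hg : g ∈ fil n k) : u * g - g ∈ fil n (k + 1) := by
  have := mul_mem_fil (sub_one_mem_fil hn hu) hg
  rwa [sub_mul, one_mul, add_comm] at this

theorem mul_sub_mem_fil' (hn : ∀ i, n i ≠ 0) {k : ℕ} {u g : MvPowerSeries σ 𝒜}
    (hu : constantCoeff u = 1) (hg : g ∈ fil n k) : g * u - g ∈ fil n (k + 1) := by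
  have := mul_mem_fil hg (sub_one_mem_fil hn hu)
  rwa [mul_sub, mul_one] at this

theorem euler_inv (u : (MvPowerSeries σ 𝒜)ˣ) :
    euler n (↑u⁻¹ : MvPowerSeries σ 𝒜) =
      -((↑u⁻¹ : MvPowerSeries σ 𝒜) * (euler n (u : MvPowerSeries σ 𝒜) * ↑u⁻¹)) := by
  have h := euler_mul (n := n) (u : MvPowerSeries σ 𝒜) ↑u⁻¹
  rw [u.mul_inv, euler_one] at h
  have h2 : (u : MvPowerSeries σ 𝒜) * euler n (↑u⁻¹ : MvPowerSeries σ 𝒜) =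
      -(euler n (u : MvPowerSeries σ 𝒜) * ↑u⁻¹) := by
    rw [eq_neg_iff_add_eq_zero, add_comm]; exact h.symm
  rw [← mul_neg, ← h2, ← mul_assoc, u.inv_mul, one_mul]

/-! ### The group of series with Lie logarithmic derivative -/

variable (L : (σ →₀ ℕ) → Submodule ℂ 𝒜)

/-- The graded family `L` is closed under commutators. -/
def IsLieFamily : Prop :=
  ∀ γ δ x y, x ∈ L γ → y ∈ L δ → x * y - y * x ∈ L (γ + δ)

/-- The completion of `⨁_{β ≠ 0} L β` inside the power series. -/
def lieSeries : Submodule ℂ (MvPowerSeries σ 𝒜) where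
  carrier := {Y | constantCoeff Y = 0 ∧ ∀ β, coeff β Y ∈ L β}
  zero_mem' := ⟨map_zero _, fun β => by rw [map_zero]; exact zero_mem _⟩
  add_mem' := fun hx hy => ⟨by rw [map_add, hx.1, hy.1, add_zero],
    fun β => by rw [map_add]; exact add_mem (hx.2 β) (hy.2 β)⟩
  smul_mem' := fun c Y hY => by
    refine ⟨?_, fun β => (L β).smul_mem c (hY.2 β)⟩
    rw [← coeff_zero_eq_constantCoeff_apply, coeff_smul', coeff_zero_eq_constantCoeff_apply, hY.1,
      smul_zero]

variable {L}

theorem euler_mem_lieSeries {Y : MvPowerSeries σ 𝒜} (hY : Y ∈ lieSeries L) :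
    euler n Y ∈ lieSeries L :=
  ⟨constantCoeff_euler Y, fun β => (L β).smul_mem _ (hY.2 β)⟩

/-- The coefficient of index `β` of a commutator with a Lie series only involves coefficients of
smaller weight. -/
theorem coeff_commutator_mem (hL : IsLieFamily L) (hn : ∀ i, n i ≠ 0) {c Y : MvPowerSeries σ 𝒜}
    (hc : c ∈ lieSeries L) {β : σ →₀ ℕ}
    (hY : ∀ δ, Finsupp.weight n δ < Finsupp.weight n β → coeff δ Y ∈ L δ) :
    coeff β (c * Y - Y * c) ∈ L β := by
  classical
  rw [map_sub, coeff_mul, coeff_mul,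
    Finsupp.sum_antidiagonal_swap β fun a b => coeff a Y * coeff b c, ← Finset.sum_sub_distrib]
  refine Submodule.sum_mem _ fun p hp => ?_
  have hp' := Finset.HasAntidiagonal.mem_antidiagonal.1 hp
  by_cases h2 : p.1 = 0
  · simp [h2, hc.1]
  · have hlt : Finsupp.weight n p.2 < Finsupp.weight n β := by
      rw [← hp', map_add]
      have := weight_ne_zero hn h2
      lia
    have := hL _ _ _ _ (hc.2 p.1) (hY p.2 hlt)
    rwa [hp'] at this

theorem commutator_mem_lieSeries (hL : IsLieFamily L) (hn : ∀ i, n i ≠ 0)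
    {c Y : MvPowerSeries σ 𝒜} (hc : c ∈ lieSeries L) (hY : Y ∈ lieSeries L) :
    c * Y - Y * c ∈ lieSeries L :=
  ⟨by simp [hc.1, hY.1], fun _ => coeff_commutator_mem hL hn hc fun δ _ => hY.2 δ⟩

/-- Conjugation by a series with Lie logarithmic derivative preserves Lie series. If `Y` starts in
weight `j`, then applying `euler - j` to `u⁻¹ Y u` gives a conjugate of a Lie series that starts in
weight `j + 1`, which allows induction. -/
theorem coeff_conj_mem (hL : IsLieFamily L) (hn : ∀ i, n i ≠ 0) {u : (MvPowerSeries σ 𝒜)ˣ}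
    (hu : constantCoeff (u : MvPowerSeries σ 𝒜) = 1) {c : MvPowerSeries σ 𝒜}
    (hc : c ∈ lieSeries L) (huc : euler n (u : MvPowerSeries σ 𝒜) = c * u) (k : ℕ) :
    ∀ (j : ℕ) (Y : MvPowerSeries σ 𝒜), Y ∈ lieSeries L → Y ∈ fil n j → ∀ β,
      Finsupp.weight n β ≤ j + k →
        coeff β ((↑u⁻¹ : MvPowerSeries σ 𝒜) * Y * (u : MvPowerSeries σ 𝒜)) ∈ L β := by
  have base : ∀ (j : ℕ) (Y : MvPowerSeries σ 𝒜), Y ∈ lieSeries L → Y ∈ fil n j → ∀ β,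
      Finsupp.weight n β ≤ j →
        coeff β ((↑u⁻¹ : MvPowerSeries σ 𝒜) * Y * (u : MvPowerSeries σ 𝒜)) ∈ L β := by
    intro j Y hY hYj β hβ
    have h1 : (↑u⁻¹ : MvPowerSeries σ 𝒜) * Y * (u : MvPowerSeries σ 𝒜) - Y ∈ fil n (j + 1) := by
      have a := mul_sub_mem_fil' hn hu (mul_mem_fil_left (↑u⁻¹ : MvPowerSeries σ 𝒜) hYj)
      have b := mul_sub_mem_fil hn (constantCoeff_inv hu) hYj
      simpa using add_mem a b
    have h2 := h1 β (by lia)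
    rw [map_sub, sub_eq_zero] at h2
    rw [h2]
    exact hY.2 β
  induction k with
  | zero => exact fun j Y hY hYj β hβ => base j Y hY hYj β hβ
  | succ k ih =>
    intro j Y hY hYj β hβ
    by_cases hβj : Finsupp.weight n β = j
    · exact base j Y hY hYj β hβj.le
    set Z := euler n Y - (j : ℂ) • Y - (c * Y - Y * c) with hZ
    have hZL : Z ∈ lieSeries L :=
      sub_mem (sub_mem (euler_mem_lieSeries hY) (Submodule.smul_mem _ _ hY))
        (commutator_mem_lieSeries hL hn hc hY)
    have hc1 := (mem_fil_one hn).2 hc.1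
    have hZj : Z ∈ fil n (j + 1) := by
      refine sub_mem (euler_sub_smul_mem_fil hYj) (sub_mem ?_ (mul_mem_fil hYj hc1))
      rw [add_comm]
      exact mul_mem_fil hc1 hYj
    have h1 := ih (j + 1) Z hZL hZj β (by lia)
    have h2 : (↑u⁻¹ : MvPowerSeries σ 𝒜) * Z * (u : MvPowerSeries σ 𝒜) =
        euler n ((↑u⁻¹ : MvPowerSeries σ 𝒜) * Y * (u : MvPowerSeries σ 𝒜)) -
          (j : ℂ) • ((↑u⁻¹ : MvPowerSeries σ 𝒜) * Y * (u : MvPowerSeries σ 𝒜)) := by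
      rw [euler_mul, euler_mul, euler_inv, huc, hZ]
      simp only [mul_sub, sub_mul, mul_assoc, u.mul_inv, mul_one, mul_smul_comm, smul_mul_assoc,
        add_mul, neg_mul]
      abel
    rw [h2, map_sub, coeff_euler, coeff_smul', ← sub_smul] at h1
    have h3 : (Finsupp.weight n β : ℂ) - j ≠ 0 := by
      rw [sub_ne_zero]
      exact_mod_cast hβj
    exact (Submodule.smul_mem_iff _ h3).1 h1

theorem conj_mem_lieSeries (hL : IsLieFamily L) (hn : ∀ i, n i ≠ 0) {u : (MvPowerSeries σ 𝒜)ˣ}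
    (hu : constantCoeff (u : MvPowerSeries σ 𝒜) = 1)
    (huc : euler n (u : MvPowerSeries σ 𝒜) * ↑u⁻¹ ∈ lieSeries L) {Y : MvPowerSeries σ 𝒜}
    (hY : Y ∈ lieSeries L) :
    (↑u⁻¹ : MvPowerSeries σ 𝒜) * Y * (u : MvPowerSeries σ 𝒜) ∈ lieSeries L :=
  ⟨by simp [hY.1], fun β => coeff_conj_mem hL hn hu huc (by rw [mul_assoc, u.inv_mul, mul_one])
    _ 0 Y hY (mem_fil_zero Y) β (Nat.zero_add _).ge⟩

/-- The group of the series `u` with constant term `1` whose logarithmic derivative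
`euler u * u⁻¹` is a Lie series. These are the exponentials of Lie series. -/
def lieGroup (hL : IsLieFamily L) (hn : ∀ i, n i ≠ 0) : Subgroup (MvPowerSeries σ 𝒜)ˣ :=
  have inv_mem : ∀ u : (MvPowerSeries σ 𝒜)ˣ, constantCoeff (u : MvPowerSeries σ 𝒜) = 1 ∧
      euler n (u : MvPowerSeries σ 𝒜) * ↑u⁻¹ ∈ lieSeries L →
      constantCoeff (↑u⁻¹ : MvPowerSeries σ 𝒜) = 1 ∧
      euler n (↑u⁻¹ : MvPowerSeries σ 𝒜) * ↑(u⁻¹)⁻¹ ∈ lieSeries L := by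
    intro u hu
    refine ⟨constantCoeff_inv hu.1, ?_⟩
    rw [euler_inv, neg_mul, inv_inv]
    exact neg_mem (conj_mem_lieSeries hL hn hu.1 hu.2 hu.2)
  { carrier := {u | constantCoeff (u : MvPowerSeries σ 𝒜) = 1 ∧
      euler n (u : MvPowerSeries σ 𝒜) * (↑u⁻¹ : MvPowerSeries σ 𝒜) ∈ lieSeries L}
    one_mem' := ⟨by simp, by simp [euler_one]⟩
    mul_mem' := by
      intro u v hu hv
      refine ⟨by simp [hu.1, hv.1], ?_⟩
      have hui := inv_mem u hu
      have h1 := conj_mem_lieSeries hL hn hui.1 hui.2 hv.2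
      rw [inv_inv] at h1
      have h2 : euler n (↑(u * v) : MvPowerSeries σ 𝒜) * ↑(u * v)⁻¹ =
          euler n (u : MvPowerSeries σ 𝒜) * ↑u⁻¹ +
            (u : MvPowerSeries σ 𝒜) * (euler n (v : MvPowerSeries σ 𝒜) * ↑v⁻¹) * ↑u⁻¹ := by
        rw [Units.val_mul, euler_mul, mul_inv_rev, Units.val_mul, add_mul]
        simp only [mul_assoc]
        rw [← mul_assoc (v : MvPowerSeries σ 𝒜), v.mul_inv, one_mul]
      rw [h2]
      exact add_mem hu.2 h1
    inv_mem' := fun {u} hu => inv_mem u hu }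

/-- The group does not depend on the weights: the logarithmic derivatives `c` and `c'` for two
systems of weights satisfy `euler n c' - euler n' c = c * c' - c' * c`, which determines `c'` from
`c` by recursion. -/
theorem lieGroup_le (hL : IsLieFamily L) (hn : ∀ i, n i ≠ 0) {n' : σ → ℕ} (hn' : ∀ i, n' i ≠ 0) :
    lieGroup hL hn ≤ lieGroup hL hn' := by
  rintro u ⟨hu1, hu⟩
  refine ⟨hu1, by simp [constantCoeff_euler], ?_⟩
  set c := euler n (u : MvPowerSeries σ 𝒜) * ↑u⁻¹ with hc
  set c' := euler n' (u : MvPowerSeries σ 𝒜) * ↑u⁻¹ with hc'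
  have e : euler n (u : MvPowerSeries σ 𝒜) = c * u := by rw [hc, mul_assoc, u.inv_mul, mul_one]
  have e' : euler n' (u : MvPowerSeries σ 𝒜) = c' * u := by
    rw [hc', mul_assoc, u.inv_mul, mul_one]
  have hc'0 : coeff 0 c' = 0 := by
    rw [hc', coeff_zero_eq_constantCoeff, map_mul, constantCoeff_euler, zero_mul]
  clear_value c c'
  have key : euler n c' = euler n' c + (c * c' - c' * c) := by
    have h := euler_comm (n := n) n' (u : MvPowerSeries σ 𝒜)
    rw [e', e, euler_mul, euler_mul, e, e', ← mul_assoc, ← mul_assoc, ← add_mul, ← add_mul] at h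
    have h2 := u.isUnit.mul_right_cancel h
    rw [← add_sub_assoc, ← h2, add_sub_cancel_right]
  have main : ∀ k β, Finsupp.weight n β = k → coeff β c' ∈ L β := by
    intro k
    induction k using Nat.strong_induction_on with
    | _ k ih =>
      intro β hβ
      by_cases hβ0 : β = 0
      · rw [hβ0, hc'0]
        exact zero_mem _
      have h1 := congrArg (coeff β) key
      rw [coeff_euler, map_add] at h1
      refine (Submodule.smul_mem_iff (L β) (Nat.cast_ne_zero.2 (weight_ne_zero hn hβ0))).1 (?_ :
        (Finsupp.weight n β : ℂ) • coeff β c' ∈ L β)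
      rw [h1]
      exact add_mem ((euler_mem_lieSeries hu).2 β)
        (coeff_commutator_mem hL hn hu fun δ hδ => ih _ (hβ ▸ hδ) δ rfl)
  exact fun β => main _ β rfl

theorem inv_sub_inv_mem_fil {k : ℕ} {u v : (MvPowerSeries σ 𝒜)ˣ}
    (h : (u : MvPowerSeries σ 𝒜) - v ∈ fil n k) :
    (↑u⁻¹ : MvPowerSeries σ 𝒜) - ↑v⁻¹ ∈ fil n k := by
  have : (↑u⁻¹ : MvPowerSeries σ 𝒜) - ↑v⁻¹ = -(↑u⁻¹ * (u - v) * ↑v⁻¹) := by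
    rw [mul_sub, sub_mul, u.inv_mul, one_mul, mul_assoc, v.mul_inv, mul_one, neg_sub]
  rw [this]
  exact neg_mem (mul_mem_fil_right _ (mul_mem_fil_left _ h))

/-- The group is complete for the weight filtration. -/
theorem exists_limit (hL : IsLieFamily L) (hn : ∀ i, n i ≠ 0) (u : ℕ → (MvPowerSeries σ 𝒜)ˣ)
    (hu : ∀ k, u k ∈ lieGroup hL hn)
    (hstep : ∀ k, (u (k + 1) : MvPowerSeries σ 𝒜) - u k ∈ fil n (k + 1)) :
    ∃ g ∈ lieGroup hL hn, ∀ k, (g : MvPowerSeries σ 𝒜) - u k ∈ fil n (k + 1) := by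
  have hmono : ∀ k d, (u (k + d) : MvPowerSeries σ 𝒜) - u k ∈ fil n (k + 1) := by
    intro k d
    induction d with
    | zero => simp
    | succ d ih =>
      have := add_mem (fil_anti (by lia : k + 1 ≤ k + d + 1) (hstep (k + d))) ih
      rw [sub_add_sub_cancel] at this
      exact this
  set g : MvPowerSeries σ 𝒜 := fun β => coeff β (u (Finsupp.weight n β) : MvPowerSeries σ 𝒜)
    with hg
  have hgc : ∀ β, coeff β g = coeff β (u (Finsupp.weight n β) : MvPowerSeries σ 𝒜) := fun _ => rfl
  have hgu : ∀ k, g - u k ∈ fil n (k + 1) := by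
    intro k β hβ
    obtain ⟨d, hd⟩ := Nat.exists_eq_add_of_le (Nat.lt_succ_iff.1 hβ)
    have h1 := hmono (Finsupp.weight n β) d β (Nat.lt_succ_self _)
    rw [← hd, map_sub, sub_eq_zero] at h1
    rw [map_sub, hgc, h1, sub_self]
  have hg1 : constantCoeff g = 1 := by
    rw [← coeff_zero_eq_constantCoeff_apply, hgc, coeff_zero_eq_constantCoeff_apply]
    exact (hu _).1
  refine ⟨oneUnit g hg1, ⟨hg1, by simp [constantCoeff_euler], fun β => ?_⟩, hgu⟩
  set k := Finsupp.weight n β with hk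
  have h1 : euler n (oneUnit g hg1 : MvPowerSeries σ 𝒜) * ↑(oneUnit g hg1)⁻¹ -
      euler n (u k : MvPowerSeries σ 𝒜) * ↑(u k)⁻¹ ∈ fil n (k + 1) := by
    have hk' : (oneUnit g hg1 : MvPowerSeries σ 𝒜) - u k ∈ fil n (k + 1) := hgu k
    have e1 := mul_mem_fil_right (↑(oneUnit g hg1)⁻¹ : MvPowerSeries σ 𝒜) (euler_mem_fil hk')
    have e2 := mul_mem_fil_left (euler n (u k : MvPowerSeries σ 𝒜)) (inv_sub_inv_mem_fil hk')
    have := add_mem e1 e2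
    rwa [map_sub, sub_mul, mul_sub, sub_add_sub_cancel] at this
  have h2 := h1 β (Nat.lt_succ_self _)
  rw [map_sub, sub_eq_zero] at h2
  rw [h2]
  exact (hu k).2.2 β

/-- If two elements of the group agree in weights below `k`, then their quotient differs from `1`
by a Lie series in weight `k`, and multiplication by any `u'` with the same leading term improves
the agreement. -/
theorem exists_step (hL : IsLieFamily L) (hn : ∀ i, n i ≠ 0) {g u : (MvPowerSeries σ 𝒜)ˣ}
    (hg : g ∈ lieGroup hL hn) (hu : u ∈ lieGroup hL hn) {k : ℕ} (hk : k ≠ 0)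
    (h : (g : MvPowerSeries σ 𝒜) - u ∈ fil n k) :
    ∃ X ∈ lieSeries L, euler n X = (k : ℂ) • X ∧ ∀ u' : (MvPowerSeries σ 𝒜)ˣ,
      (u' : MvPowerSeries σ 𝒜) - 1 - X ∈ fil n (k + 1) →
      (g : MvPowerSeries σ 𝒜) - ↑(u' * u) ∈ fil n (k + 1) := by
  set q := g * u⁻¹ with hq
  have hqm : q ∈ lieGroup hL hn := mul_mem hg (inv_mem hu)
  have hq1 : (q : MvPowerSeries σ 𝒜) - 1 ∈ fil n k := by
    have := mul_mem_fil_right (↑u⁻¹ : MvPowerSeries σ 𝒜) h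
    rwa [sub_mul, u.mul_inv, ← Units.val_mul] at this
  have hlead : ∀ β, Finsupp.weight n β = k → coeff β (q : MvPowerSeries σ 𝒜) ∈ L β := by
    intro β hβ
    have h0 : euler n (q : MvPowerSeries σ 𝒜) ∈ fil n k := by
      have := euler_mem_fil hq1
      rwa [map_sub, euler_one, sub_zero] at this
    have h1 := mul_sub_mem_fil' hn (constantCoeff_inv hqm.1) h0 β (by lia)
    rw [map_sub, sub_eq_zero] at h1
    have h2 := hqm.2.2 β
    rw [h1, coeff_euler, hβ] at h2
    exact (Submodule.smul_mem_iff _ (Nat.cast_ne_zero.2 hk)).1 h2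
  set X : MvPowerSeries σ 𝒜 := fun β =>
    if Finsupp.weight n β = k then coeff β (q : MvPowerSeries σ 𝒜) else 0 with hX
  have hXc : ∀ β, coeff β X =
    if Finsupp.weight n β = k then coeff β (q : MvPowerSeries σ 𝒜) else 0 := fun _ => rfl
  have hXq : (q : MvPowerSeries σ 𝒜) - 1 - X ∈ fil n (k + 1) := by
    intro β hβ
    rw [map_sub, hXc]
    split_ifs with hβk
    · have hβ0 : β ≠ 0 := by
        rintro rfl
        exact hk (by simpa using hβk.symm)
      have : coeff β (1 : MvPowerSeries σ 𝒜) = 0 := by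
        classical
        rw [coeff_one, if_neg hβ0]
      rw [map_sub, this, sub_zero, sub_self]
    · rw [sub_zero]
      exact hq1 β (by lia)
  refine ⟨X, ⟨?_, fun β => ?_⟩, ?_, fun u' hu' => ?_⟩
  · rw [← coeff_zero_eq_constantCoeff_apply, hXc, if_neg]
    simpa using hk.symm
  · rw [hXc]
    split_ifs with hβ
    · exact hlead β hβ
    · exact zero_mem _
  · ext β
    rw [coeff_euler, coeff_smul', hXc]
    split_ifs with hβ
    · rw [hβ]
    · simp
  · have h1 := mul_mem_fil_right (u : MvPowerSeries σ 𝒜) (sub_mem hXq hu')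
    have h2 : ((q : MvPowerSeries σ 𝒜) - 1 - X - (u' - 1 - X)) * u = g - ↑(u' * u) := by
      have : (q : MvPowerSeries σ 𝒜) * u = g := by
        rw [hq, Units.val_mul, mul_assoc, u.inv_mul, mul_one]
      rw [sub_sub_sub_cancel_right, sub_sub_sub_cancel_right, sub_mul, this, Units.val_mul]
    rwa [h2] at h1

/-- A subgroup that realises all leading terms is dense in the group for the weight filtration. -/
theorem exists_approx (hL : IsLieFamily L) (hn : ∀ i, n i ≠ 0) (T : Subgroup (MvPowerSeries σ 𝒜)ˣ)
    (hTL : T ≤ lieGroup hL hn)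
    (hT : ∀ k : ℕ, k ≠ 0 → ∀ X ∈ lieSeries L, euler n X = (k : ℂ) • X →
      ∃ u ∈ T, (u : MvPowerSeries σ 𝒜) - 1 - X ∈ fil n (k + 1))
    {g : (MvPowerSeries σ 𝒜)ˣ} (hg : g ∈ lieGroup hL hn) (k : ℕ) :
    ∃ u ∈ T, (g : MvPowerSeries σ 𝒜) - u ∈ fil n (k + 1) := by
  induction k with
  | zero =>
    refine ⟨1, one_mem _, sub_one_mem_fil hn hg.1⟩
  | succ k ih =>
    obtain ⟨u, huT, hu⟩ := ih
    obtain ⟨X, hX, hXk, h⟩ := exists_step hL hn hg (hTL huT) (Nat.succ_ne_zero k) hu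
    obtain ⟨u', hu'T, hu'⟩ := hT _ (Nat.succ_ne_zero k) X hX hXk
    exact ⟨u' * u, mul_mem hu'T huT, h u' hu'⟩

theorem mul_sub_one_sub_mem_fil {k : ℕ} (hk : k ≠ 0) {u v X Y : MvPowerSeries σ 𝒜}
    (hX : X ∈ fil n k) (hY : Y ∈ fil n k)
    (hu : u - 1 - X ∈ fil n (k + 1)) (hv : v - 1 - Y ∈ fil n (k + 1)) :
    u * v - 1 - (X + Y) ∈ fil n (k + 1) := by
  have hu1 : u - 1 ∈ fil n k := by simpa using add_mem (fil_anti (Nat.le_succ k) hu) hX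
  have hv1 : v - 1 ∈ fil n k := by simpa using add_mem (fil_anti (Nat.le_succ k) hv) hY
  have h1 := fil_anti (by lia : k + 1 ≤ k + k) (mul_mem_fil hu1 hv1)
  have h2 := add_mem h1 (add_mem hu hv)
  convert h2 using 1
  noncomm_ring

/-- The leading term of a group commutator is the commutator of the leading terms. -/
theorem commutator_sub_one_sub_mem_fil (hn : ∀ i, n i ≠ 0) {p q : ℕ}
    {u v : (MvPowerSeries σ 𝒜)ˣ} (hu1 : constantCoeff (u : MvPowerSeries σ 𝒜) = 1)
    (hv1 : constantCoeff (v : MvPowerSeries σ 𝒜) = 1) {X Y : MvPowerSeries σ 𝒜}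
    (hX : X ∈ fil n p) (hY : Y ∈ fil n q) (hu : (u : MvPowerSeries σ 𝒜) - 1 - X ∈ fil n (p + 1))
    (hv : (v : MvPowerSeries σ 𝒜) - 1 - Y ∈ fil n (q + 1)) :
    (↑(u * v * u⁻¹ * v⁻¹) : MvPowerSeries σ 𝒜) - 1 - (X * Y - Y * X) ∈ fil n (p + q + 1) := by
  set a := (u : MvPowerSeries σ 𝒜) - 1 - X with ha
  set b := (v : MvPowerSeries σ 𝒜) - 1 - Y with hb
  have hu' : (u : MvPowerSeries σ 𝒜) = 1 + X + a := by rw [ha]; abel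
  have hv' : (v : MvPowerSeries σ 𝒜) = 1 + Y + b := by rw [hb]; abel
  have ha' := fil_anti (Nat.le_succ p) hu
  have hb' := fil_anti (Nat.le_succ q) hv
  have h1 : (u * v - v * u : MvPowerSeries σ 𝒜) - (X * Y - Y * X) ∈ fil n (p + q + 1) := by
    have e : (u * v - v * u : MvPowerSeries σ 𝒜) - (X * Y - Y * X) =
        (X * b + a * (Y + b)) - (b * X + (Y + b) * a) := by
      rw [hu', hv']; noncomm_ring
    rw [e]
    have c1 : X * b ∈ fil n (p + q + 1) := mul_mem_fil (k := q + 1) hX hv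
    have c2 : a * (Y + b) ∈ fil n (p + q + 1) :=
      fil_anti (by lia) (mul_mem_fil hu (add_mem hY hb'))
    have c3 : b * X ∈ fil n (p + q + 1) := fil_anti (by lia) (mul_mem_fil hv hX)
    have c4 : (Y + b) * a ∈ fil n (p + q + 1) :=
      fil_anti (by lia) (mul_mem_fil (add_mem hY hb') hu)
    exact sub_mem (add_mem c1 c2) (add_mem c3 c4)
  have hXY : X * Y - Y * X ∈ fil n (p + q) :=
    sub_mem (mul_mem_fil hX hY) (by rw [add_comm]; exact mul_mem_fil hY hX)
  have h2 : (u * v - v * u : MvPowerSeries σ 𝒜) ∈ fil n (p + q) := by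
    simpa using add_mem (fil_anti (Nat.le_succ _) h1) hXY
  have hinv : constantCoeff (↑u⁻¹ * ↑v⁻¹ : MvPowerSeries σ 𝒜) = 1 := by
    rw [map_mul, constantCoeff_inv hu1, constantCoeff_inv hv1, one_mul]
  have h3 := mul_sub_mem_fil' hn hinv h2
  have h4 : (u * v - v * u : MvPowerSeries σ 𝒜) * (↑u⁻¹ * ↑v⁻¹) =
      ↑(u * v * u⁻¹ * v⁻¹) - 1 := by
    have : (v * u * (u⁻¹ * v⁻¹) : (MvPowerSeries σ 𝒜)ˣ) = 1 := by group
    rw [sub_mul, ← Units.val_mul, ← Units.val_mul, ← Units.val_mul, ← Units.val_mul,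
      ← Units.val_mul, this, Units.val_one, ← mul_assoc]
  rw [h4] at h3
  have := add_mem h3 h1
  convert this using 1
  abel

/-! ### Solutions of the logarithmic differential equation -/

open Classical in
/-- The coefficients of the series `g` with constant term `1` and `euler g = c * g`, computed by
recursion. -/
def solCoeff (n : σ → ℕ) (c : MvPowerSeries σ 𝒜) (β : σ →₀ ℕ) : 𝒜 :=
  if β = 0 then 1 else (Finsupp.weight n β : ℂ)⁻¹ •
    ∑ p ∈ ((Finset.HasAntidiagonal.antidiagonal β).filter fun p => p.1 ≠ 0).attach,
      coeff p.1.1 c * solCoeff n c p.1.2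
termination_by β.degree
decreasing_by
  have hp := Finset.mem_filter.1 p.2
  have h1 := congrArg Finsupp.degree (Finset.HasAntidiagonal.mem_antidiagonal.1 hp.1)
  rw [map_add] at h1
  have : p.1.1.degree ≠ 0 := fun h => hp.2 ((Finsupp.degree_eq_zero_iff _).1 h)
  lia

/-- The series `g` with constant term `1` and `euler g = c * g`. -/
def sol (n : σ → ℕ) (c : MvPowerSeries σ 𝒜) : MvPowerSeries σ 𝒜 := fun β => solCoeff n c β

theorem coeff_sol_zero (n : σ → ℕ) (c : MvPowerSeries σ 𝒜) : coeff 0 (sol n c) = 1 := by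
  change solCoeff n c 0 = 1
  rw [solCoeff, if_pos rfl]

theorem constantCoeff_sol (n : σ → ℕ) (c : MvPowerSeries σ 𝒜) : constantCoeff (sol n c) = 1 := by
  rw [← coeff_zero_eq_constantCoeff_apply, coeff_sol_zero]

theorem euler_sol (hn : ∀ i, n i ≠ 0) {c : MvPowerSeries σ 𝒜} (hc : constantCoeff c = 0) :
    euler n (sol n c) = c * sol n c := by
  classical
  ext β
  rw [coeff_euler, coeff_mul]
  by_cases hβ : β = 0
  · subst hβ
    simp [hc]
  · change _ • solCoeff n c β = _
    rw [solCoeff, if_neg hβ, smul_smul,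
      mul_inv_cancel₀ (Nat.cast_ne_zero.2 (weight_ne_zero hn hβ)), one_smul,
      Finset.sum_attach _ (fun p : (σ →₀ ℕ) × (σ →₀ ℕ) => coeff p.1 c * solCoeff n c p.2)]
    refine Eq.trans ?_ (Finset.sum_subset (Finset.filter_subset (fun p => p.1 ≠ 0) _) ?_)
    · congr!
    intro p hp hp'
    have : p.1 = 0 := by
      by_contra h
      exact hp' (Finset.mem_filter.2 ⟨hp, h⟩)
    rw [this, coeff_zero_eq_constantCoeff, hc, zero_mul]

theorem eq_sol (hn : ∀ i, n i ≠ 0) {c g : MvPowerSeries σ 𝒜} (hg : constantCoeff g = 1)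
    (hgc : euler n g = c * g) (hc : constantCoeff c = 0) : g = sol n c := by
  rw [← sub_eq_zero]
  refine eq_zero_of_euler_eq hn hc (map_zero _) (c' := 0) ?_ ?_
  · rw [map_sub, hg, constantCoeff_sol, sub_self]
  · rw [map_sub, hgc, euler_sol hn hc, mul_zero, sub_zero, mul_sub]

theorem sol_mem_lieGroup (hL : IsLieFamily L) (hn : ∀ i, n i ≠ 0) {c : MvPowerSeries σ 𝒜}
    (hc : c ∈ lieSeries L) :
    oneUnit (sol n c) (constantCoeff_sol n c) ∈ lieGroup hL hn := by
  refine ⟨constantCoeff_sol n c, ?_⟩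
  set u := oneUnit (sol n c) (constantCoeff_sol n c) with hu
  have : euler n (u : MvPowerSeries σ 𝒜) = c * u := euler_sol hn hc.1
  rw [this, mul_assoc, u.mul_inv, mul_one]
  exact hc

theorem exists_eq_sol (hL : IsLieFamily L) (hn : ∀ i, n i ≠ 0) {u : (MvPowerSeries σ 𝒜)ˣ}
    (hu : u ∈ lieGroup hL hn) : ∃ c ∈ lieSeries L, (u : MvPowerSeries σ 𝒜) = sol n c :=
  ⟨_, hu.2, eq_sol hn hu.1 (by rw [mul_assoc, u.inv_mul, mul_one]) hu.2.1⟩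

/-- A modification of `c` in weights at least `k` only changes the solution in weights at least
`k`, and linearly in weight `k`. The weights `n` of the filtration need not be the weights `n₀` of
the differential equation. -/
theorem coeff_sol_sub (hn : ∀ i, n i ≠ 0) {n₀ : σ → ℕ} (hn₀ : ∀ i, n₀ i ≠ 0)
    {c c' : MvPowerSeries σ 𝒜} (hc : constantCoeff c = 0)
    (hc' : constantCoeff c' = 0) {k : ℕ} (h : c - c' ∈ fil n k) :
    sol n₀ c - sol n₀ c' ∈ fil n k ∧ ∀ β, Finsupp.weight n β = k →
      (Finsupp.weight n₀ β : ℂ) • (coeff β (sol n₀ c) - coeff β (sol n₀ c')) =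
        coeff β c - coeff β c' := by
  have key : euler n₀ (sol n₀ c - sol n₀ c') =
      (c - c') * sol n₀ c + c' * (sol n₀ c - sol n₀ c') := by
    rw [map_sub, euler_sol hn₀ hc, euler_sol hn₀ hc']; noncomm_ring
  have h0 : constantCoeff (sol n₀ c - sol n₀ c') = 0 := by
    rw [map_sub, constantCoeff_sol, constantCoeff_sol, sub_self]
  have hc'1 := (mem_fil_one hn).2 hc'
  have hfil : ∀ j ≤ k, sol n₀ c - sol n₀ c' ∈ fil n j := by
    intro j
    induction j with
    | zero => exact fun _ => mem_fil_zero _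
    | succ j ih =>
      intro hj β hβ
      have h1 : euler n₀ (sol n₀ c - sol n₀ c') ∈ fil n (j + 1) := by
        rw [key]
        refine add_mem (fil_anti hj (mul_mem_fil_right _ h)) ?_
        rw [add_comm]
        exact mul_mem_fil hc'1 (ih (by lia))
      by_cases hβ0 : β = 0
      · rw [hβ0, coeff_zero_eq_constantCoeff, h0]
      · have := h1 β hβ
        rw [coeff_euler, smul_eq_zero] at this
        exact this.resolve_left (Nat.cast_ne_zero.2 (weight_ne_zero hn₀ hβ0))
  refine ⟨hfil k le_rfl, fun β hβ => ?_⟩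
  have h1 := congrArg (coeff β) key
  have h2 := mul_sub_mem_fil' hn (constantCoeff_sol n₀ c) h β (by lia)
  have h3 := mul_mem_fil hc'1 (hfil k le_rfl) β (by lia)
  rw [map_sub, sub_eq_zero] at h2
  rw [map_add, h3, add_zero, h2, coeff_euler, map_sub, map_sub] at h1
  exact h1

theorem map_sol {ℬ : Type*} [Ring ℬ] [Algebra ℂ ℬ] (ψ : 𝒜 →ₐ[ℂ] ℬ) (hn : ∀ i, n i ≠ 0)
    {c : MvPowerSeries σ 𝒜} (hc : constantCoeff c = 0) :
    MvPowerSeries.map (ψ : 𝒜 →+* ℬ) (sol n c) = sol n (MvPowerSeries.map (ψ : 𝒜 →+* ℬ) c) := by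
  refine eq_sol hn (by simp [constantCoeff_sol]) ?_ (by simp [hc])
  rw [← map_mul, ← euler_sol hn hc]
  ext β
  simp [coeff_euler]

/-! ### Exponentials of power series -/

/-- The exponential of a series `X` without constant term. Powers `X ^ m` with `m` larger than the
total degree of `β` do not contribute to the coefficient of index `β`. -/
def expSer (X : MvPowerSeries σ 𝒜) : MvPowerSeries σ 𝒜 := fun β =>
  ∑ m ∈ Finset.range (β.degree + 1), (m.factorial : ℂ)⁻¹ • coeff β (X ^ m)

theorem coeff_pow_eq_zero (hn : ∀ i, n i ≠ 0) {X : MvPowerSeries σ 𝒜} (hX : constantCoeff X = 0)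
    {β : σ →₀ ℕ} {m : ℕ} (hm : Finsupp.weight n β < m) : coeff β (X ^ m) = 0 := by
  refine pow_mem_fil ((mem_fil_one hn).2 hX) m β ?_
  rwa [mul_one]

theorem degree_eq_weight (β : σ →₀ ℕ) : β.degree = Finsupp.weight (fun _ : σ => 1) β := by
  rw [Finsupp.degree_eq_weight_one]

theorem degree_le_weight (hn : ∀ i, n i ≠ 0) (β : σ →₀ ℕ) :
    β.degree ≤ Finsupp.weight n β := by
  rw [Finsupp.degree_apply, Finsupp.weight_apply, Finsupp.sum]
  refine Finset.sum_le_sum fun i _ => ?_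
  exact Nat.le_mul_of_pos_right _ (Nat.pos_of_ne_zero (hn i))

theorem coeff_expSer {X : MvPowerSeries σ 𝒜} (hX : constantCoeff X = 0) {β : σ →₀ ℕ} {K : ℕ}
    (hK : β.degree < K) :
    coeff β (expSer X) = ∑ m ∈ Finset.range K, (m.factorial : ℂ)⁻¹ • coeff β (X ^ m) := by
  change ∑ m ∈ Finset.range (β.degree + 1), (m.factorial : ℂ)⁻¹ • coeff β (X ^ m) = _
  refine Finset.sum_subset (Finset.range_mono hK) fun m _ hm => ?_
  rw [coeff_pow_eq_zero (n := fun _ => 1) (fun _ => one_ne_zero) hX, smul_zero]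
  rw [← degree_eq_weight]
  simpa using hm

theorem constantCoeff_expSer {X : MvPowerSeries σ 𝒜} (hX : constantCoeff X = 0) :
    constantCoeff (expSer X) = 1 := by
  rw [← coeff_zero_eq_constantCoeff_apply, coeff_expSer hX (K := 1) (by simp)]
  simp

theorem euler_pow {X : MvPowerSeries σ 𝒜} {k : ℂ} (hXk : euler n X = k • X) (m : ℕ) :
    euler n (X ^ m) = (m * k) • X ^ m := by
  induction m with
  | zero => simp [euler_one]
  | succ m ih =>
    rw [pow_succ, euler_mul, ih, hXk, smul_mul_assoc, mul_smul_comm, ← add_smul]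
    push_cast
    rw [add_mul, one_mul]

/-- The exponential of a homogeneous series `X` has logarithmic derivative `k • X`. -/
theorem euler_expSer {X : MvPowerSeries σ 𝒜} (hX : constantCoeff X = 0) {k : ℂ}
    (hXk : euler n X = k • X) : euler n (expSer X) = (k • X) * expSer X := by
  classical
  ext β
  have h1 : coeff β (X * expSer X) =
      ∑ m ∈ Finset.range (β.degree + 1), (m.factorial : ℂ)⁻¹ • coeff β (X ^ (m + 1)) := by
    have : ∀ p ∈ Finset.HasAntidiagonal.antidiagonal β, coeff p.1 X * coeff p.2 (expSer X) =
        ∑ m ∈ Finset.range (β.degree + 1),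
          (m.factorial : ℂ)⁻¹ • (coeff p.1 X * coeff p.2 (X ^ m)) := by
      intro p hp
      rw [coeff_expSer hX (K := β.degree + 1), Finset.mul_sum]
      · simp only [mul_smul_comm]
      · rw [← Finset.HasAntidiagonal.mem_antidiagonal.1 hp, map_add]
        lia
    rw [coeff_mul, Finset.sum_congr rfl this, Finset.sum_comm]
    refine Finset.sum_congr rfl fun m _ => ?_
    rw [← Finset.smul_sum, pow_succ', coeff_mul]
  rw [smul_mul_assoc, coeff_smul', h1, coeff_euler,
    coeff_expSer hX (K := β.degree + 1 + 1) (by lia), Finset.sum_range_succ', smul_add,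
    Finset.smul_sum, Finset.smul_sum]
  have h0 : ∀ m : ℕ, (Finsupp.weight n β : ℂ) • coeff β (X ^ m) = (m * k) • coeff β (X ^ m) := by
    intro m
    rw [← coeff_euler, euler_pow hXk, coeff_smul']
  rw [smul_comm, h0 0]
  simp only [Nat.cast_zero, zero_mul, zero_smul, smul_zero, add_zero]
  refine Finset.sum_congr rfl fun m _ => ?_
  rw [smul_comm, h0, smul_smul, smul_smul, Nat.factorial_succ]
  congr 1
  have : ((m : ℂ) + 1) ≠ 0 := by exact_mod_cast Nat.succ_ne_zero m
  push_cast
  field_simp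

/-- The exponential of a series without constant term, as a unit. -/
def expUnit (X : MvPowerSeries σ 𝒜) (hX : constantCoeff X = 0) : (MvPowerSeries σ 𝒜)ˣ :=
  oneUnit (expSer X) (constantCoeff_expSer hX)

theorem expUnit_mem_lieGroup (hL : IsLieFamily L) (hn : ∀ i, n i ≠ 0) {X : MvPowerSeries σ 𝒜}
    (hX : X ∈ lieSeries L) {k : ℂ} (hXk : euler n X = k • X) :
    expUnit X hX.1 ∈ lieGroup hL hn := by
  refine ⟨constantCoeff_expSer hX.1, ?_⟩
  have : euler n (expUnit X hX.1 : MvPowerSeries σ 𝒜) = (k • X) * expUnit X hX.1 :=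
    euler_expSer hX.1 hXk
  rw [this, mul_assoc, Units.mul_inv, mul_one]
  exact Submodule.smul_mem _ _ hX

theorem mem_fil_of_euler_eq {X : MvPowerSeries σ 𝒜} {k : ℕ} (hXk : euler n X = (k : ℂ) • X) :
    X ∈ fil n k := by
  intro β hβ
  have h := congrArg (coeff β) hXk
  rw [coeff_euler, coeff_smul', ← sub_eq_zero, ← sub_smul, smul_eq_zero, sub_eq_zero] at h
  refine h.resolve_left fun h => ?_
  exact hβ.ne (by exact_mod_cast h)

theorem expSer_sub_one_sub_mem_fil (hn : ∀ i, n i ≠ 0) {X : MvPowerSeries σ 𝒜} {k : ℕ}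
    (hk : k ≠ 0) (hX : X ∈ fil n k) : expSer X - 1 - X ∈ fil n (k + 1) := by
  have hX0 : constantCoeff X = 0 := (mem_fil_one hn).1 (fil_anti (Nat.pos_of_ne_zero hk) hX)
  intro β hβ
  rw [map_sub, map_sub, coeff_expSer hX0 (K := β.degree + 1 + 1) (by lia),
    Finset.sum_range_succ', Finset.sum_range_succ', Finset.sum_eq_zero]
  · simp
  · intro m _
    rw [pow_mem_fil hX (m + 1 + 1) β, smul_zero]
    have : k + k ≤ (m + 1 + 1) * k := by nlinarith
    lia

theorem map_expSer {ℬ : Type*} [Ring ℬ] [Algebra ℂ ℬ] (ψ : 𝒜 →ₐ[ℂ] ℬ) {X : MvPowerSeries σ 𝒜}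
    (hX : constantCoeff X = 0) :
    MvPowerSeries.map (ψ : 𝒜 →+* ℬ) (expSer X) =
      expSer (MvPowerSeries.map (ψ : 𝒜 →+* ℬ) X) := by
  ext β
  rw [coeff_map, coeff_expSer hX (Nat.lt_succ_self _),
    coeff_expSer (by simp [hX]) (Nat.lt_succ_self _), map_sum]
  refine Finset.sum_congr rfl fun m _ => ?_
  rw [← map_pow, coeff_map]
  simp

end Series

/-! ### Evaluation of homogeneous series on the completion -/

section Evaluation

variable {σ V : Type*} [AddCommGroup V] [Module ℂ V] (G : ℤ → Submodule ℂ V)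
  (n : σ → ℕ)

/-- The series of operators on `V` whose coefficient of index `β` raises degrees by the weight of
`β`. -/
def homSer : Submonoid (MvPowerSeries σ (Module.End ℂ V)) where
  carrier := {g | ∀ β (m : ℤ) (v : V), v ∈ G m → coeff β g v ∈ G (m + Finsupp.weight n β)}
  one_mem' := by
    classical
    intro β m v hv
    rw [coeff_one]
    split_ifs with h
    · simpa [h] using hv
    · simp
  mul_mem' := by
    classical
    intro g h hg hh β m v hv
    rw [coeff_mul, LinearMap.sum_apply]
    refine Submodule.sum_mem _ fun p hp => ?_
    have := hg p.1 _ _ (hh p.2 m v hv)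
    rw [add_assoc, ← Nat.cast_add, ← map_add, add_comm p.2,
      Finset.HasAntidiagonal.mem_antidiagonal.1 hp] at this
    exact this

variable {G n}

/-- If the elements of `L β` raise degrees by the weight of `β`, then so do the coefficients of the
series in the group, by recursion from the logarithmic derivative. The weights `n₀` that define the
group need not be those of the grading. -/
theorem mem_homSer_of_mem_lieGroup {L : (σ →₀ ℕ) → Submodule ℂ (Module.End ℂ V)}
    {hL : IsLieFamily L} {n₀ : σ → ℕ} {hn₀ : ∀ i, n₀ i ≠ 0}
    (hG : ∀ β, ∀ x ∈ L β, ∀ (m : ℤ), ∀ v ∈ G m, x v ∈ G (m + Finsupp.weight n β))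
    {u : (MvPowerSeries σ (Module.End ℂ V))ˣ} (hu : u ∈ lieGroup hL hn₀) :
    (u : MvPowerSeries σ (Module.End ℂ V)) ∈ homSer G n := by
  classical
  obtain ⟨hu1, hc⟩ := hu
  set c := euler n₀ (u : MvPowerSeries σ (Module.End ℂ V)) * ↑u⁻¹ with hc'
  have huc : euler n₀ (u : MvPowerSeries σ (Module.End ℂ V)) = c * u := by
    rw [hc', mul_assoc, u.inv_mul, mul_one]
  have main : ∀ k β, Finsupp.weight n₀ β = k → ∀ (m : ℤ) (v : V), v ∈ G m →
      coeff β (u : MvPowerSeries σ (Module.End ℂ V)) v ∈ G (m + Finsupp.weight n β) := by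
    intro k
    induction k using Nat.strong_induction_on with
    | _ k ih =>
      intro β hβ m v hv
      by_cases hβ0 : β = 0
      · subst hβ0
        simpa [hu1] using hv
      have h1 := congrArg (fun g : MvPowerSeries σ (Module.End ℂ V) => coeff β g v) huc
      simp only [coeff_euler, coeff_mul, LinearMap.sum_apply, LinearMap.smul_apply] at h1
      refine (Submodule.smul_mem_iff _ (Nat.cast_ne_zero.2 (weight_ne_zero hn₀ hβ0) :
        (Finsupp.weight n₀ β : ℂ) ≠ 0)).1 ?_
      rw [h1]
      refine Submodule.sum_mem _ fun p hp => ?_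
      have hp' := Finset.HasAntidiagonal.mem_antidiagonal.1 hp
      by_cases hp1 : p.1 = 0
      · simp [hp1, hc.1]
      have hlt : Finsupp.weight n₀ p.2 < k := by
        rw [← hβ, ← hp', map_add]
        have := weight_ne_zero hn₀ hp1
        lia
      have := hG p.1 _ (hc.2 p.1) _ _ (ih _ hlt p.2 rfl m v hv)
      rw [add_assoc, ← Nat.cast_add, ← map_add, add_comm p.2, hp'] at this
      exact this
  exact fun β => main _ β rfl

/-- The finite set of the indices of weight at most `k`. -/
def box [Finite σ] (hn : ∀ i, n i ≠ 0) (k : ℕ) : Finset (σ →₀ ℕ) :=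
  (Finsupp.finite_of_nat_weight_le n hn k).toFinset

theorem mem_box [Finite σ] {hn : ∀ i, n i ≠ 0} {k : ℕ} {β : σ →₀ ℕ} :
    β ∈ box hn k ↔ Finsupp.weight n β ≤ k := by
  simp [box]

theorem finsum_eq_sum_of_vanish {g : MvPowerSeries σ (Module.End ℂ V)} {v : completion G} {N : ℤ}
    (hv : ∀ m < N, v.1 m = 0) {m : ℤ} {B : Finset (σ →₀ ℕ)}
    (hB : ∀ β, (Finsupp.weight n β : ℤ) ≤ m - N → β ∈ B) :
    ∑ᶠ β, coeff β g (v.1 (m - Finsupp.weight n β) : V) =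
      ∑ β ∈ B, coeff β g (v.1 (m - Finsupp.weight n β) : V) := by
  refine finsum_eq_sum_of_support_subset _ fun β hβ => hB β ?_
  by_contra h
  refine hβ ?_
  simp only [hv (m - Finsupp.weight n β) (by lia), ZeroMemClass.coe_zero, map_zero]

variable [Finite σ] (hn : ∀ i, n i ≠ 0)

theorem box_spec {m N : ℤ} (β : σ →₀ ℕ) (h : (Finsupp.weight n β : ℤ) ≤ m - N) :
    β ∈ box hn (m - N).toNat :=
  mem_box.2 (by lia)

/-- The operator `∑ β, g_β` on the completion given by a homogeneous series `g`; each component of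
its values is a finite sum. -/
def ev (g : homSer G n) : Module.End ℂ (completion G) where
  toFun v := ⟨fun m => ⟨∑ᶠ β, coeff β g.1 (v.1 (m - Finsupp.weight n β) : V), by
      refine finsum_induction (fun x => x ∈ G m) (zero_mem _) (fun _ _ => add_mem) fun β => ?_
      have := g.2 β _ _ (v.1 (m - Finsupp.weight n β)).2
      rwa [sub_add_cancel] at this⟩, by
    obtain ⟨N, hN⟩ := v.2
    refine ⟨N, fun m hm => Subtype.ext ?_⟩
    refine (finsum_eq_sum_of_vanish (B := ∅) hN fun β hβ => ?_).trans Finset.sum_empty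
    lia⟩
  map_add' v w := by
    obtain ⟨N, hN⟩ := v.2
    obtain ⟨M, hM⟩ := w.2
    have hN' : ∀ m < min N M, v.1 m = 0 := fun m hm => hN m (by lia)
    have hM' : ∀ m < min N M, w.1 m = 0 := fun m hm => hM m (by lia)
    have hNM : ∀ m < min N M, (v + w).1 m = 0 := fun m hm => by
      change v.1 m + w.1 m = 0
      rw [hN' m hm, hM' m hm, add_zero]
    refine Subtype.ext (funext fun m => Subtype.ext ?_)
    change ∑ᶠ β, coeff β g.1 ((v + w).1 (m - Finsupp.weight n β) : V) =
      ∑ᶠ β, coeff β g.1 (v.1 (m - Finsupp.weight n β) : V) +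
        ∑ᶠ β, coeff β g.1 (w.1 (m - Finsupp.weight n β) : V)
    rw [finsum_eq_sum_of_vanish hNM (box_spec hn), finsum_eq_sum_of_vanish hN' (box_spec hn),
      finsum_eq_sum_of_vanish hM' (box_spec hn), ← Finset.sum_add_distrib]
    exact Finset.sum_congr rfl fun β _ => map_add _ _ _
  map_smul' a v := by
    obtain ⟨N, hN⟩ := v.2
    have hN' : ∀ m < N, (a • v).1 m = 0 := fun m hm => by
      change a • v.1 m = 0
      rw [hN m hm, smul_zero]
    refine Subtype.ext (funext fun m => Subtype.ext ?_)
    change ∑ᶠ β, coeff β g.1 ((a • v).1 (m - Finsupp.weight n β) : V) =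
      a • ∑ᶠ β, coeff β g.1 (v.1 (m - Finsupp.weight n β) : V)
    rw [finsum_eq_sum_of_vanish hN' (box_spec hn), finsum_eq_sum_of_vanish hN (box_spec hn),
      Finset.smul_sum]
    exact Finset.sum_congr rfl fun β _ => map_smul _ _ _

theorem ev_apply (g : homSer G n) {v : completion G} {N : ℤ} (hv : ∀ m < N, v.1 m = 0) {m : ℤ}
    {B : Finset (σ →₀ ℕ)} (hB : ∀ β, (Finsupp.weight n β : ℤ) ≤ m - N → β ∈ B) :
    ((ev hn g v).1 m : V) = ∑ β ∈ B, coeff β g.1 (v.1 (m - Finsupp.weight n β) : V) :=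
  finsum_eq_sum_of_vanish hv hB

theorem ev_vanish (g : homSer G n) {v : completion G} {N : ℤ} (hv : ∀ m < N, v.1 m = 0) :
    ∀ m < N, (ev hn g v).1 m = 0 := by
  intro m hm
  refine Subtype.ext ((ev_apply hn g hv (B := ∅) fun β hβ => ?_).trans Finset.sum_empty)
  lia

theorem ev_one : ev hn (1 : homSer G n) = 1 := by
  classical
  refine LinearMap.ext fun v => Subtype.ext (funext fun m => Subtype.ext ?_)
  obtain ⟨N, hN⟩ := v.2
  rw [ev_apply hn 1 hN (B := insert 0 (box hn (m - N).toNat)) fun β hβ =>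
    Finset.mem_insert_of_mem (box_spec hn β hβ), Finset.sum_eq_single_of_mem 0
    (Finset.mem_insert_self _ _)]
  · change coeff 0 (1 : MvPowerSeries σ (Module.End ℂ V)) _ = _
    rw [coeff_zero_one, Module.End.one_apply]
    exact congrArg (fun j => (v.1 j : V)) (by simp)
  · intro β _ hβ
    change coeff β (1 : MvPowerSeries σ (Module.End ℂ V)) _ = 0
    rw [coeff_one, if_neg hβ, LinearMap.zero_apply]

theorem ev_mul (g h : homSer G n) : ev hn (g * h) = ev hn g * ev hn h := by
  classical
  refine LinearMap.ext fun v => Subtype.ext (funext fun m => Subtype.ext ?_)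
  obtain ⟨N, hN⟩ := v.2
  set B := box hn (m - N).toNat with hB
  have hBspec : ∀ β, (Finsupp.weight n β : ℤ) ≤ m - N → β ∈ B := box_spec hn
  have hB' : ∀ β, β ∉ B → m - Finsupp.weight n β < N := fun β hβ => by
    by_contra hlt
    exact hβ (hBspec β (by lia))
  rw [Module.End.mul_apply, ev_apply hn g (ev_vanish hn h hN) hBspec, ev_apply hn _ hN hBspec]
  -- both sides are the sum of `g_γ h_δ v` over the pairs with `γ + δ` in the box
  have hl : ∀ β ∈ B, coeff β (g * h).1 (v.1 (m - Finsupp.weight n β) : V) =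
      ∑ p ∈ B ×ˢ B, if p.1 + p.2 = β then
        coeff p.1 g.1 (coeff p.2 h.1 (v.1 (m - Finsupp.weight n β) : V)) else 0 := by
    intro β hβ
    change coeff β (g.1 * h.1) _ = _
    rw [coeff_mul, LinearMap.sum_apply, ← Finset.sum_filter]
    refine Finset.sum_congr ?_ fun p _ => rfl
    ext p
    rw [Finset.HasAntidiagonal.mem_antidiagonal, Finset.mem_filter, Finset.mem_product]
    refine ⟨fun hp => ⟨⟨?_, ?_⟩, hp⟩, fun hp => hp.2⟩ <;>
    · rw [← hp, hB, mem_box, map_add] at hβ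
      rw [hB, mem_box]
      lia
  have hr : ∀ γ ∈ B, coeff γ g.1 ((ev hn h v).1 (m - Finsupp.weight n γ) : V) =
      ∑ δ ∈ B, coeff γ g.1 (coeff δ h.1 (v.1 (m - Finsupp.weight n (γ + δ)) : V)) := by
    intro γ _
    rw [ev_apply hn h hN (B := B) fun δ hδ => hBspec δ (by lia), map_sum]
    refine Finset.sum_congr rfl fun δ _ => ?_
    rw [map_add, Nat.cast_add, sub_sub]
  rw [Finset.sum_congr rfl hl, Finset.sum_congr rfl hr, ← Finset.sum_product' B B
    fun γ δ => coeff γ g.1 (coeff δ h.1 (v.1 (m - Finsupp.weight n (γ + δ)) : V)),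
    Finset.sum_comm]
  refine Finset.sum_congr rfl fun p _ => ?_
  by_cases hp : p.1 + p.2 ∈ B
  · rw [Finset.sum_eq_single_of_mem _ hp, if_pos rfl]
    intro β _ hβ
    rw [if_neg (Ne.symm hβ)]
  · rw [hN _ (hB' _ hp), Finset.sum_eq_zero]
    · simp
    · intro β hβ
      rw [if_neg]
      rintro rfl
      exact hp hβ

theorem ev_pow (g : homSer G n) (k : ℕ) : ev hn (g ^ k) = ev hn g ^ k := by
  induction k with
  | zero => rw [pow_zero, pow_zero, ev_one]
  | succ k ih => rw [pow_succ, pow_succ, ev_mul, ih]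

/-- Series that agree in low weights give operators that agree in low degrees. -/
theorem ev_eq_of_sub_mem_fil {g h : homSer G n} {k : ℕ} (hgh : g.1 - h.1 ∈ fil n k)
    {v : completion G} {N : ℤ} (hv : ∀ m < N, v.1 m = 0) {m : ℤ} (hm : m < N + k) :
    (ev hn g v).1 m = (ev hn h v).1 m := by
  refine Subtype.ext ?_
  rw [ev_apply hn g hv (box_spec hn), ev_apply hn h hv (box_spec hn)]
  refine Finset.sum_congr rfl fun β hβ => ?_
  rw [mem_box] at hβ
  by_cases hβk : Finsupp.weight n β < k
  · have := hgh β hβk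
    rw [map_sub, sub_eq_zero] at this
    rw [this]
  · rw [hv (m - Finsupp.weight n β) (by lia)]
    simp

theorem ev_sub_one_raises {g : homSer G n} (hg : constantCoeff g.1 = 1) :
    Raises (ev hn g - 1) := by
  intro N v hv m hm
  rw [LinearMap.sub_apply, Module.End.one_apply]
  change (ev hn g v).1 m - v.1 m = 0
  rw [sub_eq_zero, ev_eq_of_sub_mem_fil hn (h := 1) (k := 1) (sub_one_mem_fil hn hg) hv
    (by exact_mod_cast hm), ev_one, Module.End.one_apply]

/-- The exponential of an operator on the completion is given by the exponential series. -/
theorem ev_expSer {X : homSer G n} (hX : constantCoeff X.1 = 0) (g : homSer G n)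
    (hg : g.1 = expSer X.1) {D : Module.End ℂ (completion G)} (hD : Raises D) (hDX : ev hn X = D) :
    ev hn g = proSum (fun k => ((k.factorial : ℂ))⁻¹) D hD := by
  refine LinearMap.ext fun v => Subtype.ext (funext fun m => Subtype.ext ?_)
  obtain ⟨N, hN⟩ := v.2
  set K := (m - N).toNat + 1 with hK
  have h1 : (proSum (fun k => ((k.factorial : ℂ))⁻¹) D hD v).1 m =
      ∑ k ∈ Finset.range K, ((k.factorial : ℂ))⁻¹ • ((D ^ k) v).1 m := by
    refine finsum_eq_sum_of_support_subset _ fun k hk => ?_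
    by_contra hlt
    refine hk ?_
    have hle : K ≤ k := by simpa using hlt
    simp only [hD.pow k N v hN m (by lia), smul_zero]
  rw [h1, ev_apply hn g hN (box_spec hn), hg, Submodule.coe_sum]
  have h2 : ∀ β ∈ box hn (m - N).toNat,
      coeff β (expSer X.1) (v.1 (m - Finsupp.weight n β) : V) = ∑ k ∈ Finset.range K,
        (k.factorial : ℂ)⁻¹ • coeff β (X.1 ^ k) (v.1 (m - Finsupp.weight n β) : V) := by
    intro β hβ
    have := degree_le_weight hn β
    rw [mem_box] at hβ
    rw [coeff_expSer hX (K := K) (by lia), LinearMap.sum_apply]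
    rfl
  rw [Finset.sum_congr rfl h2, Finset.sum_comm]
  refine Finset.sum_congr rfl fun k _ => ?_
  rw [← Finset.smul_sum, ← hDX, ← ev_pow, Submodule.coe_smul,
    ev_apply hn (X ^ k) hN (box_spec hn)]
  rfl

variable {L : (σ →₀ ℕ) → Submodule ℂ (Module.End ℂ V)} (hL : IsLieFamily L) {n₀ : σ → ℕ}
  (hn₀ : ∀ i, n₀ i ≠ 0)
  (hG : ∀ β, ∀ x ∈ L β, ∀ (m : ℤ), ∀ v ∈ G m, x v ∈ G (m + Finsupp.weight n β))

/-- The action of the group of series on the completion. -/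
def evGL : lieGroup hL hn₀ →* GLHat G where
  toFun u := LinearEquiv.ofBijective (ev hn ⟨u.1.1, mem_homSer_of_mem_lieGroup hG u.2⟩)
    ⟨(ev_sub_one_raises hn u.2.1).injective, (ev_sub_one_raises hn u.2.1).surjective⟩
  map_one' := LinearEquiv.ext fun v => congrArg (fun T : Module.End ℂ (completion G) => T v)
    (ev_one hn)
  map_mul' u u' := LinearEquiv.ext fun v => congrArg (fun T : Module.End ℂ (completion G) => T v)
    (ev_mul hn ⟨u.1.1, mem_homSer_of_mem_lieGroup hG u.2⟩
      ⟨u'.1.1, mem_homSer_of_mem_lieGroup hG u'.2⟩)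

theorem evGL_apply (u : lieGroup hL hn₀) (v : completion G) :
    evGL hn hL hn₀ hG u v = ev hn ⟨u.1.1, mem_homSer_of_mem_lieGroup hG u.2⟩ v := rfl

/-! ### The topology of pointwise convergence -/

/-- Pointwise convergence, in the strong sense that each component of each value is eventually
constant. -/
theorem tendsto_glHat {α : Type*} {l : Filter α} {T : α → GLHat G} {T₀ : GLHat G}
    (h : ∀ (v : completion G) (m : ℤ), ∀ᶠ a in l, (T a v).1 m = (T₀ v).1 m) :
    Tendsto T l (𝓝 T₀) := by
  rw [nhds_induced, tendsto_comap_iff, tendsto_pi_nhds]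
  intro v
  let _ : ∀ m, TopologicalSpace (G m) := fun m => moduleTopology ℂ (G m)
  rw [nhds_induced, tendsto_comap_iff]
  rw [tendsto_pi_nhds]
  intro m
  exact tendsto_nhds_of_eventually_eq (h v m)

theorem tendsto_evGL {u : ℕ → lieGroup hL hn₀} {g : lieGroup hL hn₀}
    (h : ∀ k, (g.1 : MvPowerSeries σ (Module.End ℂ V)) - (u k).1 ∈ fil n k) :
    Tendsto (fun k => evGL hn hL hn₀ hG (u k)) atTop (𝓝 (evGL hn hL hn₀ hG g)) := by
  refine tendsto_glHat fun v m => ?_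
  obtain ⟨N, hN⟩ := v.2
  filter_upwards [eventually_ge_atTop (m - N + 1).toNat] with k hk
  rw [evGL_apply, evGL_apply]
  exact (ev_eq_of_sub_mem_fil hn (h k) hN (by lia)).symm

end Evaluation

section Topology

variable {V : Type*} [AddCommGroup V] [Module ℂ V] {G : ℤ → Submodule ℂ V}

/-- The module topology of a complex vector space is Hausdorff, because linear forms are continuous
and separate points. -/
theorem t2Space_moduleTopology (E : Type*) [AddCommGroup E] [Module ℂ E] :
    @T2Space E (moduleTopology ℂ E) := by
  let _ : TopologicalSpace E := moduleTopology ℂ E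
  have : IsModuleTopology ℂ E := ⟨rfl⟩
  refine T2Space.of_injective_continuous (f := fun (x : E) (φ : Module.Dual ℂ E) => φ x) ?_
    (continuous_pi fun φ => IsModuleTopology.continuous_of_linearMap φ)
  intro x y hxy
  rw [← sub_eq_zero, ← Module.forall_dual_apply_eq_zero_iff ℂ]
  intro φ
  rw [map_sub, sub_eq_zero]
  exact congrFun hxy φ

instance t2Space_completion : T2Space (completion G) := by
  let _ : ∀ m, TopologicalSpace (G m) := fun m => moduleTopology ℂ (G m)
  have : ∀ m, T2Space (G m) := fun m => t2Space_moduleTopology _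
  exact T2Space.of_injective_continuous (f := fun v : completion G => (v : ∀ m, G m))
    Subtype.val_injective continuous_induced_dom

instance t2Space_glHat : T2Space (GLHat G) :=
  T2Space.of_injective_continuous (f := fun g : GLHat G => (g : completion G → completion G))
    DFunLike.coe_injective continuous_induced_dom

/-- The matrix coefficients of an automorphism of the completion are continuous. -/
theorem continuous_coeff (v : completion G) (m : ℤ) (φ : Module.Dual ℂ V) :
    Continuous fun T : GLHat G => φ ((T v).1 m : V) := by
  let _ : ∀ m, TopologicalSpace (G m) := fun m => moduleTopology ℂ (G m)
  have : ∀ m, IsModuleTopology ℂ (G m) := fun m => ⟨rfl⟩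
  have h1 : Continuous fun T : GLHat G => T v :=
    (continuous_apply v).comp continuous_induced_dom
  have h2 : Continuous fun w : completion G => w.1 m :=
    (continuous_apply m).comp continuous_induced_dom
  exact (IsModuleTopology.continuous_of_linearMap (φ ∘ₗ (G m).subtype)).comp (h2.comp h1)

/-- A map into the linear group is continuous if the vectors `T z v` depend continuously on `z`,
in the module topology of the whole space `V`. (This topology induces the module topology on every
homogeneous component, because the component has a linear complement.) -/
theorem continuous_glHat {Z : Type*} [TopologicalSpace Z] {T : Z → GLHat G}
    (h : ∀ (v : completion G) (m : ℤ),
      @Continuous Z V _ (moduleTopology ℂ V) fun z => ((T z v).1 m : V)) :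
    Continuous T := by
  let _ : ∀ m, TopologicalSpace (G m) := fun m => moduleTopology ℂ (G m)
  have : ∀ m, IsModuleTopology ℂ (G m) := fun m => ⟨rfl⟩
  have : ∀ m, ContinuousAdd (G m) := fun m => IsModuleTopology.toContinuousAdd ℂ _
  let _ : TopologicalSpace V := moduleTopology ℂ V
  have : IsModuleTopology ℂ V := ⟨rfl⟩
  refine continuous_induced_rng.2 (continuous_pi fun v => continuous_induced_rng.2
    (continuous_pi fun m => ?_))
  obtain ⟨π, hπ⟩ := (G m).subtype.exists_leftInverse_of_injective (Submodule.ker_subtype _)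
  have h1 : (fun z => (T z v).1 m) = π ∘ fun z => ((T z v).1 m : V) :=
    funext fun z => (LinearMap.congr_fun hπ ((T z v).1 m)).symm
  change Continuous fun z => (T z v).1 m
  rw [h1]
  exact (IsModuleTopology.continuous_of_linearMap π).comp (h v m)

end Topology

/-! ### Coordinates on the group -/

section Coordinates

/-- A map into a finite-dimensional space whose values under a separating set of linear forms can
be recovered continuously from `θ` can itself be recovered continuously. -/
theorem exists_continuous_recovery {Z C E : Type*} [TopologicalSpace Z] [AddCommGroup E]
    [Module ℂ E] [FiniteDimensional ℂ E] (θ : C → Z) (pt : C → E) (Λ : Set (Module.Dual ℂ E))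
    (hsep : ∀ x : E, (∀ ℓ ∈ Λ, ℓ x = 0) → x = 0)
    (h : ∀ ℓ ∈ Λ, ∃ κ : Z → ℂ, Continuous κ ∧ ∀ c, κ (θ c) = ℓ (pt c)) :
    ∃ κ : Z → E, @Continuous Z E _ (moduleTopology ℂ E) κ ∧ ∀ c, κ (θ c) = pt c := by
  let S : Submodule ℂ (Module.Dual ℂ E) :=
    { carrier := {ℓ | ∃ κ : Z → ℂ, Continuous κ ∧ ∀ c, κ (θ c) = ℓ (pt c)}
      zero_mem' := ⟨0, continuous_const, fun _ => rfl⟩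
      add_mem' := by
        rintro ℓ ℓ' ⟨κ, hκ, h⟩ ⟨κ', hκ', h'⟩
        exact ⟨κ + κ', hκ.add hκ', fun c => by
          rw [Pi.add_apply, h, h', LinearMap.add_apply]⟩
      smul_mem' := by
        rintro a ℓ ⟨κ, hκ, h⟩
        exact ⟨a • κ, hκ.const_smul a, fun c => congrArg (a • ·) (h c)⟩ }
  have htop : S = ⊤ := by
    have h1 : S.dualCoannihilator = ⊥ := by
      rw [eq_bot_iff]
      exact fun x hx => hsep x fun ℓ hℓ => (Submodule.mem_dualCoannihilator x).1 hx ℓ (h ℓ hℓ)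
    rw [← Subspace.dualCoannihilator_dualAnnihilator_eq (W := S), h1,
      Submodule.dualAnnihilator_bot]
  let b := Module.finBasis ℂ E
  have hb : ∀ i, ∃ κ : Z → ℂ, Continuous κ ∧ ∀ c, κ (θ c) = b.coord i (pt c) := fun i => by
    have : b.coord i ∈ S := by rw [htop]; trivial
    exact this
  choose κ hκ hκθ using hb
  let _ : TopologicalSpace E := moduleTopology ℂ E
  have : IsModuleTopology ℂ E := ⟨rfl⟩
  have : ContinuousAdd E := IsModuleTopology.toContinuousAdd ℂ E
  refine ⟨fun z => ∑ i, κ i z • b i, ?_, fun c => ?_⟩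
  · exact continuous_finsetSum _ fun i _ => (hκ i).smul continuous_const
  · simp only [hκθ]
    exact b.sum_repr (pt c)

variable {σ 𝔤 : Type*} [LieRing 𝔤] [LieAlgebra ℂ 𝔤] (gs : (σ →₀ ℕ) → Submodule ℂ 𝔤)

/-- The completion `∏_{β ≠ 0} 𝔤_β` of the positive part of a graded Lie algebra. -/
def NHat : Type _ := ∀ β : {β : σ →₀ ℕ // β ≠ 0}, gs β

/-- The product topology, where each factor carries its module topology. -/
instance : TopologicalSpace (NHat gs) :=
  @Pi.topologicalSpace _ _ fun β : {β : σ →₀ ℕ // β ≠ 0} => moduleTopology ℂ (gs β)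

variable {gs}

open Classical in
/-- The component of index `β` in `𝔤` of an element of the completion; it is zero for `β = 0`. -/
def NHat.comp (c : NHat gs) (β : σ →₀ ℕ) : 𝔤 := if h : β ≠ 0 then (c ⟨β, h⟩ : 𝔤) else 0

theorem NHat.comp_mem (c : NHat gs) (β : σ →₀ ℕ) : c.comp β ∈ gs β := by
  rw [NHat.comp]
  split_ifs with h
  · exact (c ⟨β, h⟩).2
  · exact zero_mem _

theorem NHat.comp_zero (c : NHat gs) : c.comp 0 = 0 := by
  rw [NHat.comp, dif_neg (by simp)]

theorem NHat.comp_of_ne (c : NHat gs) {β : σ →₀ ℕ} (h : β ≠ 0) : c.comp β = c ⟨β, h⟩ := by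
  rw [NHat.comp, dif_pos h]

variable {𝒜 : Type*} [Ring 𝒜] [Algebra ℂ 𝒜] (φ : 𝔤 →ₗ[ℂ] 𝒜)

/-- The linear map `φ` is a homomorphism to the commutator Lie algebra of `𝒜`. -/
def IsLieRep : Prop := ∀ x y, φ ⁅x, y⁆ = φ x * φ y - φ y * φ x

/-- The series `∑ β, φ(c_β)` over `β`. -/
def ser (c : NHat gs) : MvPowerSeries σ 𝒜 := fun β => φ (c.comp β)

theorem coeff_ser (c : NHat gs) (β : σ →₀ ℕ) : coeff β (ser φ c) = φ (c.comp β) := rfl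

theorem constantCoeff_ser (c : NHat gs) : constantCoeff (ser φ c) = 0 := by
  rw [← coeff_zero_eq_constantCoeff_apply, coeff_ser, c.comp_zero, map_zero]

variable (gs) in
/-- The images of the homogeneous components in `𝒜`. -/
def imageFamily (β : σ →₀ ℕ) : Submodule ℂ 𝒜 := (gs β).map φ

variable {φ}

theorem isLieFamily_imageFamily (hφ : IsLieRep φ)
    (hgs : ∀ γ δ, ∀ x ∈ gs γ, ∀ y ∈ gs δ, ⁅x, y⁆ ∈ gs (γ + δ)) :
    IsLieFamily (imageFamily gs φ) := by
  rintro γ δ _ _ ⟨x, hx, rfl⟩ ⟨y, hy, rfl⟩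
  exact ⟨⁅x, y⁆, hgs γ δ x hx y hy, hφ x y⟩

theorem ser_mem_lieSeries (c : NHat gs) : ser φ c ∈ lieSeries (imageFamily gs φ) :=
  ⟨constantCoeff_ser φ c, fun β => ⟨c.comp β, c.comp_mem β, rfl⟩⟩

theorem exists_ser_eq {Y : MvPowerSeries σ 𝒜} (hY : Y ∈ lieSeries (imageFamily gs φ)) :
    ∃ c : NHat gs, ser φ c = Y ∧ ∀ β, coeff β Y = 0 → c.comp β = 0 := by
  classical
  choose x hx hxY using hY.2
  let c : NHat gs := fun β => ⟨if coeff β.1 Y = 0 then 0 else x β.1, by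
    split_ifs
    · exact zero_mem _
    · exact hx _⟩
  refine ⟨c, ?_, fun β hβ => ?_⟩
  · ext β
    rw [coeff_ser]
    by_cases h : β = 0
    · rw [h, NHat.comp_zero, map_zero, coeff_zero_eq_constantCoeff, hY.1]
    · rw [NHat.comp_of_ne _ h]
      change φ (if coeff β Y = 0 then 0 else x β) = _
      split_ifs with h0
      · rw [map_zero, h0]
      · exact hxY β
  · by_cases h : β = 0
    · rw [h, NHat.comp_zero]
    · rw [NHat.comp_of_ne _ h]
      exact if_pos hβ

variable {n₀ : σ → ℕ} (hn₀ : ∀ i, n₀ i ≠ 0)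

/-- The group element with logarithmic derivative `c`. -/
def solUnit (hL : IsLieFamily (imageFamily gs φ)) (c : NHat gs) : lieGroup hL hn₀ :=
  ⟨oneUnit (sol n₀ (ser φ c)) (constantCoeff_sol _ _),
    sol_mem_lieGroup hL hn₀ (ser_mem_lieSeries c)⟩

theorem solUnit_surjective (hL : IsLieFamily (imageFamily gs φ)) :
    Function.Surjective (solUnit hn₀ hL) := by
  rintro ⟨u, hu⟩
  obtain ⟨Y, hY, huY⟩ := exists_eq_sol hL hn₀ hu
  obtain ⟨c, hc, _⟩ := exists_ser_eq hY
  refine ⟨c, Subtype.ext (Units.ext ?_)⟩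
  rw [huY, ← hc]
  rfl

end Coordinates

section Embedding

variable {σ 𝔤 V : Type*} [LieRing 𝔤] [LieAlgebra ℂ 𝔤] {gs : (σ →₀ ℕ) → Submodule ℂ 𝔤}
  [AddCommGroup V] [Module ℂ V] {φ : 𝔤 →ₗ[ℂ] Module.End ℂ V} {n₀ : σ → ℕ}

/-- The coefficients of the solution depend continuously on the logarithmic derivative. -/
theorem continuous_coeff_sol (hn₀ : ∀ i, n₀ i ≠ 0)
    (hfin : ∀ β ≠ 0, FiniteDimensional ℂ (gs β)) (β : σ →₀ ℕ) (v : V) :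
    @Continuous (NHat gs) V _ (moduleTopology ℂ V) fun c => coeff β (sol n₀ (ser φ c)) v := by
  classical
  let _ : TopologicalSpace V := moduleTopology ℂ V
  have : IsModuleTopology ℂ V := ⟨rfl⟩
  have : ContinuousAdd V := IsModuleTopology.toContinuousAdd ℂ V
  have main : ∀ k β, Finsupp.weight n₀ β = k →
      Continuous fun c : NHat gs => coeff β (sol n₀ (ser φ c)) v := by
    intro k
    induction k using Nat.strong_induction_on with
    | _ k ih =>
      intro β hβ
      by_cases hβ0 : β = 0
      · subst hβ0
        simp only [coeff_sol_zero]
        exact continuous_const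
      have hw : (Finsupp.weight n₀ β : ℂ) ≠ 0 := Nat.cast_ne_zero.2 (weight_ne_zero hn₀ hβ0)
      have h1 : (fun c : NHat gs => coeff β (sol n₀ (ser φ c)) v) = fun c =>
          (Finsupp.weight n₀ β : ℂ)⁻¹ • ∑ p ∈ Finset.HasAntidiagonal.antidiagonal β,
            φ (c.comp p.1) (coeff p.2 (sol n₀ (ser φ c)) v) := by
        funext c
        have h := congrArg (fun g : MvPowerSeries σ (Module.End ℂ V) => coeff β g v)
          (euler_sol hn₀ (constantCoeff_ser φ c))
        simp only [coeff_euler, coeff_mul, LinearMap.sum_apply, LinearMap.smul_apply] at h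
        rw [eq_inv_smul_iff₀ hw, h]
        rfl
      rw [h1]
      refine continuous_const.smul (continuous_finsetSum _ fun p hp => ?_)
      have hp' := Finset.HasAntidiagonal.mem_antidiagonal.1 hp
      by_cases hp1 : p.1 = 0
      · simp only [hp1, NHat.comp_zero, map_zero, LinearMap.zero_apply]
        exact continuous_const
      have hlt : Finsupp.weight n₀ p.2 < k := by
        rw [← hβ, ← hp', map_add]
        have := weight_ne_zero hn₀ hp1
        lia
      let _ : TopologicalSpace (gs p.1) := moduleTopology ℂ (gs p.1)
      have : IsModuleTopology ℂ (gs p.1) := ⟨rfl⟩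
      have := hfin p.1 hp1
      have h2 : Continuous fun xw : gs p.1 × V => φ xw.1 xw.2 :=
        IsModuleTopology.continuous_bilinear_of_finite_left (R := ℂ)
          (φ ∘ₗ (gs p.1).subtype)
      have h3 : Continuous fun c : NHat gs => c ⟨p.1, hp1⟩ := by
        let _ : ∀ β : {β : σ →₀ ℕ // β ≠ 0}, TopologicalSpace (gs β) :=
          fun β => moduleTopology ℂ (gs β)
        exact continuous_apply (⟨p.1, hp1⟩ : {β : σ →₀ ℕ // β ≠ 0})
      have h4 := h2.comp (h3.prodMk (ih _ hlt p.2 rfl))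
      simp only [NHat.comp_of_ne _ hp1]
      exact h4
  exact main _ β rfl

/-- The set of indices of weight `k` is finite. -/
theorem finite_fiber [Finite σ] {n : σ → ℕ} (hn : ∀ i, n i ≠ 0) (k : ℕ) :
    Finite {β : σ →₀ ℕ // Finsupp.weight n β = k} :=
  (Finsupp.finite_of_nat_weight_eq n hn k).to_subtype

variable {G : ℤ → Submodule ℂ V} {n : σ → ℕ} [Finite σ] (hn₀ : ∀ i, n₀ i ≠ 0)
  (hn : ∀ i, n i ≠ 0)
  (hL : IsLieFamily (imageFamily gs φ))
  (hG : ∀ β, ∀ x ∈ imageFamily gs φ β, ∀ (m : ℤ), ∀ v ∈ G m, x v ∈ G (m + Finsupp.weight n β))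

/-- The group element with logarithmic derivative `c`, as an automorphism of the completion. -/
def param (c : NHat gs) : GLHat G := evGL hn hL hn₀ hG (solUnit hn₀ hL c)

theorem coe_param_apply (c : NHat gs) {v : completion G} {N : ℤ} (hv : ∀ m < N, v.1 m = 0)
    (m : ℤ) : ((param hn₀ hn hL hG c v).1 m : V) = ∑ β ∈ box hn (m - N).toNat,
      coeff β (sol n₀ (ser φ c)) (v.1 (m - Finsupp.weight n β) : V) :=
  ev_apply hn _ hv (box_spec hn)

theorem continuous_param (hfin : ∀ β ≠ 0, FiniteDimensional ℂ (gs β)) :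
    Continuous (param hn₀ hn hL hG) := by
  refine continuous_glHat fun v m => ?_
  obtain ⟨N, hN⟩ := v.2
  simp only [coe_param_apply hn₀ hn hL hG _ hN m]
  let _ : TopologicalSpace V := moduleTopology ℂ V
  have : IsModuleTopology ℂ V := ⟨rfl⟩
  have : ContinuousAdd V := IsModuleTopology.toContinuousAdd ℂ V
  exact continuous_finsetSum _ fun β _ => continuous_coeff_sol hn₀ hfin β _

/-- A homogeneous vector as an element of the completion. -/
def singleHat (m : ℤ) (v : G m) : completion G :=
  ⟨(Pi.single m v : ∀ m, G m), m, fun _ hj => Pi.single_eq_of_ne (M := fun m => G m) hj.ne v⟩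

theorem coe_param_singleHat (c : NHat gs) (m : ℤ) (v : G m) (k : ℕ) :
    ((param hn₀ hn hL hG c (singleHat m v)).1 (m + k) : V) =
      ∑ β ∈ (box hn k).filter fun β => Finsupp.weight n β = k,
        coeff β (sol n₀ (ser φ c)) (v : V) := by
  rw [coe_param_apply hn₀ hn hL hG c (N := m)
      (fun j hj => Pi.single_eq_of_ne (M := fun m => G m) hj.ne v),
    Finset.sum_filter]
  have : (m + k - m).toNat = k := by lia
  rw [this]
  refine Finset.sum_congr rfl fun β _ => ?_
  split_ifs with h
  · congr 1
    have : m + k - (Finsupp.weight n β : ℤ) = m := by lia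
    have e : ∀ j, j = m → ((singleHat m v).1 j : V) = v := by
      rintro j rfl
      change ((Pi.single j v : ∀ m, G m) j : V) = v
      rw [Pi.single_eq_same]
    exact e _ this
  · have : (singleHat m v).1 (m + k - (Finsupp.weight n β : ℤ)) = 0 :=
      Pi.single_eq_of_ne (M := fun m => G m) (by lia) v
    rw [this, ZeroMemClass.coe_zero, map_zero]

/-- If the action on the completion is faithful in each degree, then the components of `c` are
continuous functions of the group element. By induction, in weight `k` one knows the truncation of
`c` to weights below `k`; subtracting the contribution of the truncation from the degree `k` part
of the group element leaves a linear expression in the components of weight `k`. -/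
theorem exists_continuous_comp (hfin : ∀ β ≠ 0, FiniteDimensional ℂ (gs β))
    (hF : ∀ k : ℕ, k ≠ 0 → ∀ x : ∀ β : {β : σ →₀ ℕ // Finsupp.weight n β = k}, gs β,
      (∀ (m : ℤ), ∀ v ∈ G m, ∑ᶠ β, φ (x β) v = 0) → x = 0)
    (k : ℕ) : ∀ β : {β : σ →₀ ℕ // β ≠ 0}, Finsupp.weight n β.1 = k →
      ∃ κ : GLHat G → gs β, @Continuous _ _ _ (moduleTopology ℂ (gs β)) κ ∧
        ∀ c : NHat gs, κ (param hn₀ hn hL hG c) = c β := by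
  classical
  induction k using Nat.strong_induction_on with
  | _ k ih =>
    intro β₀ hβ₀
    have hk : k ≠ 0 := hβ₀ ▸ weight_ne_zero hn β₀.2
    have hfib : ∀ β : {β : σ →₀ ℕ // Finsupp.weight n β = k}, β.1 ≠ 0 := by
      rintro ⟨β, hβ⟩ rfl
      exact hk (by simpa using hβ.symm)
    have := finite_fiber hn k
    have hfint : Fintype {β : σ →₀ ℕ // Finsupp.weight n β = k} := Fintype.ofFinite _
    have : ∀ β : {β : σ →₀ ℕ // Finsupp.weight n β = k}, FiniteDimensional ℂ (gs β.1) :=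
      fun β => hfin β.1 (hfib β)
    -- the truncation of `c` as a function of the group element
    have ih' : ∀ β : {β : σ →₀ ℕ // β ≠ 0}, ∃ κ : GLHat G → gs β,
        @Continuous _ _ _ (moduleTopology ℂ (gs β)) κ ∧ ∀ c : NHat gs,
          κ (param hn₀ hn hL hG c) = if Finsupp.weight n β.1 < k then c β else 0 := by
      intro β
      split_ifs with h
      · exact ih _ h β rfl
      · exact ⟨fun _ => 0, @continuous_const _ _ _ (moduleTopology ℂ (gs β)) _, fun _ => rfl⟩
    choose κ hκ hκc using ih'
    let τ : GLHat G → NHat gs := fun T β => κ β T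
    have hτ : Continuous τ := by
      let _ : ∀ β : {β : σ →₀ ℕ // β ≠ 0}, TopologicalSpace (gs β) :=
        fun β => moduleTopology ℂ (gs β)
      exact continuous_pi hκ
    have hτc : ∀ c β, Finsupp.weight n β = k →
        (Finsupp.weight n₀ β : ℂ) • (coeff β (sol n₀ (ser φ c)) -
          coeff β (sol n₀ (ser φ (τ (param hn₀ hn hL hG c))))) = φ (c.comp β) := by
      intro c β hβ
      set c' := τ (param hn₀ hn hL hG c) with hc'
      have hcc' : ∀ γ, Finsupp.weight n γ < k → c'.comp γ = c.comp γ := by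
        intro γ hγ
        by_cases hγ0 : γ = 0
        · rw [hγ0, NHat.comp_zero, NHat.comp_zero]
        · rw [NHat.comp_of_ne _ hγ0, NHat.comp_of_ne _ hγ0]
          exact congrArg Subtype.val ((hκc ⟨γ, hγ0⟩ c).trans (if_pos hγ))
      have hcβ : c'.comp β = 0 := by
        have hβ0 : β ≠ 0 := hfib ⟨β, hβ⟩
        rw [NHat.comp_of_ne _ hβ0]
        exact congrArg Subtype.val ((hκc ⟨β, hβ0⟩ c).trans (if_neg hβ.not_lt))
      have := (coeff_sol_sub hn hn₀ (constantCoeff_ser φ c) (constantCoeff_ser φ c') (k := k)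
        fun γ hγ => by rw [map_sub, coeff_ser, coeff_ser, hcc' γ hγ, sub_self]).2 β hβ
      rw [this, coeff_ser, coeff_ser, hcβ, map_zero, sub_zero]
    -- the linear forms given by matrix coefficients
    let E := ∀ β : {β : σ →₀ ℕ // Finsupp.weight n β = k}, gs β.1
    let form : V → Module.Dual ℂ V → Module.Dual ℂ E := fun v ψ =>
      ∑ β : {β : σ →₀ ℕ // Finsupp.weight n β = k}, (Finsupp.weight n₀ β.1 : ℂ)⁻¹ •
        (ψ ∘ₗ φ.flip v ∘ₗ (gs β.1).subtype ∘ₗ LinearMap.proj β)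
    have hform : ∀ v ψ (x : E), form v ψ x = ψ (∑ β, φ ((Finsupp.weight n₀ β.1 : ℂ)⁻¹ •
        (x β : 𝔤)) v) := by
      intro v ψ x
      simp only [form, LinearMap.sum_apply, LinearMap.smul_apply, LinearMap.comp_apply, map_sum,
        map_smul, LinearMap.flip_apply, Submodule.subtype_apply]
      rfl
    have hrec : ∃ K : GLHat G → E, @Continuous _ E _ (moduleTopology ℂ E) K ∧
        ∀ c : NHat gs, K (param hn₀ hn hL hG c) = fun β => c ⟨β.1, hfib β⟩ := by
      refine exists_continuous_recovery (E := E) (param hn₀ hn hL hG)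
        (fun (c : NHat gs) β => c ⟨β.1, hfib β⟩)
        {ℓ | ∃ m, ∃ v ∈ G m, ∃ ψ, ℓ = form v ψ} (fun x hx => ?_) ?_
      · have h0 := hF k hk (fun β => (Finsupp.weight n₀ β.1 : ℂ)⁻¹ • x β) fun m v hv => by
          rw [finsum_eq_sum_of_fintype, ← Module.forall_dual_apply_eq_zero_iff ℂ]
          intro ψ
          have := hx _ ⟨m, v, hv, ψ, rfl⟩
          rwa [hform] at this
        funext β
        have h1 := congrFun h0 β
        exact (smul_eq_zero.1 h1).resolve_left
          (inv_ne_zero (Nat.cast_ne_zero.2 (weight_ne_zero hn₀ (hfib β))))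
      · rintro _ ⟨m, v, hv, ψ, rfl⟩
        have hsum : ∀ F : (σ →₀ ℕ) → V,
            ∑ β ∈ (box hn k).filter fun β => Finsupp.weight n β = k, F β =
            ∑ β : {β : σ →₀ ℕ // Finsupp.weight n β = k}, F β := by
          intro F
          refine Finset.sum_subtype _ (fun β => ?_) F
          rw [Finset.mem_filter, mem_box]
          exact ⟨fun h => h.2, fun h => ⟨h.le, h⟩⟩
        refine ⟨fun T => ψ ((T (singleHat m ⟨v, hv⟩)).1 (m + k) : V) -
          ψ (∑ β : {β : σ →₀ ℕ // Finsupp.weight n β = k}, coeff β.1 (sol n₀ (ser φ (τ T))) v),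
          (continuous_coeff _ _ ψ).sub ?_, fun c => ?_⟩
        · let _ : TopologicalSpace V := moduleTopology ℂ V
          have : IsModuleTopology ℂ V := ⟨rfl⟩
          have : ContinuousAdd V := IsModuleTopology.toContinuousAdd ℂ V
          exact (IsModuleTopology.continuous_of_linearMap ψ).comp (continuous_finsetSum _
            fun β _ => (continuous_coeff_sol hn₀ hfin β.1 v).comp hτ)
        · refine Eq.trans ?_ (hform v ψ fun β => c ⟨β.1, hfib β⟩).symm
          have h1 := coe_param_singleHat hn₀ hn hL hG c m ⟨v, hv⟩ k
          rw [hsum] at h1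
          refine (congrArg (fun w => ψ w - _) h1).trans ?_
          rw [← map_sub, ← Finset.sum_sub_distrib]
          congr 1
          refine Finset.sum_congr rfl fun β _ => ?_
          have hw : (Finsupp.weight n₀ β.1 : ℂ) ≠ 0 :=
            Nat.cast_ne_zero.2 (weight_ne_zero hn₀ (hfib β))
          rw [map_smul, ← NHat.comp_of_ne c (hfib β), ← hτc c β.1 β.2, smul_smul,
            inv_mul_cancel₀ hw, one_smul, LinearMap.sub_apply]
    obtain ⟨K, hK, hKc⟩ := hrec
    let _ : ∀ β : {β : σ →₀ ℕ // Finsupp.weight n β = k}, TopologicalSpace (gs β.1) :=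
      fun β => moduleTopology ℂ (gs β.1)
    let _ : TopologicalSpace E := moduleTopology ℂ E
    have : IsModuleTopology ℂ E := ⟨rfl⟩
    have : ∀ β : {β : σ →₀ ℕ // Finsupp.weight n β = k}, IsModuleTopology ℂ (gs β.1) :=
      fun β => ⟨rfl⟩
    have : ∀ β : {β : σ →₀ ℕ // Finsupp.weight n β = k}, ContinuousAdd (gs β.1) :=
      fun β => IsModuleTopology.toContinuousAdd ℂ _
    have hproj : Continuous fun x : E => x ⟨β₀.1, hβ₀⟩ :=
      IsModuleTopology.continuous_of_linearMap (LinearMap.proj (R := ℂ) (φ := fun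
        β : {β : σ →₀ ℕ // Finsupp.weight n β = k} => gs β.1) ⟨β₀.1, hβ₀⟩)
    exact ⟨fun T => K T ⟨β₀.1, hβ₀⟩, hproj.comp hK, fun c => congrFun (hKc c) ⟨β₀.1, hβ₀⟩⟩

/-- The coordinates on the group have a continuous inverse that is defined on all of `GL(V̂)`. -/
theorem exists_continuous_leftInverse (hfin : ∀ β ≠ 0, FiniteDimensional ℂ (gs β))
    (hF : ∀ k : ℕ, k ≠ 0 → ∀ x : ∀ β : {β : σ →₀ ℕ // Finsupp.weight n β = k}, gs β,
      (∀ (m : ℤ), ∀ v ∈ G m, ∑ᶠ β, φ (x β) v = 0) → x = 0) :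
    ∃ κ : GLHat G → NHat gs, Continuous κ ∧
      Function.LeftInverse κ (param hn₀ hn hL hG) := by
  choose κ hκ hκc using fun β => exists_continuous_comp hn₀ hn hL hG hfin hF _ β rfl
  refine ⟨fun T β => κ β T, ?_, fun c => funext fun β => hκc β c⟩
  let _ : ∀ β : {β : σ →₀ ℕ // β ≠ 0}, TopologicalSpace (gs β) := fun β => moduleTopology ℂ (gs β)
  exact continuous_pi hκ

end Embedding

/-! ### Iterated brackets and the triangular decomposition -/

section Nest

/-- The iterated bracket `⁅x i₁, ⁅x i₂, …, x iₖ⁆⁆` along a list; it is zero for the empty list. -/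
def nest {α 𝔤 : Type*} [LieRing 𝔤] (x : α → 𝔤) : List α → 𝔤
  | [] => 0
  | [i] => x i
  | i :: j :: l => ⁅x i, nest x (j :: l)⁆

theorem lie_nest {α 𝔤 : Type*} [LieRing 𝔤] {x : α → 𝔤} (i : α) {l : List α}
    (hl : l ≠ []) : ⁅x i, nest x l⁆ = nest x (i :: l) := by
  cases l with
  | nil => exact absurd rfl hl
  | cons j l => rfl

variable {α 𝔤 : Type*} [LieRing 𝔤] [LieAlgebra ℂ 𝔤] {x : α → 𝔤}

theorem lie_mem_span_nest (i : α) {z : 𝔤} (hz : z ∈ Submodule.span ℂ (Set.range (nest x))) :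
    ⁅x i, z⁆ ∈ Submodule.span ℂ (Set.range (nest x)) := by
  induction hz using Submodule.span_induction with
  | mem z hz =>
    obtain ⟨l, rfl⟩ := hz
    by_cases hl : l = []
    · subst hl
      rw [nest, lie_zero]
      exact zero_mem _
    · rw [lie_nest i hl]
      exact Submodule.subset_span ⟨_, rfl⟩
  | zero => rw [lie_zero]; exact zero_mem _
  | add z w _ _ hz hw => rw [lie_add]; exact add_mem hz hw
  | smul c z _ hz => rw [lie_smul]; exact Submodule.smul_mem _ c hz

/-- If the brackets of `b` with the `x i` lie in a space that acts on iterated brackets, then the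
bracket of `b` with an iterated bracket is again a sum of iterated brackets and an element of that
space. -/
theorem lie_nest_mem {H₀ : Submodule ℂ 𝔤}
    (hH : ∀ h ∈ H₀, ∀ l, ⁅h, nest x l⁆ ∈ Submodule.span ℂ (Set.range (nest x))) {b : 𝔤}
    (hb : ∀ i, ⁅b, x i⁆ ∈ H₀) (l : List α) :
    ⁅b, nest x l⁆ ∈ Submodule.span ℂ (Set.range (nest x)) ⊔ H₀ := by
  induction l with
  | nil => rw [nest, lie_zero]; exact zero_mem _
  | cons i l ih =>
    by_cases hl : l = []
    · subst hl
      exact Submodule.mem_sup_right (hb i)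
    · rw [← lie_nest i hl, leibniz_lie]
      refine Submodule.mem_sup_left (add_mem (hH _ (hb i) l) ?_)
      obtain ⟨z, hz, h, hh, hzh⟩ := Submodule.mem_sup.1 ih
      rw [← hzh, lie_add]
      refine add_mem (lie_mem_span_nest i hz) ?_
      rw [← lie_skew]
      exact neg_mem (hH h hh [i])

/-- If a family of independent subspaces contains all elements of a spanning set, then each
subspace is spanned by the elements of the set that it contains. -/
theorem le_span_inter {Λ E : Type*} [AddCommGroup E] [Module ℂ E] {W : Λ → Submodule ℂ E}
    (hW : iSupIndep W) {S : Set E} (hS : Submodule.span ℂ S = ⊤)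
    (hSW : ∀ s ∈ S, ∃ μ, s ∈ W μ) (μ : Λ) : W μ ≤ Submodule.span ℂ (S ∩ W μ) := by
  intro v hv
  have hle : ∀ ν, Submodule.span ℂ (S ∩ W ν) ≤ W ν := fun ν =>
    Submodule.span_le.2 Set.inter_subset_right
  have htop : v ∈ Submodule.span ℂ (S ∩ W μ) ⊔ ⨆ (ν) (_ : ν ≠ μ), W ν := by
    have : (⊤ : Submodule ℂ E) ≤ Submodule.span ℂ (S ∩ W μ) ⊔ ⨆ (ν) (_ : ν ≠ μ), W ν := by
      rw [← hS, Submodule.span_le]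
      intro s hs
      obtain ⟨ν, hν⟩ := hSW s hs
      by_cases h : ν = μ
      · subst h
        exact Submodule.mem_sup_left (Submodule.subset_span ⟨hs, hν⟩)
      · exact Submodule.mem_sup_right (Submodule.mem_iSup_of_mem ν
          (Submodule.mem_iSup_of_mem h hν))
    exact this trivial
  obtain ⟨t, ht, r, hr, hv'⟩ := Submodule.mem_sup.1 htop
  have h1 : r ∈ W μ := by
    rw [← add_sub_cancel_left t r, hv']
    exact sub_mem hv (hle μ ht)
  have h2 := (Submodule.disjoint_def.1 (hW μ)) r h1 hr
  rw [← hv', h2, add_zero]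
  exact ht

end Nest

section KM

variable {ι : Type*} [Fintype ι] {A : Matrix ι ι ℤ} {H : Type*} [AddCommGroup H] [Module ℂ H]
  (R : Realization A H)

/-- The quotient map from the free Lie algebra, as a homomorphism of Lie algebras. -/
def mkHom : FreeLieAlgebra ℂ (Gen ι H) →ₗ⁅ℂ⁆ KMAlgebra R where
  toFun := mk R
  map_add' _ _ := rfl
  map_smul' _ _ := rfl
  map_lie' := rfl

theorem mkHom_surjective : Function.Surjective (mkHom R) :=
  LieSubmodule.Quotient.surjective_mk' (relIdeal R)

theorem mkHom_eq_zero {z : FreeLieAlgebra ℂ (Gen ι H)} (hz : Relator R z) : mkHom R z = 0 :=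
  (LieSubmodule.Quotient.mk_eq_zero' (N := relIdeal R)).2 (LieSubmodule.subset_lieSpan hz)

theorem lie_cartan_cartan (x y : H) : ⁅cartan R x, cartan R y⁆ = 0 := by
  have := mkHom_eq_zero R (Relator.hh x y)
  rwa [LieHom.map_lie] at this

theorem eVec_mem (i : ι) : eVec R i ∈ rootSpace R (R.root i) := by
  intro x
  have := mkHom_eq_zero R (Relator.he x i)
  rwa [map_sub, map_smul, LieHom.map_lie, sub_eq_zero] at this

theorem fVec_mem (i : ι) : fVec R i ∈ rootSpace R (-R.root i) := by
  intro x
  have := mkHom_eq_zero R (Relator.hf x i)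
  rw [map_add, map_smul, LieHom.map_lie] at this
  rw [LinearMap.neg_apply, neg_smul]
  exact eq_neg_of_add_eq_zero_left this

theorem cartan_mem (x : H) : cartan R x ∈ rootSpace R 0 := by
  intro y
  rw [lie_cartan_cartan, LinearMap.zero_apply, zero_smul]

theorem lie_eVec_fVec (i j : ι) :
    ⁅eVec R i, fVec R j⁆ ∈ Submodule.span ℂ (Set.range (cartan R)) := by
  by_cases h : i = j
  · subst h
    have := mkHom_eq_zero R (Relator.ef_same i)
    rw [map_sub, LieHom.map_lie, sub_eq_zero] at this
    exact Submodule.subset_span ⟨_, this.symm⟩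
  · have := mkHom_eq_zero R (Relator.ef_ne i j h)
    rw [LieHom.map_lie] at this
    change ⁅eVec R i, fVec R j⁆ = 0 at this
    rw [this]
    exact zero_mem _

/-- Root spaces for distinct weights are independent, as simultaneous eigenspaces of the commuting
operators `ad h`. -/
theorem iSupIndep_rootSpace : iSupIndep (rootSpace R) := by
  have h1 := Module.End.independent_iInf_maxGenEigenspace_of_forall_mapsTo
    (fun x : H => LieAlgebra.ad ℂ (KMAlgebra R) (cartan R x)) (fun x y μ =>
      Module.End.mapsTo_maxGenEigenspace_of_comm (by
        refine LinearMap.ext fun z => ?_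
        change ⁅cartan R y, ⁅cartan R x, z⁆⁆ = ⁅cartan R x, ⁅cartan R y, z⁆⁆
        rw [leibniz_lie, lie_cartan_cartan, zero_lie, zero_add]) μ)
  have h2 := h1.comp (DFunLike.coe_injective (F := Module.Dual ℂ H))
  refine h2.mono fun μ z hz => ?_
  change z ∈ ⨅ x : H, (LieAlgebra.ad ℂ (KMAlgebra R) (cartan R x)).maxGenEigenspace (μ x)
  rw [Submodule.mem_iInf]
  intro x
  rw [Module.End.mem_maxGenEigenspace]
  refine ⟨1, ?_⟩
  rw [pow_one, LinearMap.sub_apply, LinearMap.smul_apply, Module.End.one_apply, sub_eq_zero]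
  exact hz x

theorem nest_mem {α : Type*} {x : α → KMAlgebra R} {w : α → Module.Dual ℂ H}
    (hx : ∀ i, x i ∈ rootSpace R (w i)) (l : List α) :
    nest x l ∈ rootSpace R (l.map w).sum := by
  induction l with
  | nil => exact zero_mem _
  | cons i l ih =>
    by_cases hl : l = []
    · subst hl
      simpa [nest] using hx i
    · rw [← lie_nest i hl, List.map_cons, List.sum_cons]
      exact lie_mem_weightSpace R _ (hx i) ih

/-- The indices `i` with `e_i ≠ 0`. Every index has this property; working with this set makes the
proof of that fact unnecessary. -/
abbrev Idx : Type _ := {i : ι // eVec R i ≠ 0}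

/-- A set that spans the Kac-Moody algebra: the iterated brackets of the `e_i`, the Cartan
subalgebra, and the iterated brackets of the `f_i`. -/
def triSet : Set (KMAlgebra R) :=
  Set.range (nest fun i : Idx R => eVec R i) ∪ Set.range (cartan R) ∪ Set.range (nest (fVec R))

theorem lie_nest_of_mem {α : Type*} {x : α → KMAlgebra R} {w : α → Module.Dual ℂ H}
    (hx : ∀ i, x i ∈ rootSpace R (w i)) {h : KMAlgebra R}
    (hh : h ∈ Submodule.span ℂ (Set.range (cartan R))) (l : List α) :
    ⁅h, nest x l⁆ ∈ Submodule.span ℂ (Set.range (nest x)) := by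
  induction hh using Submodule.span_induction with
  | mem z hz =>
    obtain ⟨y, rfl⟩ := hz
    rw [nest_mem R hx l y]
    exact Submodule.smul_mem _ _ (Submodule.subset_span ⟨l, rfl⟩)
  | zero => rw [zero_lie]; exact zero_mem _
  | add z w _ _ hz hw => rw [add_lie]; exact add_mem hz hw
  | smul c z _ hz => rw [smul_lie]; exact Submodule.smul_mem _ c hz

/-- A Lie subalgebra that contains the generators is everything. -/
theorem mem_of_gen_mem {K : LieSubalgebra ℂ (KMAlgebra R)}
    (hK : ∀ g : Gen ι H, mk R (FreeLieAlgebra.of ℂ g) ∈ K) (z : KMAlgebra R) : z ∈ K := by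
  obtain ⟨y, rfl⟩ := mkHom_surjective R z
  let F : FreeLieAlgebra ℂ (Gen ι H) →ₗ⁅ℂ⁆ K :=
    FreeLieAlgebra.lift ℂ fun g => (⟨_, hK g⟩ : K)
  have : K.incl.comp F = mkHom R := by
    refine FreeLieAlgebra.hom_ext fun g => ?_
    rw [LieHom.comp_apply, FreeLieAlgebra.lift_of_apply]
    rfl
  rw [← this]
  exact (F y).2

/-- The sum of the three parts of the triangular decomposition is stable under the adjoint action of
the generators, hence of the whole algebra, so it is a subalgebra that contains the generators. -/
theorem span_triSet : Submodule.span ℂ (triSet R) = ⊤ := by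
  set Ne := Submodule.span ℂ (Set.range (nest fun i : Idx R => eVec R i)) with hNe
  set Nf := Submodule.span ℂ (Set.range (nest (fVec R))) with hNf
  set H₀ := Submodule.span ℂ (Set.range (cartan R)) with hH₀
  set T := Submodule.span ℂ (triSet R) with hT
  have hNeT : Ne ≤ T := Submodule.span_mono fun z hz => Or.inl (Or.inl hz)
  have hH₀T : H₀ ≤ T := Submodule.span_mono fun z hz => Or.inl (Or.inr hz)
  have hNfT : Nf ≤ T := Submodule.span_mono fun z hz => Or.inr hz
  have he : ∀ i : Idx R, eVec R i ∈ rootSpace R (R.root i) := fun i => eVec_mem R i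
  -- brackets with generators preserve `T`
  have heNf : ∀ i l, ⁅eVec R i, nest (fVec R) l⁆ ∈ T := fun i l =>
    (sup_le hNfT hH₀T) (lie_nest_mem (fun h hh l => lie_nest_of_mem R (fVec_mem R) hh l)
      (lie_eVec_fVec R i) l)
  have hfNe : ∀ i l, ⁅fVec R i, nest (fun i : Idx R => eVec R i) l⁆ ∈ T := fun i l =>
    (sup_le hNeT hH₀T) (lie_nest_mem (fun h hh l => lie_nest_of_mem R he hh l)
      (fun j => by rw [← lie_skew]; exact neg_mem (lie_eVec_fVec R j i)) l)
  have hgen : ∀ g : Gen ι H, ∀ z ∈ T, ⁅mk R (FreeLieAlgebra.of ℂ g), z⁆ ∈ T := by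
    intro g z hz
    induction hz using Submodule.span_induction with
    | zero => rw [lie_zero]; exact zero_mem _
    | add z w _ _ hz hw => rw [lie_add]; exact add_mem hz hw
    | smul c z _ hz => rw [lie_smul]; exact Submodule.smul_mem _ c hz
    | mem z hz =>
      cases g with
      | h x =>
        change ⁅cartan R x, z⁆ ∈ T
        have hx : cartan R x ∈ H₀ := Submodule.subset_span ⟨x, rfl⟩
        rcases hz with (⟨l, rfl⟩ | ⟨y, rfl⟩) | ⟨l, rfl⟩
        · exact hNeT (lie_nest_of_mem R he hx l)
        · rw [lie_cartan_cartan]; exact zero_mem _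
        · exact hNfT (lie_nest_of_mem R (fVec_mem R) hx l)
      | e i =>
        change ⁅eVec R i, z⁆ ∈ T
        by_cases hi : eVec R i = 0
        · rw [hi, zero_lie]; exact zero_mem _
        rcases hz with (⟨l, rfl⟩ | ⟨y, rfl⟩) | ⟨l, rfl⟩
        · exact hNeT (lie_mem_span_nest (x := fun i : Idx R => eVec R i) ⟨i, hi⟩
            (Submodule.subset_span ⟨l, rfl⟩))
        · rw [← lie_skew, eVec_mem R i y]
          exact neg_mem (hNeT (Submodule.smul_mem _ _ (Submodule.subset_span ⟨[⟨i, hi⟩], rfl⟩)))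
        · exact heNf i l
      | f i =>
        change ⁅fVec R i, z⁆ ∈ T
        rcases hz with (⟨l, rfl⟩ | ⟨y, rfl⟩) | ⟨l, rfl⟩
        · exact hfNe i l
        · rw [← lie_skew, fVec_mem R i y]
          exact neg_mem (hNfT (Submodule.smul_mem _ _ (Submodule.subset_span ⟨[i], rfl⟩)))
        · exact hNfT (lie_mem_span_nest i (Submodule.subset_span ⟨l, rfl⟩))
  let N : LieSubalgebra ℂ (KMAlgebra R) :=
    { carrier := {x | ∀ z ∈ T, ⁅x, z⁆ ∈ T}
      zero_mem' := fun z _ => by rw [zero_lie]; exact zero_mem _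
      add_mem' := fun hx hy z hz => by rw [add_lie]; exact add_mem (hx z hz) (hy z hz)
      smul_mem' := fun c x hx z hz => by rw [smul_lie]; exact Submodule.smul_mem _ c (hx z hz)
      lie_mem' := fun {x y} hx hy z hz => by
        rw [lie_lie]
        exact sub_mem (hx _ (hy z hz)) (hy _ (hx z hz)) }
  have hN : ∀ x : KMAlgebra R, x ∈ N := mem_of_gen_mem R (K := N) hgen
  let K : LieSubalgebra ℂ (KMAlgebra R) := { T with lie_mem' := fun {x y} _ hy => hN x y hy }
  rw [eq_top_iff]
  intro z _
  refine mem_of_gen_mem R (K := K) (fun g => ?_) z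
  cases g with
  | h x => exact hH₀T (Submodule.subset_span ⟨x, rfl⟩)
  | e i =>
    by_cases hi : eVec R i = 0
    · change eVec R i ∈ T
      rw [hi]
      exact zero_mem _
    · exact hNeT (Submodule.subset_span ⟨[⟨i, hi⟩], rfl⟩)
  | f i => exact hNfT (Submodule.subset_span ⟨[i], rfl⟩)

/-! ### Positive root spaces -/

/-- The weight `∑ β_i α_i`. -/
def rt : (Idx R →₀ ℕ) →+ Module.Dual ℂ H := Finsupp.weight fun i : Idx R => R.root i

/-- The root space of weight `∑ β_i α_i`. -/
def gs (β : Idx R →₀ ℕ) : Submodule ℂ (KMAlgebra R) := rootSpace R (rt R β)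

/-- The multiplicities of the letters of a list. -/
def content {α : Type*} (l : List α) : α →₀ ℕ := (l.map fun i => Finsupp.single i 1).sum

theorem degree_content {α : Type*} (l : List α) : (content l).degree = l.length := by
  induction l with
  | nil => simp [content]
  | cons i l ih =>
    have : content (i :: l) = Finsupp.single i 1 + content l := by simp [content]
    rw [this, map_add, ih, Finsupp.degree_single, List.length_cons, add_comm]

theorem rt_content (l : List (Idx R)) :
    rt R (content l) = (l.map fun i : Idx R => R.root i).sum := by
  induction l with
  | nil => simp [content]
  | cons i l ih =>
    have : content (i :: l) = Finsupp.single i 1 + content l := by simp [content]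
    rw [this, map_add, ih, List.map_cons, List.sum_cons]
    simp [rt, Finsupp.weight_single]

theorem sum_root_injective {k l : ι → ℕ} (h : ∑ i, k i • R.root i = ∑ i, l i • R.root i) :
    k = l := by
  have h1 := Fintype.linearIndependent_iff.1 R.root_linearIndependent
    (fun i => (k i : ℂ) - l i) (by
      simp only [sub_smul, Finset.sum_sub_distrib, Nat.cast_smul_eq_nsmul]
      rw [h, sub_self])
  funext i
  have := h1 i
  rw [sub_eq_zero] at this
  exact_mod_cast this

theorem add_eq_zero_of_mem_posCone {μ : Module.Dual ℂ H} (h : μ ∈ posCone R)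
    (h' : -μ ∈ posCone R) : μ = 0 := by
  obtain ⟨k, hk⟩ := h
  obtain ⟨l, hl⟩ := h'
  have h1 : ∑ i, (k i + l i) • R.root i = ∑ i, (0 : ι → ℕ) i • R.root i := by
    simp only [add_smul, Finset.sum_add_distrib, ← hk, ← hl]
    simp
  have h2 := sum_root_injective R h1
  rw [hk]
  refine Finset.sum_eq_zero fun i _ => ?_
  have := congrFun h2 i
  simp only [Pi.zero_apply] at this
  rw [(by lia : k i = 0), zero_smul]

theorem rt_injective : Function.Injective (rt R) := by
  have h1 := R.root_linearIndependent.comp (fun i : Idx R => (i : ι)) Subtype.val_injective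
  have h2 : LinearIndependent ℕ fun i : Idx R => R.root i :=
    LinearIndependent.restrict_scalars' ℕ h1
  exact h2

theorem rt_ne_zero {β : Idx R →₀ ℕ} (hβ : β ≠ 0) : rt R β ≠ 0 := fun h =>
  hβ (rt_injective R (by rw [h, map_zero]))

theorem zero_mem_posCone : (0 : Module.Dual ℂ H) ∈ posCone R :=
  ⟨0, by simp⟩

theorem add_mem_posCone {μ ν : Module.Dual ℂ H} (hμ : μ ∈ posCone R) (hν : ν ∈ posCone R) :
    μ + ν ∈ posCone R := by
  obtain ⟨k, hk⟩ := hμ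
  obtain ⟨l, hl⟩ := hν
  exact ⟨k + l, by simp only [Pi.add_apply, add_smul, Finset.sum_add_distrib, ← hk, ← hl]⟩

theorem root_mem_posCone (i : ι) : R.root i ∈ posCone R := by
  classical
  refine ⟨Pi.single i 1, ?_⟩
  rw [Finset.sum_eq_single_of_mem i (Finset.mem_univ i)]
  · simp
  · intro j _ hj
    rw [Pi.single_eq_of_ne hj, zero_smul]

theorem sum_root_mem_posCone (l : List ι) : (l.map R.root).sum ∈ posCone R := by
  induction l with
  | nil => exact zero_mem_posCone R
  | cons i l ih => exact add_mem_posCone R (root_mem_posCone R i) ih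

theorem rt_mem_posCone (β : Idx R →₀ ℕ) : rt R β ∈ posCone R := by
  induction β using Finsupp.induction_linear with
  | zero => rw [map_zero]; exact zero_mem_posCone R
  | add β γ hβ hγ => rw [map_add]; exact add_mem_posCone R hβ hγ
  | single i k =>
    induction k with
    | zero => simpa using zero_mem_posCone R
    | succ k ih =>
      rw [Finsupp.single_add, map_add]
      refine add_mem_posCone R ih ?_
      simpa [rt, Finsupp.weight_single] using root_mem_posCone R i

theorem eq_of_mem_rootSpace {μ ν : Module.Dual ℂ H} {z : KMAlgebra R} (hz : z ≠ 0)
    (hμ : z ∈ rootSpace R μ) (hν : z ∈ rootSpace R ν) : μ = ν := by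
  by_contra h
  exact hz (Submodule.disjoint_def.1 ((iSupIndep_rootSpace R).pairwiseDisjoint h) z hμ hν)

/-- A root space of nonzero weight in `Q⁺` is spanned by the iterated brackets of the `e_i` that it
contains. -/
theorem rootSpace_le_span {μ : Module.Dual ℂ H} (hμ : μ ∈ posCone R) (hμ0 : μ ≠ 0) :
    rootSpace R μ ≤ Submodule.span ℂ
      {z | ∃ l : List (Idx R), rt R (content l) = μ ∧ z = nest (fun i : Idx R => eVec R i) l} := by
  have he : ∀ i : Idx R, eVec R i ∈ rootSpace R (R.root i) := fun i => eVec_mem R i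
  have hf : ∀ l, nest (fVec R) l ∈ rootSpace R (-(l.map R.root).sum) := by
    intro l
    have := nest_mem R (fVec_mem R) l
    have h : ∀ l : List ι, (l.map fun i => -R.root i).sum = -(l.map R.root).sum := by
      intro l
      induction l with
      | nil => simp
      | cons i l ih => rw [List.map_cons, List.map_cons, List.sum_cons, List.sum_cons, ih, neg_add]
    rwa [h] at this
  refine (le_span_inter (iSupIndep_rootSpace R) (span_triSet R) ?_ μ).trans
    (Submodule.span_le.2 ?_)
  · rintro s ((⟨l, rfl⟩ | ⟨y, rfl⟩) | ⟨l, rfl⟩)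
    · exact ⟨_, nest_mem R he l⟩
    · exact ⟨_, cartan_mem R y⟩
    · exact ⟨_, hf l⟩
  · rintro s ⟨hs, hsμ⟩
    by_cases hs0 : s = 0
    · rw [hs0]; exact zero_mem _
    rcases hs with (⟨l, rfl⟩ | ⟨y, rfl⟩) | ⟨l, rfl⟩
    · refine Submodule.subset_span ⟨l, ?_, rfl⟩
      rw [rt_content]
      exact eq_of_mem_rootSpace R hs0 (nest_mem R he l) hsμ
    · exact absurd (eq_of_mem_rootSpace R hs0 hsμ (cartan_mem R y)) hμ0
    · refine absurd (add_eq_zero_of_mem_posCone R hμ ?_) hμ0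
      rw [eq_of_mem_rootSpace R hs0 hsμ (hf l), neg_neg]
      exact sum_root_mem_posCone R l

theorem gs_le_span {β : Idx R →₀ ℕ} (hβ : β ≠ 0) : gs R β ≤ Submodule.span ℂ
    {z | ∃ l : List (Idx R), content l = β ∧ z = nest (fun i : Idx R => eVec R i) l} := by
  refine (rootSpace_le_span R (rt_mem_posCone R β) (rt_ne_zero R hβ)).trans
    (Submodule.span_mono ?_)
  rintro z ⟨l, hl, rfl⟩
  exact ⟨l, rt_injective R hl, rfl⟩

theorem finiteDimensional_gs {β : Idx R →₀ ℕ} (hβ : β ≠ 0) : FiniteDimensional ℂ (gs R β) := by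
  have hfin : {z | ∃ l : List (Idx R), content l = β ∧
      z = nest (fun i : Idx R => eVec R i) l}.Finite := by
    refine ((List.finite_length_eq (Idx R) β.degree).image
      (nest fun i : Idx R => eVec R i)).subset ?_
    rintro z ⟨l, hl, rfl⟩
    exact ⟨l, by rw [Set.mem_ofPred_eq, ← hl, degree_content], rfl⟩
  have := FiniteDimensional.span_of_finite ℂ hfin
  exact Submodule.finiteDimensional_of_le (gs_le_span R hβ)

theorem exists_rt_eq {μ : Module.Dual ℂ H} (hμ : μ ∈ posCone R) (hμ0 : μ ≠ 0)
    (h : rootSpace R μ ≠ ⊥) : ∃ β, rt R β = μ := by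
  by_contra hne
  refine h (eq_bot_iff.2 ((rootSpace_le_span R hμ hμ0).trans (Submodule.span_le.2 ?_)))
  rintro z ⟨l, hl, rfl⟩
  exact absurd ⟨_, hl⟩ hne

theorem lie_mem_gs (γ δ : Idx R →₀ ℕ) (x : KMAlgebra R) (hx : x ∈ gs R γ) (y : KMAlgebra R)
    (hy : y ∈ gs R δ) : ⁅x, y⁆ ∈ gs R (γ + δ) := by
  have := lie_mem_weightSpace R _ hx hy
  rwa [← map_add] at this

theorem iSupIndep_gs : iSupIndep (gs R) := (iSupIndep_rootSpace R).comp (rt_injective R)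

theorem gs_le_nPlus {β : Idx R →₀ ℕ} (hβ : β ≠ 0) : gs R β ≤ nPlus R := by
  by_cases h : gs R β = ⊥
  · rw [h]; exact bot_le
  · exact le_iSup₂_of_le (rt R β) ⟨⟨rt_ne_zero R hβ, h⟩, rt_mem_posCone R β⟩ le_rfl

end KM

/-! ### Homogeneous elements of positive degree -/

section Homogeneous

variable {ι : Type*} [Fintype ι] {A : Matrix ι ι ℤ} {H : Type*} [AddCommGroup H] [Module ℂ H]
  (R : Realization A H) {P : AddSubgroup (Module.Dual ℂ H)}

theorem rt_mem (hP : ∀ i, R.root i ∈ P) (β : Idx R →₀ ℕ) : rt R β ∈ P := by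
  rw [rt, Finsupp.weight_apply]
  exact sum_mem fun i _ => nsmul_mem (hP i) _

/-- The degree of the simple root `α_i` in the grading given by `f`. -/
def deg (hP : ∀ i, R.root i ∈ P) (f : P →+ ℤ) (i : Idx R) : ℕ := (f ⟨R.root i, hP i⟩).toNat

variable {f : P →+ ℤ} {V : Type*} [AddCommGroup V] [Module ℂ V] [LieRingModule (KMAlgebra R) V]
  [LieModule ℂ (KMAlgebra R) V]

theorem degree_root_pos (hP : ∀ i, R.root i ∈ P) (hV : IsStandardGraded R f V)
    (i : Idx R) : 0 < f ⟨R.root i, hP i⟩ := by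
  have h0 : R.root i ≠ 0 := R.root_linearIndependent.ne_zero _
  have hr : R.root i ∈ roots R :=
    ⟨h0, fun h => i.2 ((Submodule.eq_bot_iff _).1 h _ (eVec_mem R i))⟩
  rcases lt_trichotomy (f ⟨R.root i, hP i⟩) 0 with h | h | h
  · exact absurd (add_eq_zero_of_mem_posCone R (root_mem_posCone R i) (hV.neg _ hr h).2) h0
  · exact absurd h (hV.ne_zero _ hr)
  · exact h

theorem deg_ne_zero (hP : ∀ i, R.root i ∈ P) (hV : IsStandardGraded R f V)
    (i : Idx R) : deg R hP f i ≠ 0 := by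
  have := degree_root_pos R hP hV i
  rw [deg]
  lia

theorem weight_deg (hP : ∀ i, R.root i ∈ P) (hV : IsStandardGraded R f V)
    (β : Idx R →₀ ℕ) :
    (Finsupp.weight (deg R hP f) β : ℤ) = f ⟨rt R β, rt_mem R hP β⟩ := by
  have h : (⟨rt R β, rt_mem R hP β⟩ : P) = β.sum fun i k => k • ⟨R.root i, hP i⟩ := by
    refine Subtype.ext ?_
    rw [Finsupp.sum, AddSubgroup.val_finsetSum]
    rfl
  rw [h, Finsupp.sum, map_sum, Finsupp.weight_apply, Finsupp.sum, Nat.cast_sum]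
  refine Finset.sum_congr rfl fun i _ => ?_
  have := degree_root_pos R hP hV i
  rw [map_nsmul, smul_eq_mul, Nat.cast_mul, nsmul_eq_mul, deg, Int.toNat_of_nonneg this.le]

theorem gs_le_gPiece (hP : ∀ i, R.root i ∈ P) (hV : IsStandardGraded R f V)
    {β : Idx R →₀ ℕ} {k : ℤ} (hk : (Finsupp.weight (deg R hP f) β : ℤ) = k) :
    gs R β ≤ gPiece R f k :=
  le_iSup₂_of_le (f := fun (μ : P) (_ : f μ = k) => rootSpace R μ) ⟨rt R β, rt_mem R hP β⟩
    ((weight_deg R hP hV β).symm.trans hk) le_rfl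

/-- The family `F` consists of elements of the positive root spaces of degree `k`. -/
structure IsHomFamily (n : Idx R → ℕ) (k : ℕ) (F : (Idx R →₀ ℕ) →₀ KMAlgebra R) : Prop where
  mem : ∀ β, F β ∈ gs R β
  weight_eq : ∀ β, F β ≠ 0 → Finsupp.weight n β = k

theorem exists_isHomFamily (hP : ∀ i, R.root i ∈ P) (hV : IsStandardGraded R f V)
    {k : ℕ} (hk : k ≠ 0) {x : KMAlgebra R} (hx : x ∈ gPiece R f k) :
    ∃ F, IsHomFamily R (deg R hP f) k F ∧ (F.sum fun _ y => y) = x := by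
  have hle : gPiece R f k ≤ ⨆ β, ⨆ (_ : Finsupp.weight (deg R hP f) β = k), gs R β := by
    refine iSup₂_le fun μ hμ => ?_
    by_cases hbot : weightSpace R (KMAlgebra R) (μ : Module.Dual ℂ H) = ⊥
    · rw [hbot]
      exact bot_le
    have hμ0 : (μ : Module.Dual ℂ H) ≠ 0 := fun h => by
      have : μ = 0 := Subtype.ext h
      rw [this, map_zero] at hμ
      exact hk (by exact_mod_cast hμ.symm)
    obtain ⟨hμr, hμc⟩ := hV.pos μ ⟨hμ0, hbot⟩ (by lia)
    obtain ⟨β, hβ⟩ := exists_rt_eq R hμc hμ0 hbot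
    refine le_iSup₂_of_le β ?_ (by rw [gs, hβ])
    have := weight_deg R hP hV β
    rw [(Subtype.ext hβ : (⟨rt R β, rt_mem R hP β⟩ : P) = μ), hμ] at this
    exact_mod_cast this
  obtain ⟨F, hF, hFx⟩ := (Submodule.mem_iSup_iff_exists_finsupp _ _).1 (hle hx)
  refine ⟨F, ⟨fun β => ?_, fun β hβ => ?_⟩, hFx⟩
  · exact (iSup_le fun _ => le_rfl : (⨆ (_ : Finsupp.weight (deg R hP f) β = k), gs R β) ≤ _) (hF β)
  · by_contra hne
    have := hF β
    rw [iSup_neg hne] at this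
    exact hβ this

theorem IsHomFamily.apply_zero {n : Idx R → ℕ} {k : ℕ} (hk : k ≠ 0)
    {F : (Idx R →₀ ℕ) →₀ KMAlgebra R} (hF : IsHomFamily R n k F) : F 0 = 0 := by
  by_contra h
  have := hF.weight_eq 0 h
  rw [map_zero] at this
  exact hk this.symm

theorem eq_of_sum_eq {F F' : (Idx R →₀ ℕ) →₀ KMAlgebra R} (hF : ∀ β, F β ∈ gs R β)
    (hF' : ∀ β, F' β ∈ gs R β) (h : (F.sum fun _ y => y) = F'.sum fun _ y => y) : F = F' := by
  classical
  have h1 : ((F - F').sum fun _ y => y) = 0 := by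
    rw [Finsupp.sum_sub_index (fun _ _ _ => rfl), h, sub_self]
  rw [← sub_eq_zero]
  ext β
  by_cases hβ : β ∈ (F - F').support
  · exact ((iSupIndep_iff_finsetSum_eq_zero_imp_eq_zero _).1 (iSupIndep_gs R)) _ _
      (fun β _ => sub_mem (hF β) (hF' β)) h1 β hβ
  · simpa using hβ

end Homogeneous

/-! ### The action on a standard graded module -/

section Action

variable {ι : Type*} [Fintype ι] {A : Matrix ι ι ℤ} {H : Type*} [AddCommGroup H] [Module ℂ H]
  (R : Realization A H)

section Rep

variable {𝒜 : Type*} [Ring 𝒜] [Algebra ℂ 𝒜] (φ : KMAlgebra R →ₗ[ℂ] 𝒜)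

/-- The image under `φ` of a family of elements of the root spaces, as a series. -/
def famSer (F : (Idx R →₀ ℕ) →₀ KMAlgebra R) : MvPowerSeries (Idx R) 𝒜 := fun β => φ (F β)

theorem coeff_famSer (F : (Idx R →₀ ℕ) →₀ KMAlgebra R) (β : Idx R →₀ ℕ) :
    coeff β (famSer R φ F) = φ (F β) := rfl

variable {n : Idx R → ℕ} {k : ℕ} {F : (Idx R →₀ ℕ) →₀ KMAlgebra R}

theorem famSer_mem_lieSeries (hk : k ≠ 0) (hF : IsHomFamily R n k F) :
    famSer R φ F ∈ lieSeries (imageFamily (gs R) φ) := by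
  refine ⟨?_, fun β => ⟨F β, hF.mem β, rfl⟩⟩
  rw [← coeff_zero_eq_constantCoeff_apply, coeff_famSer, hF.apply_zero R hk, map_zero]

theorem euler_famSer (hF : IsHomFamily R n k F) :
    euler n (famSer R φ F) = (k : ℂ) • famSer R φ F := by
  ext β
  rw [coeff_euler, coeff_smul', coeff_famSer]
  by_cases h : F β = 0
  · rw [h, map_zero, smul_zero, smul_zero]
  · rw [hF.weight_eq β h]

end Rep

variable {P : AddSubgroup (Module.Dual ℂ H)} {f : P →+ ℤ} (V : Type*) [AddCommGroup V] [Module ℂ V]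
  [LieRingModule (KMAlgebra R) V] [LieModule ℂ (KMAlgebra R) V]

/-- The representation of the Kac-Moody algebra, as a linear map. -/
def act : KMAlgebra R →ₗ[ℂ] Module.End ℂ V := LieModule.toEnd ℂ (KMAlgebra R) V

theorem act_apply (x : KMAlgebra R) (v : V) : act R V x v = ⁅x, v⁆ := rfl

theorem isLieRep_act : IsLieRep (act R V) := fun x y =>
  LinearMap.ext fun v => lie_lie x y v

theorem isLieFamily_act : IsLieFamily (imageFamily (gs R) (act R V)) :=
  isLieFamily_imageFamily (isLieRep_act R V) (lie_mem_gs R)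

theorem one_weight_ne_zero (i : Idx R) : (fun _ : Idx R => 1) i ≠ 0 := one_ne_zero

/-- The group of series whose image in `GL(V̂)` is the complete unipotent group. Its definition uses
the principal grading, which is available for every module. -/
def serGroup : Subgroup (MvPowerSeries (Idx R) (Module.End ℂ V))ˣ :=
  lieGroup (isLieFamily_act R V) (one_weight_ne_zero R)

variable {V}

theorem image_mem_piece (hP : ∀ i, R.root i ∈ P) (hV : IsStandardGraded R f V)
    (β : Idx R →₀ ℕ) (x : Module.End ℂ V)
    (hx : x ∈ imageFamily (gs R) (act R V) β) (m : ℤ) (v : V) (hv : v ∈ piece R f V m) :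
    x v ∈ piece R f V (m + Finsupp.weight (deg R hP f) β) := by
  obtain ⟨y, hy, rfl⟩ := hx
  exact lie_mem_piece R f V (add_comm _ _) (gs_le_gPiece R hP hV rfl hy) hv

variable (hP : ∀ i, R.root i ∈ P) (hV : IsStandardGraded R f V)

/-- The action of the group of series on the completion of the module. -/
def toGL : serGroup R V →* GLV R f V :=
  evGL (deg_ne_zero R hP hV) (isLieFamily_act R V) (one_weight_ne_zero R)
    (image_mem_piece R hP hV)

theorem expUnit_famSer_mem {k : ℕ} (hk : k ≠ 0) {n : Idx R → ℕ} (hn : ∀ i, n i ≠ 0)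
    {F : (Idx R →₀ ℕ) →₀ KMAlgebra R} (hF : IsHomFamily R n k F) :
    expUnit (famSer R (act R V) F) (famSer_mem_lieSeries R _ hk hF).1 ∈ serGroup R V :=
  lieGroup_le _ hn _ (expUnit_mem_lieGroup _ hn (famSer_mem_lieSeries R _ hk hF)
    (euler_famSer R _ hF))

theorem rhoHat_eq_ev {k : ℤ} {k' : ℕ} (hkk' : k = k') {F : (Idx R →₀ ℕ) →₀ KMAlgebra R}
    (hF : IsHomFamily R (deg R hP f) k' F) (x : gPiece R f k)
    (hx : (F.sum fun _ y => y) = x)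
    (hX : famSer R (act R V) F ∈ homSer (piece R f V) (deg R hP f)) :
    ev (deg_ne_zero R hP hV) ⟨famSer R (act R V) F, hX⟩ = rhoHat R f V x := by
  refine LinearMap.ext fun v => Subtype.ext (funext fun m => Subtype.ext ?_)
  change ∑ᶠ β, act R V (F β) (v.1 (m - Finsupp.weight (deg R hP f) β) : V) =
    ⁅(x : KMAlgebra R), (v.1 (m - k) : V)⁆
  rw [← hx, finsum_eq_sum_of_support_subset (s := F.support), ← act_apply, Finsupp.sum, map_sum,
    LinearMap.sum_apply]
  · refine Finset.sum_congr rfl fun β hβ => ?_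
    rw [hF.weight_eq β (Finsupp.mem_support_iff.1 hβ), hkk']
  · intro β hβ
    rw [Finset.mem_coe, Finsupp.mem_support_iff]
    intro h
    exact hβ (by simp only [h, map_zero, LinearMap.zero_apply])

theorem toGL_eq_expRho {k : ℤ} (hk : 0 < k) {k' : ℕ} (hkk' : k = k')
    {F : (Idx R →₀ ℕ) →₀ KMAlgebra R}
    (hF : IsHomFamily R (deg R hP f) k' F) (x : gPiece R f k)
    (hx : (F.sum fun _ y => y) = x) (u : serGroup R V)
    (hu : (u.1 : MvPowerSeries (Idx R) (Module.End ℂ V)) = expSer (famSer R (act R V) F)) :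
    toGL R hP hV u = expRho R f V hk x := by
  have hX := famSer_mem_lieSeries R (act R V) (by lia : k' ≠ 0) hF
  have hX' : famSer R (act R V) F ∈ homSer (piece R f V) (deg R hP f) := fun β m v hv =>
    image_mem_piece R hP hV β _ (hX.2 β) m v hv
  refine LinearEquiv.ext fun v => ?_
  exact congrArg (fun T : Module.End ℂ (VHat R f V) => T v)
    (ev_expSer (deg_ne_zero R hP hV) (X := ⟨_, hX'⟩) hX.1 ⟨_, _⟩ hu (rhoHat_raises R f V hk x)
      (rhoHat_eq_ev R hP hV hkk' hF x hx hX'))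

/-- The exponential of a homogeneous element of degree `k` is in the image of the group of series,
and its leading term is that element. -/
theorem exists_toGL_eq_expRho {k : ℤ} (hk : 0 < k) (x : gPiece R f k) :
    ∃ u : serGroup R V, toGL R hP hV u = expRho R f V hk x ∧
      (u.1 : MvPowerSeries (Idx R) (Module.End ℂ V)) - 1 ∈ fil (deg R hP f) k.toNat := by
  obtain ⟨k', rfl⟩ := Int.eq_ofNat_of_zero_le hk.le
  have hk' : k' ≠ 0 := by lia
  obtain ⟨F, hF, hFx⟩ := exists_isHomFamily R hP hV hk' x.2
  refine ⟨⟨_, expUnit_famSer_mem R hk' (deg_ne_zero R hP hV) hF⟩,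
    toGL_eq_expRho R hP hV hk rfl hF x hFx _ rfl, ?_⟩
  have h1 := mem_fil_of_euler_eq (euler_famSer R (act R V) hF)
  have h2 := expSer_sub_one_sub_mem_fil (deg_ne_zero R hP hV) hk' h1
  have := add_mem (fil_anti (Nat.le_succ k') h2) h1
  rwa [sub_add_cancel] at this

/-! ### Infinite ordered products -/

/-- Every infinite ordered product converges, to an element of the range of `toGL`. -/
theorem exists_tendsto_partialProd (x : ∀ k : ℕ, gPiece R f ((k : ℤ) + 1)) : ∃ g : serGroup R V,
    IsOrderedProd R f V x (toGL R hP hV g) := by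
  have hpos : ∀ k : ℕ, 0 < (k : ℤ) + 1 := fun k => by lia
  choose u hu hu1 using fun k => exists_toGL_eq_expRho R hP hV (hpos k) (x k)
  let p : ℕ → serGroup R V := fun k => Nat.rec 1 (fun j q => u j * q) k
  have hp : ∀ k, toGL R hP hV (p k) = partialProd R f V x k := by
    intro k
    induction k with
    | zero => exact map_one _
    | succ k ih =>
      change toGL R hP hV (u k * p k) = expRho R f V _ (x k) * partialProd R f V x k
      rw [map_mul, hu, ih]
  obtain ⟨g, hg, hgp⟩ := exists_limit (isLieFamily_act R V) (deg_ne_zero R hP hV)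
    (fun k => (p k).1) (fun k => lieGroup_le _ _ _ (p k).2) fun k => by
      change ((u k).1 * (p k).1 : MvPowerSeries (Idx R) (Module.End ℂ V)) - (p k).1 ∈ _
      have := mul_mem_fil_right ((p k).1 : MvPowerSeries (Idx R) (Module.End ℂ V)) (hu1 k)
      rwa [sub_mul, one_mul, (by lia : ((k : ℤ) + 1).toNat = k + 1)] at this
  refine ⟨⟨g, lieGroup_le _ _ _ hg⟩, ?_⟩
  have := tendsto_evGL (deg_ne_zero R hP hV) (isLieFamily_act R V) (one_weight_ne_zero R)
    (image_mem_piece R hP hV) (u := p) (g := ⟨g, lieGroup_le _ _ _ hg⟩)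
    fun k => fil_anti (Nat.le_succ k) (hgp k)
  exact this.congr hp

/-- A homogeneous series comes from a homogeneous element. -/
theorem exists_famSer_eq (hV : IsStandardGraded R f V) {k : ℕ}
    {X : MvPowerSeries (Idx R) (Module.End ℂ V)}
    (hX : X ∈ lieSeries (imageFamily (gs R) (act R V)))
    (hXk : euler (deg R hP f) X = (k : ℂ) • X) :
    ∃ F, IsHomFamily R (deg R hP f) k F ∧ famSer R (act R V) F = X ∧
      (F.sum fun _ y => y) ∈ gPiece R f k := by
  obtain ⟨c, hc, hc0⟩ := exists_ser_eq hX
  have hw : ∀ β, c.comp β ≠ 0 → Finsupp.weight (deg R hP f) β = k := by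
    intro β hβ
    have h1 := congrArg (coeff β) hXk
    rw [coeff_euler, coeff_smul', ← sub_eq_zero, ← sub_smul, smul_eq_zero, sub_eq_zero] at h1
    exact_mod_cast h1.resolve_right fun h => hβ (hc0 β h)
  let F := Finsupp.onFinset (box (deg_ne_zero R hP hV) k) c.comp fun β hβ =>
    mem_box.2 (hw β hβ).le
  have hF : IsHomFamily R (deg R hP f) k F := ⟨c.comp_mem, hw⟩
  refine ⟨F, hF, hc, Submodule.sum_mem _ fun β hβ => ?_⟩
  exact gs_le_gPiece R hP hV (by rw [hF.weight_eq β (Finsupp.mem_support_iff.1 hβ)]) (hF.mem β)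

/-- If `u` agrees with `g` in degrees up to `k`, then multiplication by the exponential of an
element of degree `k + 1` yields agreement in degree `k + 1`. -/
theorem exists_ordered_step {g u : serGroup R V} {k : ℕ}
    (h : (g.1 : MvPowerSeries (Idx R) (Module.End ℂ V)) - u.1 ∈ fil (deg R hP f) (k + 1)) :
    ∃ (x : gPiece R f ((k : ℤ) + 1)) (u' : serGroup R V),
      toGL R hP hV u' = expRho R f V (by lia) x * toGL R hP hV u ∧
      (g.1 : MvPowerSeries (Idx R) (Module.End ℂ V)) - u'.1 ∈ fil (deg R hP f) (k + 1 + 1) := by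
  have hn := deg_ne_zero R hP hV
  obtain ⟨X, hX, hXk, hstep⟩ := exists_step (isLieFamily_act R V) hn
    (lieGroup_le _ _ hn g.2) (lieGroup_le _ _ hn u.2) (Nat.succ_ne_zero k) h
  obtain ⟨F, hF, rfl, hFk⟩ := exists_famSer_eq R hP hV hX hXk
  rw [Nat.cast_succ] at hFk
  let w : serGroup R V := ⟨_, expUnit_famSer_mem R (Nat.succ_ne_zero k) hn hF⟩
  refine ⟨⟨_, hFk⟩, w * u, ?_, hstep w.1 ?_⟩
  · rw [map_mul, toGL_eq_expRho R hP hV (by lia) (Nat.cast_succ k).symm hF ⟨_, hFk⟩ rfl w rfl]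
  · exact expSer_sub_one_sub_mem_fil hn (Nat.succ_ne_zero k) (mem_fil_of_euler_eq hXk)

/-- Every element of the group of series acts as an infinite ordered product, whose factors are
found one degree at a time. -/
theorem exists_isOrderedProd (g : serGroup R V) :
    ∃ x, IsOrderedProd R f V x (toGL R hP hV g) := by
  let S : ℕ → Type _ := fun k => {u : serGroup R V //
    (g.1 : MvPowerSeries (Idx R) (Module.End ℂ V)) - u.1 ∈ fil (deg R hP f) (k + 1)}
  have step : ∀ (k : ℕ) (u : S k), ∃ (x : gPiece R f ((k : ℤ) + 1)) (u' : S (k + 1)),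
      toGL R hP hV u'.1 = expRho R f V (by lia) x * toGL R hP hV u.1 := fun k u => by
    obtain ⟨x, u', hu', hgu'⟩ := exists_ordered_step R hP hV u.2
    exact ⟨x, ⟨u', hgu'⟩, hu'⟩
  choose x s hs using step
  let p : ∀ k, S k := fun k => Nat.rec
    ⟨1, sub_one_mem_fil (deg_ne_zero R hP hV) g.2.1⟩ (fun k u => s k u) k
  have hp : ∀ k, toGL R hP hV (p k).1 = partialProd R f V (fun k => x k (p k)) k := by
    intro k
    induction k with
    | zero => exact map_one _
    | succ k ih =>
      change toGL R hP hV (s k (p k)).1 = expRho R f V _ (x k (p k)) * partialProd R f V _ k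
      rw [hs, ih]
  refine ⟨fun k => x k (p k), ?_⟩
  have := tendsto_evGL (deg_ne_zero R hP hV) (isLieFamily_act R V) (one_weight_ne_zero R)
    (image_mem_piece R hP hV) (u := fun k => (p k).1) (g := g)
    fun k => fil_anti (Nat.le_succ k) (p k).2
  exact this.congr hp

theorem uHat_eq_range : uHat R f V = Set.range (toGL R hP hV) := by
  ext g
  constructor
  · rintro ⟨x, hx⟩
    obtain ⟨u, hu⟩ := exists_tendsto_partialProd R hP hV x
    exact ⟨u, tendsto_nhds_unique hu hx⟩
  · rintro ⟨u, rfl⟩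
    exact exists_isOrderedProd R hP hV u

end Action

/-! ### The closure of the group generated by the simple root exponentials -/

section Closure

variable {ι : Type*} [Fintype ι] {A : Matrix ι ι ℤ} {H : Type*} [AddCommGroup H] [Module ℂ H]
  (R : Realization A H) {P : AddSubgroup (Module.Dual ℂ H)} {f : P →+ ℤ}
  {V : Type*} [AddCommGroup V] [Module ℂ V] [LieRingModule (KMAlgebra R) V]
  [LieModule ℂ (KMAlgebra R) V]

theorem iSup_piece (hV : IsStandardGraded R f V) : ⨆ m, piece R f V m = ⊤ := by
  rw [eq_top_iff, ← hV.iSup_weightSpace]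
  refine iSup_le fun μ => ?_
  by_cases h : weightSpace R V μ = ⊥
  · rw [h]
    exact bot_le
  · have hμ : μ ∈ P := hV.wts_subset h
    exact le_iSup_of_le (f ⟨μ, hμ⟩) (le_iSup₂_of_le
      (f := fun (ν : P) (_ : f ν = f ⟨μ, hμ⟩) => weightSpace R V ν) ⟨μ, hμ⟩ rfl le_rfl)

/-- Elements of positive degree that act as zero on all homogeneous components are zero. -/
theorem eq_zero_of_act_eq_zero (hV : IsStandardGraded R f V) (hVf : NPlusFaithful R V)
    {n : Idx R → ℕ} (hn : ∀ i, n i ≠ 0) (k : ℕ) (hk : k ≠ 0)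
    (x : ∀ β : {β : Idx R →₀ ℕ // Finsupp.weight n β = k}, gs R β)
    (hx : ∀ (m : ℤ), ∀ v ∈ piece R f V m, ∑ᶠ β, act R V (x β) v = 0) : x = 0 := by
  have := finite_fiber hn k
  have hfint : Fintype {β : Idx R →₀ ℕ // Finsupp.weight n β = k} := Fintype.ofFinite _
  have hfib : ∀ β : {β : Idx R →₀ ℕ // Finsupp.weight n β = k}, β.1 ≠ 0 := by
    rintro ⟨β, hβ⟩ rfl
    exact hk (by simpa using hβ.symm)
  have h1 : ∑ β, (x β : KMAlgebra R) = 0 := by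
    refine hVf _ (sum_mem fun β _ => gs_le_nPlus R (hfib β) (x β).2) fun v => ?_
    have hle : ⨆ m, piece R f V m ≤ LinearMap.ker (act R V (∑ β, (x β : KMAlgebra R))) := by
      refine iSup_le fun m w hw => ?_
      rw [LinearMap.mem_ker, map_sum, LinearMap.sum_apply, ← finsum_eq_sum_of_fintype]
      exact hx m w hw
    rw [iSup_piece R hV] at hle
    exact hle (Submodule.mem_top (x := v))
  have h2 := (iSupIndep_gs R).comp (Subtype.val_injective (p := fun β => Finsupp.weight n β = k))
  funext β
  exact Subtype.ext ((iSupIndep_iff_finsetSum_eq_zero_imp_eq_zero _).1 h2 Finset.univ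
    (fun β => (x β : KMAlgebra R)) (fun β _ => (x β).2) h1 β (Finset.mem_univ β))

variable (hP : ∀ i, R.root i ∈ P) (hV : IsStandardGraded R f V)

/-- The coordinates on the complete unipotent group given by the logarithmic derivative. -/
def coord : NHat (gs R) → GLV R f V :=
  param (one_weight_ne_zero R) (deg_ne_zero R hP hV) (isLieFamily_act R V)
    (image_mem_piece R hP hV)

theorem exists_coord_leftInverse (hVf : NPlusFaithful R V) : ∃ κ : GLV R f V → NHat (gs R),
    Continuous κ ∧ Function.LeftInverse κ (coord R hP hV) :=
  exists_continuous_leftInverse (one_weight_ne_zero R) (deg_ne_zero R hP hV) (isLieFamily_act R V)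
    (image_mem_piece R hP hV) (fun _ => finiteDimensional_gs R)
    (eq_zero_of_act_eq_zero R hV hVf (deg_ne_zero R hP hV))

theorem continuous_coord : Continuous (coord R hP hV) :=
  continuous_param (one_weight_ne_zero R) (deg_ne_zero R hP hV) (isLieFamily_act R V)
    (image_mem_piece R hP hV) fun _ => finiteDimensional_gs R

theorem range_coord : Set.range (coord R hP hV) = Set.range (toGL R hP hV) :=
  (solUnit_surjective (one_weight_ne_zero R) (isLieFamily_act R V)).range_comp (toGL R hP hV)

/-- The coordinates are a closed embedding, because they have a continuous left inverse. -/
theorem isClosedEmbedding_coord (hVf : NPlusFaithful R V) :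
    IsClosedEmbedding (coord R hP hV) := by
  obtain ⟨κ, hκ, hinv⟩ := exists_coord_leftInverse R hP hV hVf
  exact hinv.isClosedEmbedding hκ (continuous_coord R hP hV)

theorem uPlus_le_range : uPlus R f V ≤ (toGL R hP hV).range := by
  refine (Subgroup.closure_le _).2 ?_
  rintro _ ⟨i, t, k, hk, hx, rfl⟩
  obtain ⟨u, hu, _⟩ := exists_toGL_eq_expRho R hP hV hk ⟨_, hx⟩
  exact ⟨u, hu⟩

/-- The series that act through the group generated by the simple root exponentials. -/
def simpleGroup : Subgroup (MvPowerSeries (Idx R) (Module.End ℂ V))ˣ :=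
  ((uPlus R f V).comap (toGL R hP hV)).map (serGroup R V).subtype

theorem simpleGroup_le : simpleGroup R hP hV ≤ serGroup R V := by
  rintro _ ⟨u, _, rfl⟩
  exact u.2

theorem monomial_mem_fil {σ 𝒜 : Type*} [Ring 𝒜] [Algebra ℂ 𝒜] {n : σ → ℕ} {β : σ →₀ ℕ} {k : ℕ}
    (h : Finsupp.weight n β = k) (a : 𝒜) : monomial β a ∈ fil n k := by
  classical
  intro γ hγ
  rw [coeff_monomial, if_neg]
  rintro rfl
  exact hγ.ne h

/-- Every iterated bracket of the `e_i` is the leading term of an iterated group commutator of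
simple root exponentials. -/
theorem exists_mem_simpleGroup_nest (l : List (Idx R)) (hl : l ≠ []) (t : ℂ) :
    ∃ u ∈ simpleGroup R hP hV, (u : MvPowerSeries (Idx R) (Module.End ℂ V)) - 1 -
      monomial (content l) (act R V (t • nest (fun i : Idx R => eVec R i) l)) ∈
        fil (deg R hP f) (Finsupp.weight (deg R hP f) (content l) + 1) := by
  classical
  have hn := deg_ne_zero R hP hV
  have base : ∀ (i : Idx R) (t : ℂ), ∃ u ∈ simpleGroup R hP hV,
      (u : MvPowerSeries (Idx R) (Module.End ℂ V)) - 1 -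
        monomial (Finsupp.single i 1) (act R V (t • eVec R i)) ∈
          fil (deg R hP f) (deg R hP f i + 1) := by
    intro i t
    have hw : Finsupp.weight (deg R hP f) (Finsupp.single i 1) = deg R hP f i := by
      simp [Finsupp.weight_single]
    have hrt : rt R (Finsupp.single i 1) = R.root i := by simp [rt, Finsupp.weight_single]
    have hmem : t • eVec R i ∈ gs R (Finsupp.single i 1) := by
      rw [gs, hrt]
      exact Submodule.smul_mem _ _ (eVec_mem R i)
    let F : (Idx R →₀ ℕ) →₀ KMAlgebra R := Finsupp.single (Finsupp.single i 1) (t • eVec R i)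
    have hF : IsHomFamily R (deg R hP f) (deg R hP f i) F := by
      refine ⟨fun β => ?_, fun β hβ => ?_⟩
      · by_cases h : Finsupp.single i 1 = β
        · rw [← h, Finsupp.single_eq_same]
          exact hmem
        · rw [Finsupp.single_eq_of_ne' h]
          exact zero_mem _
      · by_cases h : Finsupp.single i 1 = β
        · rw [← h, hw]
        · exact absurd (Finsupp.single_eq_of_ne' h) hβ
    have hser : famSer R (act R V) F =
        monomial (Finsupp.single i 1) (act R V (t • eVec R i)) := by
      ext1 β
      rw [coeff_famSer, coeff_monomial]
      split_ifs with h
      · rw [h, Finsupp.single_eq_same]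
      · rw [Finsupp.single_eq_of_ne h, map_zero]
    have hsum : (F.sum fun _ y => y) = t • eVec R i := Finsupp.sum_single_index rfl
    have hpos : 0 < (deg R hP f i : ℤ) := by
      have := hn i
      lia
    refine ⟨_, ⟨⟨_, expUnit_famSer_mem R (hn i) hn hF⟩, ?_, rfl⟩, ?_⟩
    · change toGL R hP hV _ ∈ uPlus R f V
      rw [toGL_eq_expRho R hP hV hpos rfl hF
        ⟨t • eVec R i, gs_le_gPiece R hP hV (by rw [hw]) hmem⟩ hsum _ rfl]
      exact Subgroup.subset_closure ⟨i, t, _, hpos, _, rfl⟩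
    · have := expSer_sub_one_sub_mem_fil hn (hn i)
        (mem_fil_of_euler_eq (euler_famSer R (act R V) hF))
      rw [← hser]
      exact this
  induction l generalizing t with
  | nil => exact absurd rfl hl
  | cons i l ih =>
    by_cases hl' : l = []
    · subst hl'
      have hc : content [i] = Finsupp.single i 1 := by simp [content]
      have hw : Finsupp.weight (deg R hP f) (Finsupp.single i 1) = deg R hP f i := by
        simp [Finsupp.weight_single]
      rw [hc, hw]
      exact base i t
    · obtain ⟨u, hu, hu'⟩ := base i t
      obtain ⟨v, hv, hv'⟩ := ih hl' 1
      have hc : content (i :: l) = Finsupp.single i 1 + content l := by simp [content]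
      have hw : Finsupp.weight (deg R hP f) (Finsupp.single i 1) = deg R hP f i := by
        simp [Finsupp.weight_single]
      have h := commutator_sub_one_sub_mem_fil hn (simpleGroup_le R hP hV hu).1
        (simpleGroup_le R hP hV hv).1 (monomial_mem_fil hw _) (monomial_mem_fil rfl _) hu' hv'
      refine ⟨_, mul_mem (mul_mem (mul_mem hu hv) (inv_mem hu)) (inv_mem hv), ?_⟩
      have e : monomial (content (i :: l))
          (act R V (t • nest (fun i : Idx R => eVec R i) (i :: l))) =
          monomial (Finsupp.single i 1) (act R V (t • eVec R i)) *
            monomial (content l) (act R V ((1 : ℂ) • nest (fun i : Idx R => eVec R i) l)) -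
          monomial (content l) (act R V ((1 : ℂ) • nest (fun i : Idx R => eVec R i) l)) *
            monomial (Finsupp.single i 1) (act R V (t • eVec R i)) := by
        rw [monomial_mul_monomial, monomial_mul_monomial, add_comm (content l), ← map_sub,
          ← isLieRep_act, one_smul, smul_lie, ← hc, ← lie_nest i hl']
      rw [e, hc, map_add, hw]
      exact h

/-- Every element of a positive root space is the leading term of an element of `U⁺_V`. -/
theorem exists_mem_simpleGroup_monomial {β : Idx R →₀ ℕ} (hβ : β ≠ 0) {y : KMAlgebra R}
    (hy : y ∈ gs R β) : ∃ u ∈ simpleGroup R hP hV,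
      (u : MvPowerSeries (Idx R) (Module.End ℂ V)) - 1 - monomial β (act R V y) ∈
        fil (deg R hP f) (Finsupp.weight (deg R hP f) β + 1) := by
  have hn := deg_ne_zero R hP hV
  suffices h : ∀ t : ℂ, ∃ u ∈ simpleGroup R hP hV,
      (u : MvPowerSeries (Idx R) (Module.End ℂ V)) - 1 - monomial β (act R V (t • y)) ∈
        fil (deg R hP f) (Finsupp.weight (deg R hP f) β + 1) by
    simpa using h 1
  have hy' := gs_le_span R hβ hy
  clear hy
  induction hy' using Submodule.span_induction with
  | mem z hz =>
    obtain ⟨l, rfl, rfl⟩ := hz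
    refine exists_mem_simpleGroup_nest R hP hV l ?_
    rintro rfl
    exact hβ rfl
  | zero => exact fun t => ⟨1, one_mem _, by simp⟩
  | add z w _ _ hz hw =>
    intro t
    obtain ⟨u, hu, hu'⟩ := hz t
    obtain ⟨v, hv, hv'⟩ := hw t
    refine ⟨u * v, mul_mem hu hv, ?_⟩
    rw [smul_add, map_add, map_add]
    exact mul_sub_one_sub_mem_fil (weight_ne_zero hn hβ) (monomial_mem_fil rfl _)
      (monomial_mem_fil rfl _) hu' hv'
  | smul c z _ hz =>
    intro t
    rw [smul_smul]
    exact hz _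

theorem exists_mem_simpleGroup {k : ℕ} (hk : k ≠ 0)
    {X : MvPowerSeries (Idx R) (Module.End ℂ V)}
    (hX : X ∈ lieSeries (imageFamily (gs R) (act R V)))
    (hXk : euler (deg R hP f) X = (k : ℂ) • X) : ∃ u ∈ simpleGroup R hP hV,
      (u : MvPowerSeries (Idx R) (Module.End ℂ V)) - 1 - X ∈ fil (deg R hP f) (k + 1) := by
  classical
  obtain ⟨F, hF, rfl, _⟩ := exists_famSer_eq R hP hV hX hXk
  have h : ∀ s ⊆ F.support, ∃ u ∈ simpleGroup R hP hV,
      (u : MvPowerSeries (Idx R) (Module.End ℂ V)) - 1 -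
        ∑ β ∈ s, monomial β (act R V (F β)) ∈ fil (deg R hP f) (k + 1) := by
    intro s
    induction s using Finset.induction_on with
    | empty => exact fun _ => ⟨1, one_mem _, by simp⟩
    | insert β s hβ ih =>
      intro hs
      have hw : ∀ γ ∈ insert β s, Finsupp.weight (deg R hP f) γ = k := fun γ hγ =>
        hF.weight_eq γ (Finsupp.mem_support_iff.1 (hs hγ))
      have hβ0 : β ≠ 0 := by
        rintro rfl
        have := hw 0 (Finset.mem_insert_self _ _)
        rw [map_zero] at this
        exact hk this.symm
      obtain ⟨u, hu, hu'⟩ := ih fun γ hγ => hs (Finset.mem_insert_of_mem hγ)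
      obtain ⟨v, hv, hv'⟩ := exists_mem_simpleGroup_monomial R hP hV hβ0 (hF.mem β)
      rw [hw β (Finset.mem_insert_self _ _)] at hv'
      refine ⟨v * u, mul_mem hv hu, ?_⟩
      rw [Finset.sum_insert hβ]
      exact mul_sub_one_sub_mem_fil hk (monomial_mem_fil (hw β (Finset.mem_insert_self _ _)) _)
        (sum_mem fun γ hγ => monomial_mem_fil (hw γ (Finset.mem_insert_of_mem hγ)) _) hv' hu'
  obtain ⟨u, hu, hu'⟩ := h F.support subset_rfl
  refine ⟨u, hu, ?_⟩
  have e : famSer R (act R V) F = ∑ β ∈ F.support, monomial β (act R V (F β)) := by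
    ext1 γ
    rw [coeff_famSer, map_sum]
    simp only [coeff_monomial]
    rw [Finset.sum_ite_eq]
    split_ifs with h
    · rfl
    · rw [Finsupp.notMem_support_iff.1 h, map_zero]
  rw [e]
  exact hu'

theorem range_toGL_eq_closure (hVf : NPlusFaithful R V) :
    Set.range (toGL R hP hV) = closure (uPlus R f V : Set (GLV R f V)) := by
  have hn := deg_ne_zero R hP hV
  refine subset_antisymm ?_ (closure_minimal (uPlus_le_range R hP hV) ?_)
  · rintro _ ⟨g, rfl⟩
    have happ := exists_approx (isLieFamily_act R V) hn (simpleGroup R hP hV)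
      (fun u hu => lieGroup_le _ _ hn (simpleGroup_le R hP hV hu))
      (fun k hk X hX hXk => exists_mem_simpleGroup R hP hV hk hX hXk) (lieGroup_le _ _ hn g.2)
    choose u hu hgu using happ
    choose w hw hwu using hu
    refine mem_closure_of_tendsto (tendsto_evGL hn (isLieFamily_act R V) (one_weight_ne_zero R)
      (image_mem_piece R hP hV) (u := w) (g := g) fun k => ?_) (Eventually.of_forall hw)
    have : (w k).1 = u k := hwu k
    rw [this]
    exact fil_anti (Nat.le_succ k) (hgu k)
  · rw [← range_coord]
    exact (isClosedEmbedding_coord R hP hV hVf).isClosed_range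

end Closure

/-! ### Comparison of two representations -/

section Compare

variable {ι : Type*} [Fintype ι] {A : Matrix ι ι ℤ} {H : Type*} [AddCommGroup H] [Module ℂ H]
  (R : Realization A H)

section Pair

variable {𝒜 ℬ : Type*} [Ring 𝒜] [Algebra ℂ 𝒜] [Ring ℬ] [Algebra ℂ ℬ]
  {φ : KMAlgebra R →ₗ[ℂ] 𝒜} {ψ : KMAlgebra R →ₗ[ℂ] ℬ}

theorem isLieRep_prod (hφ : IsLieRep φ) (hψ : IsLieRep ψ) : IsLieRep (φ.prod ψ) := fun x y =>
  Prod.ext (hφ x y) (hψ x y)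

theorem map_fst_sol {n : Idx R → ℕ} (hn : ∀ i, n i ≠ 0) (c : NHat (gs R)) :
    MvPowerSeries.map (AlgHom.fst ℂ 𝒜 ℬ : 𝒜 × ℬ →+* 𝒜) (sol n (ser (φ.prod ψ) c)) =
      sol n (ser φ c) :=
  map_sol (AlgHom.fst ℂ 𝒜 ℬ) hn (constantCoeff_ser _ c)

theorem map_snd_sol {n : Idx R → ℕ} (hn : ∀ i, n i ≠ 0) (c : NHat (gs R)) :
    MvPowerSeries.map (AlgHom.snd ℂ 𝒜 ℬ : 𝒜 × ℬ →+* ℬ) (sol n (ser (φ.prod ψ) c)) =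
      sol n (ser ψ c) :=
  map_sol (AlgHom.snd ℂ 𝒜 ℬ) hn (constantCoeff_ser _ c)

/-- The multiplication in terms of logarithmic derivatives is the same in all representations: a
product of solutions for `φ × ψ` is again a solution, with one logarithmic derivative for both
components. -/
theorem exists_sol_mul (hφ : IsLieRep φ) (hψ : IsLieRep ψ) {n : Idx R → ℕ} (hn : ∀ i, n i ≠ 0)
    (c d : NHat (gs R)) : ∃ e : NHat (gs R),
      sol n (ser φ c) * sol n (ser φ d) = sol n (ser φ e) ∧
      sol n (ser ψ c) * sol n (ser ψ d) = sol n (ser ψ e) := by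
  have hL := isLieFamily_imageFamily (isLieRep_prod R hφ hψ) (lie_mem_gs R)
  obtain ⟨e, he⟩ := solUnit_surjective hn hL (solUnit hn hL c * solUnit hn hL d)
  have h : sol n (ser (φ.prod ψ) e) = sol n (ser (φ.prod ψ) c) * sol n (ser (φ.prod ψ) d) :=
    congrArg (fun u : lieGroup hL hn => (u.1 : MvPowerSeries (Idx R) (𝒜 × ℬ))) he
  refine ⟨e, ?_, ?_⟩
  · rw [← map_fst_sol (ψ := ψ) R hn e, h, map_mul, map_fst_sol R hn, map_fst_sol R hn]
  · rw [← map_snd_sol (φ := φ) R hn e, h, map_mul, map_snd_sol R hn, map_snd_sol R hn]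

/-- The logarithmic derivative of an exponential is the same in all representations. -/
theorem exists_sol_eq_expSer (hφ : IsLieRep φ) (hψ : IsLieRep ψ) {n : Idx R → ℕ}
    (hn : ∀ i, n i ≠ 0) {n' : Idx R → ℕ} (hn' : ∀ i, n' i ≠ 0) {k : ℕ} (hk : k ≠ 0)
    {F : (Idx R →₀ ℕ) →₀ KMAlgebra R} (hF : IsHomFamily R n' k F) : ∃ e : NHat (gs R),
      sol n (ser φ e) = expSer (famSer R φ F) ∧ sol n (ser ψ e) = expSer (famSer R ψ F) := by
  have hL := isLieFamily_imageFamily (isLieRep_prod R hφ hψ) (lie_mem_gs R)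
  have hX := famSer_mem_lieSeries R (φ.prod ψ) hk hF
  obtain ⟨e, he⟩ := solUnit_surjective hn hL ⟨_, lieGroup_le _ hn' _
    (expUnit_mem_lieGroup hL hn' hX (euler_famSer R (φ.prod ψ) hF))⟩
  have h : sol n (ser (φ.prod ψ) e) = expSer (famSer R (φ.prod ψ) F) :=
    congrArg (fun u : lieGroup hL hn => (u.1 : MvPowerSeries (Idx R) (𝒜 × ℬ))) he
  refine ⟨e, ?_, ?_⟩
  · rw [← map_fst_sol (ψ := ψ) R hn e, h, map_expSer (AlgHom.fst ℂ 𝒜 ℬ) hX.1]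
    rfl
  · rw [← map_snd_sol (φ := φ) R hn e, h, map_expSer (AlgHom.snd ℂ 𝒜 ℬ) hX.1]
    rfl

end Pair

variable {P : AddSubgroup (Module.Dual ℂ H)} (hP : ∀ i, R.root i ∈ P) {f : P →+ ℤ}
  {V : Type*} [AddCommGroup V] [Module ℂ V] [LieRingModule (KMAlgebra R) V]
  [LieModule ℂ (KMAlgebra R) V] (hV : IsStandardGraded R f V) (hVf : NPlusFaithful R V)

theorem coord_mul {c d e : NHat (gs R)}
    (h : sol (fun _ => 1) (ser (act R V) c) * sol (fun _ => 1) (ser (act R V) d) =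
      sol (fun _ => 1) (ser (act R V) e)) :
    coord R hP hV c * coord R hP hV d = coord R hP hV e := by
  refine (map_mul (toGL R hP hV) _ _).symm.trans (congrArg (toGL R hP hV) ?_)
  exact Subtype.ext (Units.ext h)

theorem coord_eq_expRho {k : ℤ} (hk : 0 < k) {k' : ℕ} (hkk' : k = k')
    {F : (Idx R →₀ ℕ) →₀ KMAlgebra R} (hF : IsHomFamily R (deg R hP f) k' F) (x : gPiece R f k)
    (hx : (F.sum fun _ y => y) = x) {e : NHat (gs R)}
    (h : sol (fun _ => 1) (ser (act R V) e) = expSer (famSer R (act R V) F)) :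
    coord R hP hV e = expRho R f V hk x :=
  toGL_eq_expRho R hP hV hk hkk' hF x hx
    (solUnit (one_weight_ne_zero R) (isLieFamily_act R V) e) h

/-- The coordinates as a homeomorphism onto the complete unipotent group. -/
def coordHomeomorph : NHat (gs R) ≃ₜ (toGL R hP hV).range :=
  ((isClosedEmbedding_coord R hP hV hVf).isEmbedding.toHomeomorph).trans
    (Homeomorph.setCongr (range_coord R hP hV))

theorem coe_coordHomeomorph (c : NHat (gs R)) :
    (coordHomeomorph R hP hV hVf c : GLV R f V) = coord R hP hV c := rfl

variable {P' : AddSubgroup (Module.Dual ℂ H)} (hP' : ∀ i, R.root i ∈ P') {f' : P' →+ ℤ}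
  {W : Type*} [AddCommGroup W] [Module ℂ W] [LieRingModule (KMAlgebra R) W]
  [LieModule ℂ (KMAlgebra R) W] (hW : IsStandardGraded R f' W) (hWf : NPlusFaithful R W)

/-- The isomorphism of the complete unipotent groups of two modules that preserves logarithmic
derivatives. -/
def compareEquiv : (toGL R hP hV).range ≃ₜ* (toGL R hP' hW).range :=
  { (coordHomeomorph R hP hV hVf).symm.trans (coordHomeomorph R hP' hW hWf) with
    map_mul' := fun g h => by
      obtain ⟨c, rfl⟩ := (coordHomeomorph R hP hV hVf).surjective g
      obtain ⟨d, rfl⟩ := (coordHomeomorph R hP hV hVf).surjective h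
      obtain ⟨e, heV, heW⟩ := exists_sol_mul R (isLieRep_act R V) (isLieRep_act R W)
        (one_weight_ne_zero R) c d
      have h1 : coordHomeomorph R hP hV hVf c * coordHomeomorph R hP hV hVf d =
          coordHomeomorph R hP hV hVf e := Subtype.ext (coord_mul R hP hV heV)
      have h2 : coordHomeomorph R hP' hW hWf c * coordHomeomorph R hP' hW hWf d =
          coordHomeomorph R hP' hW hWf e := Subtype.ext (coord_mul R hP' hW heW)
      change coordHomeomorph R hP' hW hWf ((coordHomeomorph R hP hV hVf).symm _) =
        coordHomeomorph R hP' hW hWf ((coordHomeomorph R hP hV hVf).symm _) *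
        coordHomeomorph R hP' hW hWf ((coordHomeomorph R hP hV hVf).symm _)
      rw [h1, Homeomorph.symm_apply_apply, Homeomorph.symm_apply_apply,
        Homeomorph.symm_apply_apply, h2] }

theorem compareEquiv_coord (c : NHat (gs R)) :
    compareEquiv R hP hV hVf hP' hW hWf (coordHomeomorph R hP hV hVf c) =
      coordHomeomorph R hP' hW hWf c :=
  congrArg (coordHomeomorph R hP' hW hWf)
    ((coordHomeomorph R hP hV hVf).symm_apply_apply c)

theorem compareEquiv_expRho {k k' : ℤ} (hk : 0 < k) (hk' : 0 < k') {x : KMAlgebra R}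
    (hx : x ∈ gPiece R f k) (hx' : x ∈ gPiece R f' k') :
    ∃ hmem : expRho R f V hk ⟨x, hx⟩ ∈ (toGL R hP hV).range,
      (compareEquiv R hP hV hVf hP' hW hWf ⟨expRho R f V hk ⟨x, hx⟩, hmem⟩ : GLV R f' W) =
        expRho R f' W hk' ⟨x, hx'⟩ := by
  obtain ⟨j, rfl⟩ := Int.eq_ofNat_of_zero_le hk.le
  obtain ⟨j', rfl⟩ := Int.eq_ofNat_of_zero_le hk'.le
  obtain ⟨F, hF, hFx⟩ := exists_isHomFamily R hP hV (by lia) hx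
  obtain ⟨F', hF', hFx'⟩ := exists_isHomFamily R hP' hW (by lia) hx'
  -- the components of `x` in the root spaces do not depend on the grading
  obtain rfl : F = F' := eq_of_sum_eq R hF.mem hF'.mem (hFx.trans hFx'.symm)
  obtain ⟨e, heV, heW⟩ := exists_sol_eq_expSer R (isLieRep_act R V) (isLieRep_act R W)
    (one_weight_ne_zero R) (deg_ne_zero R hP hV) (by lia) hF
  have h1 := coord_eq_expRho R hP hV hk rfl hF ⟨x, hx⟩ hFx heV
  have h2 := coord_eq_expRho R hP' hW hk' rfl hF' ⟨x, hx'⟩ hFx' heW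
  have hmem : expRho R f V hk ⟨x, hx⟩ ∈ (toGL R hP hV).range :=
    h1 ▸ (coordHomeomorph R hP hV hVf e).2
  refine ⟨hmem, ?_⟩
  have h3 : (⟨_, hmem⟩ : (toGL R hP hV).range) = coordHomeomorph R hP hV hVf e :=
    Subtype.ext h1.symm
  rw [h3, compareEquiv_coord, coe_coordHomeomorph, h2]

theorem exists_smul_eVec_mem_gPiece (hP : ∀ i, R.root i ∈ P)
    (hV : IsStandardGraded R f V) (i : ι) (t : ℂ) :
    ∃ k : ℤ, 0 < k ∧ t • eVec R i ∈ gPiece R f k := by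
  by_cases hi : eVec R i = 0
  · exact ⟨1, one_pos, by rw [hi, smul_zero]; exact zero_mem _⟩
  · exact ⟨f ⟨R.root i, hP i⟩, degree_root_pos R hP hV ⟨i, hi⟩,
      (le_iSup₂_of_le (f := fun (μ : P) (_ : f μ = f ⟨R.root i, hP i⟩) => rootSpace R μ)
        ⟨R.root i, hP i⟩ rfl le_rfl) (Submodule.smul_mem _ t (eVec_mem R i))⟩

/-- A continuous homomorphism on the closure of `U⁺_V` is determined by its values on the
exponentials of the multiples of the `e_i`. -/
theorem eq_of_eq_expRho {G' : Type*} [Group G'] [TopologicalSpace G'] [T2Space G']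
    {Φ Ψ : (toGL R hP hV).range →* G'} (hΦ : Continuous Φ) (hΨ : Continuous Ψ)
    (h : ∀ (i : ι) (t : ℂ) (k : ℤ) (hk : 0 < k) (hx : t • eVec R i ∈ gPiece R f k)
      (hmem : expRho R f V hk ⟨t • eVec R i, hx⟩ ∈ (toGL R hP hV).range),
      Φ ⟨_, hmem⟩ = Ψ ⟨_, hmem⟩)
    (hVf : NPlusFaithful R V) : Φ = Ψ := by
  have hle : uPlus R f V ≤ (Φ.eqLocus Ψ).map (toGL R hP hV).range.subtype := by
    refine (Subgroup.closure_le _).2 ?_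
    rintro _ ⟨i, t, k, hk, hx, rfl⟩
    have hmem : expRho R f V hk ⟨t • eVec R i, hx⟩ ∈ (toGL R hP hV).range :=
      uPlus_le_range R hP hV (Subgroup.subset_closure ⟨i, t, k, hk, hx, rfl⟩)
    exact ⟨⟨_, hmem⟩, h i t k hk hx hmem, rfl⟩
  have hdense : Dense {g : (toGL R hP hV).range | Φ g = Ψ g} := by
    intro g
    rw [IsInducing.subtypeVal.closure_eq_preimage_closure_image]
    have hg : (g : GLV R f V) ∈ closure (uPlus R f V : Set (GLV R f V)) := by
      rw [← range_toGL_eq_closure R hP hV hVf]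
      exact g.2
    exact closure_mono hle hg
  exact MonoidHom.ext fun g => congrFun (Continuous.ext_on hdense hΦ hΨ fun _ hg => hg) g

end Compare

end KacMoody

theorem mainTheorem3 {ι : Type*} [Fintype ι] [DecidableEq ι] {A : Matrix ι ι ℤ}
    (hA : KacMoody.IsSymmetrizableGCM A) {H : Type*} [AddCommGroup H] [Module ℂ H]
    (R : KacMoody.Realization A H)
    -- a faithful standard graded module `V`
    {P : AddSubgroup (Module.Dual ℂ H)} (hP : ∀ i, R.root i ∈ P) (f : P →+ ℤ)
    (V : Type*) [AddCommGroup V] [Module ℂ V] [LieRingModule (KacMoody.KMAlgebra R) V]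
    [LieModule ℂ (KacMoody.KMAlgebra R) V]
    (hV : KacMoody.IsStandardGraded R f V) (hVf : KacMoody.NPlusFaithful R V)
    -- a second faithful standard graded module `W`
    {P' : AddSubgroup (Module.Dual ℂ H)} (hP' : ∀ i, R.root i ∈ P') (f' : P' →+ ℤ)
    (W : Type*) [AddCommGroup W] [Module ℂ W] [LieRingModule (KacMoody.KMAlgebra R) W]
    [LieModule ℂ (KacMoody.KMAlgebra R) W]
    (hW : KacMoody.IsStandardGraded R f' W) (hWf : KacMoody.NPlusFaithful R W) :
    -- every infinite ordered product converges
    (∀ x, ∃ g, KacMoody.IsOrderedProd R f V x g) ∧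
    -- the products form a group, which is the closure of `U⁺_V` in `GL(V̂)`
    ∃ UV : Subgroup (KacMoody.GLV R f V), (UV : Set (KacMoody.GLV R f V)) = KacMoody.uHat R f V ∧
      (UV : Set (KacMoody.GLV R f V)) =
        closure (KacMoody.uPlus R f V : Set (KacMoody.GLV R f V)) ∧
    -- for `W` in place of `V` the closure of `U⁺_W` is the same topological group, and
    -- `exp(ρ_V(x))` corresponds to `exp(ρ_W(x))`
    ∃ UW : Subgroup (KacMoody.GLV R f' W), (UW : Set (KacMoody.GLV R f' W)) =
        closure (KacMoody.uPlus R f' W : Set (KacMoody.GLV R f' W)) ∧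
      ∃! Φ : UV ≃ₜ* UW, ∀ (k k' : ℤ) (hk : 0 < k) (hk' : 0 < k') (x : KacMoody.KMAlgebra R)
        (hx : x ∈ KacMoody.gPiece R f k) (hx' : x ∈ KacMoody.gPiece R f' k'),
        ∃ hmem : KacMoody.expRho R f V hk ⟨x, hx⟩ ∈ UV,
          (Φ ⟨KacMoody.expRho R f V hk ⟨x, hx⟩, hmem⟩ : KacMoody.GLV R f' W) =
            KacMoody.expRho R f' W hk' ⟨x, hx'⟩ := by
  refine ⟨fun x => ?_, (KacMoody.toGL R hP hV).range, ?_, ?_, (KacMoody.toGL R hP' hW).range, ?_,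
    KacMoody.compareEquiv R hP hV hVf hP' hW hWf, ?_, ?_⟩
  · obtain ⟨g, hg⟩ := KacMoody.exists_tendsto_partialProd R hP hV x
    exact ⟨_, hg⟩
  · exact (KacMoody.uHat_eq_range R hP hV).symm
  · exact KacMoody.range_toGL_eq_closure R hP hV hVf
  · exact KacMoody.range_toGL_eq_closure R hP' hW hWf
  · intro k k' hk hk' x hx hx'
    exact KacMoody.compareEquiv_expRho R hP hV hVf hP' hW hWf hk hk' hx hx'
  · intro Ψ hΨ
    have key : Ψ.toMulEquiv.toMonoidHom =
        (KacMoody.compareEquiv R hP hV hVf hP' hW hWf).toMulEquiv.toMonoidHom := by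
      refine KacMoody.eq_of_eq_expRho R hP hV Ψ.continuous
        (KacMoody.compareEquiv R hP hV hVf hP' hW hWf).continuous
        (fun i t k hk hx hmem => Subtype.ext ?_) hVf
      obtain ⟨k', hk', hx'⟩ := KacMoody.exists_smul_eVec_mem_gPiece R hP' hW i t
      obtain ⟨_, h1⟩ := hΨ k k' hk hk' _ hx hx'
      obtain ⟨_, h2⟩ := KacMoody.compareEquiv_expRho R hP hV hVf hP' hW hWf hk hk' hx hx'
      exact h1.trans h2.symm
    exact ContinuousMulEquiv.ext fun g => DFunLike.congr_fun key g

end
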